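/- Let $\Bbbk$ be an algebraically closed field of characteristic zero and let $n\ge 1$. **The bicategory.** Let $A=A_n$ be the $\Bbbk$-algebra with basis $e_0,\dots,e_n,a_1,\dots,a_n,b_1,\dots,b_n,c$, where the $e_i$ are orthogonal idempotents with sum $1$, $a_i\in e_iAe_0$, $b_i\in e_0Ae_i$, $c\in e_0Ae_0$, and the only non-zero products of two elements among the $a_i,b_i,c$ are $b_ia_i=c$ (this is the zigzag algebra of the star graph with centre $0$ and leaves $1,\dots,n$, modulo the span of the loops $a_ib_i$ at the leaves). Let $\mathscr B=\mathscr B_n$ be the $\Bbbk$-linear bicategory with one object $\mathtt i$, with 1-morphisms the $A$-$A$-bimodules in $\operatorname{add}\{A,\ Ae_k\otimes_\Bbbk e_0A\mid 0\le k\le n\}$, with 2-morphisms all bimodule homomorphisms, and with composition $G\circ F=G\otimes_AF$. Let $\mathbf{Cat}_\Bbbk$ be the 2-category of small $\Bbbk$-linear categories, $\Bbbk$-linear functors and natural transformations, and $[\mathscr B,\mathbf{Cat}_\Bbbk]_\Bbbk$ the bicategory of $\Bbbk$-linear pseudofunctors (birepresentations), strong transformations and modifications. **The birepresentations.** Let $\mathbf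 P=\mathscr B(\mathtt i,-)$; let $\mathbf N\subseteq\mathbf P$ be the subbirepresentation on $\operatorname{add}\{Ae_k\otimes_\Bbbk e_0A\mid 0\le k\le n\}$ with inclusion $\Gamma:\mathbf N\to\mathbf P$; and let $\mathbf C$ be the cell birepresentation, that is, the category $A\text{-proj}$ of finitely generated projective left $A$-modules with $F$ acting as $F\otimes_A-$. Let $\Theta_j:\mathbf P\to\mathbf C$ be the strong transformation $F\mapsto F\otimes_AAe_j$. For $j,k\in\{1,\dots,n\}$ let $s_{j,k}:\Theta_j\circ\Gamma\cong\Theta_k\circ\Gamma$ be the invertible modification whose component at $N\in\mathbf N(\mathtt i)$ is the composite $N\otimes_AAe_j\cong Ne_j\xrightarrow{\cdot a_j}Nc\xrightarrow{(\cdot a_k)^{-1}}Ne_k\cong N\otimes_AAe_k$ (both right multiplications are isomorphisms onto $Nc$). **The construction.** Let $\mathfrak P$ be a set partition of $\{0,\dots,n\}$ in which $\{0\}$ is a block, and let $\{i^m_1,\dots,i^m_{k_m}\}$, $m=1,\dots,r$, be an enumeration of its other blocks. Let $\mathbf C^{W}(\mathfrak P)$, with a strong transformation $\Omega^W:\mathbf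 C\to\mathbf C^W(\mathfrak P)$ and invertible modifications $\widehat x^m_l:\Omega^W\circ\Theta_{i^m_l}\cong\Omega^W\circ\Theta_{i^m_{l+1}}$ ($1\le m\le r$, $1\le l<k_m$), be the iterated bicategorical coisoinserter of the pairs $\Theta_{i^m_l},\Theta_{i^m_{l+1}}:\mathbf P\to\mathbf C$ in $[\mathscr B,\mathbf{Cat}_\Bbbk]_\Bbbk$. That is, for each $\mathbf M$, composition with $\Omega^W$ is an equivalence from the category of strong transformations $\mathbf C^W(\mathfrak P)\to\mathbf M$ to the category of strong transformations $\Upsilon:\mathbf C\to\mathbf M$ equipped with invertible modifications $\Upsilon\circ\Theta_{i^m_l}\cong\Upsilon\circ\Theta_{i^m_{l+1}}$. Let $\Omega^R:\mathbf C^W(\mathfrak P)\to\mathbf C^{WR}(\mathfrak P)$ be the multiple bicategorical coequifier of all the parallel pairs $\widehat x^m_l\bullet\Gamma$ and $\Omega^W\bullet s_{i^m_l,i^m_{l+1}}$. That is, $\Omega^R$ coequifies these pairs, and for each $\mathbf M$ composition with $\Omega^R$ is an equivalence from the category of strong transformations $\mathbf C^{WR}(\mathfrak P)\to\mathbf M$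 to the full subcategory of those strong transformations $\mathbf C^W(\mathfrak P)\to\mathbf M$ which coequify all of these pairs. **Statement.** These bicategorical colimits exist, and $\mathbf C^{WR}(\mathfrak P)$ (for any choice of the colimits and of the enumeration of the blocks) is simple transitive: it is non-zero; it is finitary, that is, $\mathbf C^{WR}(\mathfrak P)(\mathtt i)$ is equivalent, as a $\Bbbk$-linear category, to the category of finitely generated projective modules over a finite dimensional $\Bbbk$-algebra; and it has no proper $\mathscr B$-stable ideals, that is, if $\mathbf I$ is an ideal of $\mathbf C^{WR}(\mathfrak P)(\mathtt i)$ with $\mathbf C^{WR}(\mathfrak P)(F)(f)\in\mathbf I$ for all $f\in\mathbf I$ and all 1-morphisms $F$ of $\mathscr B$, then $\mathbf I$ is zero or contains all morphisms. -/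

import Mathlib

open CategoryTheory MulOpposite Bicategory
open scoped TensorProduct CategoryTheory.Pseudofunctor.StrongTrans

universe u v w

set_option linter.unusedVariables false
set_option linter.unusedSimpArgs false

noncomputable section

namespace StarBirep

/-- `S`-`R`-bimodules over `k` (with `k` acting centrally): a `k`-vector space with a left action
of `S` and a commuting right action of `R`, both `k`-linear. -/
structure BiMod (k : Type u) [Field k] (S R : Type u) [Ring S] [Algebra k S] [Ring R]
    [Algebra k R] : Type (u + 1) where
  V : Type u
  [addCommGroup : AddCommGroup V]
  [module : Module k V]
  lact : S →ₐ[k] Module.End k V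
  ract : Rᵐᵒᵖ →ₐ[k] Module.End k V
  comm : ∀ (s : S) (r : Rᵐᵒᵖ) (x : V), lact s (ract r x) = ract r (lact s x)

attribute [instance] BiMod.addCommGroup BiMod.module

namespace BiMod

variable {k : Type u} [Field k]

section Hom

variable {S R : Type u} [Ring S] [Algebra k S] [Ring R] [Algebra k R]

/-- Bimodule homomorphisms. -/
@[ext]
structure Hom (M N : BiMod k S R) : Type (u + 1) where
  lin : M.V →ₗ[k] N.V
  map_l : ∀ (s : S) (x : M.V), lin (M.lact s x) = N.lact s (lin x)
  map_r : ∀ (r : Rᵐᵒᵖ) (x : M.V), lin (M.ract r x) = N.ract r (lin x)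

instance : Category.{u + 1} (BiMod k S R) where
  Hom M N := Hom M N
  id M := ⟨LinearMap.id, fun _ _ => rfl, fun _ _ => rfl⟩
  comp f g := ⟨g.lin ∘ₗ f.lin, fun s x => by simp [f.map_l, g.map_l],
    fun s x => by simp [f.map_r, g.map_r]⟩

variable {M N L : BiMod k S R}

@[simp] lemma id_lin : Hom.lin (𝟙 M) = LinearMap.id := rfl
@[simp] lemma comp_lin (f : M ⟶ N) (g : N ⟶ L) :
    Hom.lin (f ≫ g) = (Hom.lin g) ∘ₗ (Hom.lin f) := rfl

lemma hom_ext {f g : M ⟶ N} (h : ∀ x, Hom.lin f x = Hom.lin g x) : f = g :=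
  Hom.ext (LinearMap.ext h)

instance : Add (M ⟶ N) :=
  ⟨fun f g => ⟨Hom.lin f + Hom.lin g, fun s x => by simp [Hom.map_l],
    fun s x => by simp [Hom.map_r]⟩⟩

instance : Zero (M ⟶ N) := ⟨⟨0, fun _ _ => by simp, fun _ _ => by simp⟩⟩

instance : Neg (M ⟶ N) :=
  ⟨fun f => ⟨- Hom.lin f, fun s x => by simp [Hom.map_l], fun s x => by simp [Hom.map_r]⟩⟩

instance : AddCommGroup (M ⟶ N) where
  add_assoc f g h := Hom.ext (add_assoc _ _ _)
  zero_add f := Hom.ext (zero_add _)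
  add_zero f := Hom.ext (add_zero _)
  neg_add_cancel f := Hom.ext (neg_add_cancel _)
  add_comm f g := Hom.ext (add_comm _ _)
  nsmul := nsmulRec
  zsmul := zsmulRec

@[simp] lemma add_lin (f g : M ⟶ N) : Hom.lin (f + g) = Hom.lin f + Hom.lin g := rfl
@[simp] lemma zero_lin : Hom.lin (0 : M ⟶ N) = 0 := rfl

instance : Module k (M ⟶ N) where
  smul c f := ⟨c • Hom.lin f, fun s x => by simp [Hom.map_l], fun s x => by simp [Hom.map_r]⟩
  one_smul f := Hom.ext (one_smul _ _)
  mul_smul a b f := Hom.ext (mul_smul _ _ _)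
  smul_zero a := Hom.ext (smul_zero _)
  smul_add a f g := Hom.ext (smul_add _ _ _)
  add_smul a b f := Hom.ext (add_smul _ _ _)
  zero_smul f := Hom.ext (zero_smul _ _)

@[simp] lemma smul_lin (c : k) (f : M ⟶ N) : Hom.lin (c • f) = c • Hom.lin f := rfl

instance : Preadditive (BiMod k S R) where
  add_comp _ _ _ _ _ _ := hom_ext fun x => by simp
  comp_add _ _ _ _ _ _ := hom_ext fun x => by simp

instance : Linear k (BiMod k S R) where
  smul_comp _ _ _ _ _ _ := hom_ext fun x => by simp
  comp_smul _ _ _ _ _ _ := hom_ext fun x => by simp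

/-- An invertible morphism from a bijective one. -/
def isoOfLinearEquiv (e : M.V ≃ₗ[k] N.V)
    (hl : ∀ (s : S) (x : M.V), e (M.lact s x) = N.lact s (e x))
    (hr : ∀ (r : Rᵐᵒᵖ) (x : M.V), e (M.ract r x) = N.ract r (e x)) : M ≅ N where
  hom := ⟨e.toLinearMap, hl, hr⟩
  inv := ⟨e.symm.toLinearMap, fun s x => by
      apply e.injective; simp [hl], fun s x => by
      apply e.injective; simp [hr]⟩
  hom_inv_id := hom_ext fun x => by simp
  inv_hom_id := hom_ext fun x => by simp

@[simp] lemma isoOfLinearEquiv_hom_lin (e : M.V ≃ₗ[k] N.V) (hl) (hr) :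
    Hom.lin (isoOfLinearEquiv e hl hr).hom = e.toLinearMap := rfl
@[simp] lemma isoOfLinearEquiv_inv_lin (e : M.V ≃ₗ[k] N.V) (hl) (hr) :
    Hom.lin (isoOfLinearEquiv e hl hr).inv = e.symm.toLinearMap := rfl

end Hom

section Tensor

variable {T S R Q : Type u} [Ring T] [Algebra k T] [Ring S] [Algebra k S] [Ring R] [Algebra k R]
  [Ring Q] [Algebra k Q]

/-- The relations `m s ⊗ x = m ⊗ s x`. -/
def tensorRel (M : BiMod k T S) (N : BiMod k S R) : Submodule k (M.V ⊗[k] N.V) :=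
  Submodule.span k {z | ∃ (s : S) (m : M.V) (x : N.V),
    z = (M.ract (op s) m) ⊗ₜ[k] x - m ⊗ₜ[k] (N.lact s x)}

/-- The vector space underlying `M ⊗_S N`, as a quotient of `M ⊗_k N`. -/
abbrev TensorV (M : BiMod k T S) (N : BiMod k S R) : Type u := (M.V ⊗[k] N.V) ⧸ tensorRel M N

/-- Pure tensors. -/
def tm₀ (M : BiMod k T S) (N : BiMod k S R) : M.V →ₗ[k] N.V →ₗ[k] TensorV M N :=
  (TensorProduct.mk k M.V N.V).compr₂ (tensorRel M N).mkQ

lemma tm₀_balanced (M : BiMod k T S) (N : BiMod k S R) (s : S) (m : M.V) (x : N.V) :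
    tm₀ M N (M.ract (op s) m) x = tm₀ M N m (N.lact s x) := by
  simp only [tm₀, LinearMap.compr₂_apply, TensorProduct.mk_apply, Submodule.mkQ_apply]
  rw [Submodule.Quotient.eq]
  exact Submodule.subset_span ⟨s, m, x, rfl⟩

/-- The map induced by a balanced bilinear map. -/
def lift₀ {M : BiMod k T S} {N : BiMod k S R} {W : Type*} [AddCommGroup W] [Module k W]
    (f : M.V →ₗ[k] N.V →ₗ[k] W)
    (hf : ∀ (s : S) (m : M.V) (x : N.V), f (M.ract (op s) m) x = f m (N.lact s x)) :
    TensorV M N →ₗ[k] W :=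
  (tensorRel M N).liftQ (TensorProduct.lift f) (by
    rw [tensorRel, Submodule.span_le]
    rintro _ ⟨s, m, x, rfl⟩
    simp [hf])

@[simp] lemma lift₀_tm₀ {M : BiMod k T S} {N : BiMod k S R} {W : Type*} [AddCommGroup W]
    [Module k W] (f : M.V →ₗ[k] N.V →ₗ[k] W) (hf) (m : M.V) (x : N.V) :
    lift₀ f hf (tm₀ M N m x) = f m x := by
  simp [lift₀, tm₀]

lemma ext₀ {M : BiMod k T S} {N : BiMod k S R} {W : Type*} [AddCommGroup W] [Module k W]
    {f g : TensorV M N →ₗ[k] W} (h : ∀ m x, f (tm₀ M N m x) = g (tm₀ M N m x)) : f = g := by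
  apply Submodule.linearMap_qext
  exact TensorProduct.ext' h

lemma ext₀_apply {M : BiMod k T S} {N : BiMod k S R} {W : Type*} [AddCommGroup W]
    [Module k W] {f g : TensorV M N →ₗ[k] W} (h : ∀ m x, f (tm₀ M N m x) = g (tm₀ M N m x))
    (z : TensorV M N) : f z = g z := by rw [ext₀ h]

/-- The map `f ⊗ g`. -/
def map₀ {M M' : BiMod k T S} {N N' : BiMod k S R} (f : M.V →ₗ[k] M'.V)
    (g : N.V →ₗ[k] N'.V) (hf : ∀ s x, f (M.ract s x) = M'.ract s (f x))
    (hg : ∀ s x, g (N.lact s x) = N'.lact s (g x)) : TensorV M N →ₗ[k] TensorV M' N' :=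
  lift₀ ((tm₀ M' N').compl₁₂ f g) (fun s m x => by simp [hf, hg, tm₀_balanced])

@[simp] lemma map₀_tm₀ {M M' : BiMod k T S} {N N' : BiMod k S R} (f : M.V →ₗ[k] M'.V)
    (g : N.V →ₗ[k] N'.V) (hf) (hg) (m : M.V) (x : N.V) :
    map₀ f g hf hg (tm₀ M N m x) = tm₀ M' N' (f m) (g x) := by
  simp [map₀]

/-- The tensor product `M ⊗_S N`. -/
def tensor (M : BiMod k T S) (N : BiMod k S R) : BiMod k T R where
  V := TensorV M N
  lact :=
    { toFun := fun t => map₀ (M.lact t) LinearMap.id (fun s x => M.comm t s x) (fun _ _ => rfl)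
      map_one' := ext₀ fun m x => by simp
      map_mul' := fun a b => ext₀ fun m x => by simp
      map_zero' := ext₀ fun m x => by simp
      map_add' := fun a b => ext₀ fun m x => by simp
      commutes' := fun c => ext₀ fun m x => by simp [Algebra.algebraMap_eq_smul_one] }
  ract :=
    { toFun := fun t => map₀ LinearMap.id (N.ract t) (fun _ _ => rfl)
        (fun s x => (N.comm s t x).symm)
      map_one' := ext₀ fun m x => by simp
      map_mul' := fun a b => ext₀ fun m x => by simp
      map_zero' := ext₀ fun m x => by simp
      map_add' := fun a b => ext₀ fun m x => by simp
      commutes' := fun c => ext₀ fun m x => by simp [Algebra.algebraMap_eq_smul_one] }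
  comm := fun s r z => LinearMap.congr_fun
    (f := (map₀ (M.lact s) LinearMap.id (fun t x => M.comm s t x) (fun _ _ => rfl)) ∘ₗ
      (map₀ LinearMap.id (N.ract r) (fun _ _ => rfl) (fun t x => (N.comm t r x).symm)))
    (g := (map₀ LinearMap.id (N.ract r) (fun _ _ => rfl) (fun t x => (N.comm t r x).symm)) ∘ₗ
      (map₀ (M.lact s) LinearMap.id (fun t x => M.comm s t x) (fun _ _ => rfl)))
    (ext₀ fun m x => by simp) z

/-- The pure tensors `m ⊗ x` in `M ⊗_S N`. -/
def tm (M : BiMod k T S) (N : BiMod k S R) : M.V →ₗ[k] N.V →ₗ[k] (tensor M N).V := tm₀ M N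

lemma tm_balanced (M : BiMod k T S) (N : BiMod k S R) (s : S) (m : M.V) (x : N.V) :
    tm M N (M.ract (op s) m) x = tm M N m (N.lact s x) := tm₀_balanced M N s m x

/-- The linear map out of `M ⊗_S N` induced by an `S`-balanced bilinear map. -/
def tlift {M : BiMod k T S} {N : BiMod k S R} {W : Type*} [AddCommGroup W] [Module k W]
    (f : M.V →ₗ[k] N.V →ₗ[k] W)
    (hf : ∀ (s : S) (m : M.V) (x : N.V), f (M.ract (op s) m) x = f m (N.lact s x)) :
    (tensor M N).V →ₗ[k] W := lift₀ f hf

@[simp] lemma tlift_tm {M : BiMod k T S} {N : BiMod k S R} {W : Type*} [AddCommGroup W]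
    [Module k W] (f : M.V →ₗ[k] N.V →ₗ[k] W) (hf) (m : M.V) (x : N.V) :
    tlift f hf (tm M N m x) = f m x := lift₀_tm₀ f hf m x

lemma tensor_ext {M : BiMod k T S} {N : BiMod k S R} {W : Type*} [AddCommGroup W] [Module k W]
    {f g : (tensor M N).V →ₗ[k] W} (h : ∀ m x, f (tm M N m x) = g (tm M N m x)) : f = g :=
  ext₀ h

@[simp] lemma tensor_lact_tm (M : BiMod k T S) (N : BiMod k S R) (t : T) (m : M.V) (x : N.V) :
    (tensor M N).lact t (tm M N m x) = tm M N (M.lact t m) x :=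
  map₀_tm₀ _ _ (fun s x => M.comm t s x) (fun _ _ => rfl) _ _

@[simp] lemma tensor_ract_tm (M : BiMod k T S) (N : BiMod k S R) (r : Rᵐᵒᵖ) (m : M.V)
    (x : N.V) : (tensor M N).ract r (tm M N m x) = tm M N m (N.ract r x) :=
  map₀_tm₀ _ _ (fun _ _ => rfl) (fun s x => (N.comm s r x).symm) _ _

/-- A morphism out of `M ⊗_S N` from a balanced bilinear map that is compatible with the
outer actions. -/
def homLift {M : BiMod k T S} {N : BiMod k S R} {L : BiMod k T R}
    (f : M.V →ₗ[k] N.V →ₗ[k] L.V)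
    (hf : ∀ (s : S) (m : M.V) (x : N.V), f (M.ract (op s) m) x = f m (N.lact s x))
    (hl : ∀ t m x, f (M.lact t m) x = L.lact t (f m x))
    (hr : ∀ r m x, f m (N.ract r x) = L.ract r (f m x)) : tensor M N ⟶ L where
  lin := tlift f hf
  map_l t := LinearMap.congr_fun (f := tlift f hf ∘ₗ (tensor M N).lact t)
    (g := L.lact t ∘ₗ tlift f hf) (tensor_ext fun m x => by simp [hl])
  map_r t := LinearMap.congr_fun (f := tlift f hf ∘ₗ (tensor M N).ract t)
    (g := L.ract t ∘ₗ tlift f hf) (tensor_ext fun m x => by simp [hr])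

@[simp] lemma homLift_tm {M : BiMod k T S} {N : BiMod k S R} {L : BiMod k T R}
    (f : M.V →ₗ[k] N.V →ₗ[k] L.V) (hf) (hl) (hr) (m : M.V) (x : N.V) :
    Hom.lin (homLift (L := L) f hf hl hr) (tm M N m x) = f m x := tlift_tm f hf m x

lemma tensor_hom_ext {M : BiMod k T S} {N : BiMod k S R} {L : BiMod k T R}
    {f g : tensor M N ⟶ L}
    (h : ∀ m x, Hom.lin f (tm M N m x) = Hom.lin g (tm M N m x)) : f = g :=
  Hom.ext (tensor_ext h)

/-- The map `f ⊗ g`. -/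
def tensorHom {M M' : BiMod k T S} {N N' : BiMod k S R} (f : M ⟶ M') (g : N ⟶ N') :
    tensor M N ⟶ tensor M' N' :=
  homLift ((tm M' N').compl₁₂ (Hom.lin f) (Hom.lin g))
    (fun s m x => by simp [Hom.map_l, Hom.map_r, tm_balanced])
    (fun s m x => by simp [Hom.map_l]) (fun s m x => by simp [Hom.map_r])

@[simp] lemma tensorHom_tm {M M' : BiMod k T S} {N N' : BiMod k S R} (f : M ⟶ M') (g : N ⟶ N')
    (m : M.V) (x : N.V) :
    Hom.lin (tensorHom f g) (tm M N m x) = tm M' N' (Hom.lin f m) (Hom.lin g x) := by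
  simp [tensorHom]

variable (M : BiMod k T S) (N : BiMod k S R) (L : BiMod k R Q)

lemma tensor_ext₃ {W : Type*} [AddCommGroup W] [Module k W]
    {f g : (tensor (tensor M N) L).V →ₗ[k] W}
    (h : ∀ m x l, f (tm (tensor M N) L (tm M N m x) l) = g (tm (tensor M N) L (tm M N m x) l)) :
    f = g := by
  refine tensor_ext fun z l => ?_
  exact LinearMap.congr_fun (f := f ∘ₗ (tm (tensor M N) L).flip l)
    (g := g ∘ₗ (tm (tensor M N) L).flip l) (tensor_ext fun m x => h m x l) z

lemma tensor_ext₃' {W : Type*} [AddCommGroup W] [Module k W]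
    {f g : (tensor M (tensor N L)).V →ₗ[k] W}
    (h : ∀ m x l, f (tm M (tensor N L) m (tm N L x l)) = g (tm M (tensor N L) m (tm N L x l))) :
    f = g := by
  refine tensor_ext fun m z => ?_
  exact LinearMap.congr_fun (f := f ∘ₗ tm M (tensor N L) m)
    (g := g ∘ₗ tm M (tensor N L) m) (tensor_ext fun x l => h m x l) z

/-- `m ⊗ x ↦ (l ↦ m ⊗ (x ⊗ l))` -/
def assocAux : (tensor M N).V →ₗ[k] L.V →ₗ[k] (tensor M (tensor N L)).V :=
  tlift (LinearMap.mk₂ k (fun m x => (tm M (tensor N L) m) ∘ₗ (tm N L x))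
      (fun _ _ _ => by ext; simp) (fun _ _ _ => by ext; simp)
      (fun _ _ _ => by ext; simp) (fun _ _ _ => by ext; simp))
    (fun s m x => by
      ext l
      simp [tm_balanced])

@[simp] lemma assocAux_tm (m : M.V) (x : N.V) (l : L.V) :
    assocAux M N L (tm M N m x) l = tm M (tensor N L) m (tm N L x l) := by simp [assocAux]

/-- `x ⊗ l ↦ (m ↦ (m ⊗ x) ⊗ l)` -/
def assocInvAux : (tensor N L).V →ₗ[k] M.V →ₗ[k] (tensor (tensor M N) L).V :=
  tlift (LinearMap.mk₂ k (fun x l => ((tm (tensor M N) L).flip l) ∘ₗ ((tm M N).flip x))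
      (fun _ _ _ => by ext; simp) (fun _ _ _ => by ext; simp)
      (fun _ _ _ => by ext; simp) (fun _ _ _ => by ext; simp))
    (fun s m x => by
      ext l
      simp [← tm_balanced])

@[simp] lemma assocInvAux_tm (m : M.V) (x : N.V) (l : L.V) :
    assocInvAux M N L (tm N L x l) m = tm (tensor M N) L (tm M N m x) l := by
  simp [assocInvAux]

/-- `(M ⊗ N) ⊗ L ⟶ M ⊗ (N ⊗ L)`. -/
def assocHom : tensor (tensor M N) L ⟶ tensor M (tensor N L) :=
  homLift (assocAux M N L)
    (fun r z l => LinearMap.congr_fun (f := (assocAux M N L).flip l ∘ₗ (tensor M N).ract (op r))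
      (g := (assocAux M N L).flip (L.lact r l)) (tensor_ext fun m x => by simp [tm_balanced]) z)
    (fun t z l => LinearMap.congr_fun (f := (assocAux M N L).flip l ∘ₗ (tensor M N).lact t)
      (g := (tensor M (tensor N L)).lact t ∘ₗ (assocAux M N L).flip l)
      (tensor_ext fun m x => by simp) z)
    (fun t z l => LinearMap.congr_fun (f := (assocAux M N L).flip (L.ract t l))
      (g := (tensor M (tensor N L)).ract t ∘ₗ (assocAux M N L).flip l)
      (tensor_ext fun m x => by simp) z)

@[simp] lemma assocHom_tm (m : M.V) (x : N.V) (l : L.V) :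
    Hom.lin (assocHom M N L) (tm (tensor M N) L (tm M N m x) l) =
      tm M (tensor N L) m (tm N L x l) :=
  (homLift_tm (M := tensor M N) (N := L) (L := tensor M (tensor N L)) (assocAux M N L) _ _ _
    (tm M N m x) l).trans (assocAux_tm M N L m x l)

/-- `M ⊗ (N ⊗ L) ⟶ (M ⊗ N) ⊗ L`. -/
def assocInv : tensor M (tensor N L) ⟶ tensor (tensor M N) L :=
  homLift (assocInvAux M N L).flip
    (fun r m z => LinearMap.congr_fun (f := (assocInvAux M N L).flip (M.ract (op r) m))
      (g := (assocInvAux M N L).flip m ∘ₗ (tensor N L).lact r)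
      (tensor_ext fun x l => by simp [tm_balanced]) z)
    (fun t m z => LinearMap.congr_fun (f := (assocInvAux M N L).flip (M.lact t m))
      (g := (tensor (tensor M N) L).lact t ∘ₗ (assocInvAux M N L).flip m)
      (tensor_ext fun x l => by simp) z)
    (fun t m z => LinearMap.congr_fun (f := (assocInvAux M N L).flip m ∘ₗ (tensor N L).ract t)
      (g := (tensor (tensor M N) L).ract t ∘ₗ (assocInvAux M N L).flip m)
      (tensor_ext fun x l => by simp) z)

@[simp] lemma assocInv_tm (m : M.V) (x : N.V) (l : L.V) :
    Hom.lin (assocInv M N L) (tm M (tensor N L) m (tm N L x l)) =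
      tm (tensor M N) L (tm M N m x) l := by simp [assocInv]

/-- The associativity isomorphism `(M ⊗ N) ⊗ L ≅ M ⊗ (N ⊗ L)`. -/
@[simps]
def assoc : tensor (tensor M N) L ≅ tensor M (tensor N L) where
  hom := assocHom M N L
  inv := assocInv M N L
  hom_inv_id := Hom.ext (tensor_ext₃ _ _ _ fun m x l => by simp)
  inv_hom_id := Hom.ext (tensor_ext₃' _ _ _ fun m x l => by simp)

variable (k S) in
/-- The regular bimodule `S`. -/
def regular : BiMod k S S where
  V := S
  lact := Algebra.lmul k S
  ract :=
    { toFun := fun r => LinearMap.mulRight k r.unop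
      map_one' := by ext; simp
      map_mul' := fun a b => by ext; simp [mul_assoc]
      map_zero' := by ext; simp
      map_add' := fun a b => by ext; simp [mul_add]
      commutes' := fun c => by
        ext x
        simp [Algebra.algebraMap_eq_smul_one] }
  comm := fun s r x => by simp [mul_assoc]

variable (k S) in
/-- The identity map from `S` to the space underlying the regular bimodule. -/
def ofReg : S ≃ₗ[k] (regular k S).V := LinearEquiv.refl k S

@[simp] lemma regular_lact (s x : S) : (regular k S).lact s (ofReg k S x) = ofReg k S (s * x) :=
  rfl
@[simp] lemma regular_ract (s : Sᵐᵒᵖ) (x : S) :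
    (regular k S).ract s (ofReg k S x) = ofReg k S (x * s.unop) := rfl

lemma regular_lact' (s : S) (x : (regular k S).V) :
    (regular k S).lact s x = ofReg k S (s * (ofReg k S).symm x) := rfl
lemma regular_ract' (s : Sᵐᵒᵖ) (x : (regular k S).V) :
    (regular k S).ract s x = ofReg k S ((ofReg k S).symm x * s.unop) := rfl

/-- `S ⊗_S N ⟶ N`, `s ⊗ x ↦ s x`. -/
def leftUnitHom : tensor (regular k S) N ⟶ N :=
  homLift (N.lact.toLinearMap ∘ₗ (ofReg k S).symm.toLinearMap)
    (fun s m x => by simp [regular_ract']) (fun s m x => by simp [regular_lact'])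
    (fun s m x => by simp [N.comm])

@[simp] lemma leftUnitHom_tm (s : (regular k S).V) (x : N.V) :
    Hom.lin (leftUnitHom N) (tm (regular k S) N s x) = N.lact ((ofReg k S).symm s) x :=
  homLift_tm (M := regular k S) (N := N) (L := N)
    (N.lact.toLinearMap ∘ₗ (ofReg k S).symm.toLinearMap) _ _ _ s x

/-- The isomorphism `S ⊗_S N ≅ N`. -/
def leftUnit : tensor (regular k S) N ≅ N where
  hom := leftUnitHom N
  inv := ⟨tm (regular k S) N (ofReg k S 1), fun s x => by
      simp [← tm_balanced], fun s x => by simp⟩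
  hom_inv_id := tensor_hom_ext fun m x => by
    have := tm_balanced (regular k S) N ((ofReg k S).symm m) (ofReg k S 1) x
    simpa using this.symm
  inv_hom_id := hom_ext fun x => by simp

@[simp] lemma leftUnit_hom_tm (s : (regular k S).V) (x : N.V) :
    Hom.lin (leftUnit N).hom (tm (regular k S) N s x) = N.lact ((ofReg k S).symm s) x :=
  leftUnitHom_tm N s x

@[simp] lemma leftUnit_inv (x : N.V) :
    Hom.lin (leftUnit N).inv x = tm (regular k S) N (ofReg k S 1) x := rfl

/-- The isomorphism `M ⊗_S S ≅ M`. -/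
def rightUnit : tensor M (regular k S) ≅ M where
  hom := homLift (M.ract.toLinearMap ∘ₗ (opLinearEquiv k : S ≃ₗ[k] Sᵐᵒᵖ).toLinearMap ∘ₗ
      (ofReg k S).symm.toLinearMap).flip
    (fun s m x => by simp [regular_lact']) (fun s m x => by simp [M.comm])
    (fun s m x => by simp [regular_ract'])
  inv := ⟨(tm M (regular k S)).flip (ofReg k S 1), fun s x => by simp, fun s x => by
      have := tm_balanced M (regular k S) s.unop x (ofReg k S 1)
      simpa using this⟩
  hom_inv_id := tensor_hom_ext fun m x => by
    have := tm_balanced M (regular k S) ((ofReg k S).symm x) m (ofReg k S 1)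
    simpa using this
  inv_hom_id := hom_ext fun x => by simp

@[simp] lemma rightUnit_hom_tm (m : M.V) (s : (regular k S).V) :
    Hom.lin (rightUnit M).hom (tm M (regular k S) m s) =
      M.ract (op ((ofReg k S).symm s)) m := by
  simp [rightUnit]

@[simp] lemma rightUnit_inv (x : M.V) :
    Hom.lin (rightUnit M).inv x = tm M (regular k S) x (ofReg k S 1) := rfl

lemma tensor_hom_ext₃ {M : BiMod k T S} {N : BiMod k S R} {L : BiMod k R Q} {X : BiMod k T Q}
    {f g : tensor (tensor M N) L ⟶ X}
    (h : ∀ m x l, Hom.lin f (tm (tensor M N) L (tm M N m x) l) =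
      Hom.lin g (tm (tensor M N) L (tm M N m x) l)) : f = g :=
  Hom.ext (tensor_ext₃ _ _ _ h)

lemma tensor_hom_ext₃' {M : BiMod k T S} {N : BiMod k S R} {L : BiMod k R Q} {X : BiMod k T Q}
    {f g : tensor M (tensor N L) ⟶ X}
    (h : ∀ m x l, Hom.lin f (tm M (tensor N L) m (tm N L x l)) =
      Hom.lin g (tm M (tensor N L) m (tm N L x l))) : f = g :=
  Hom.ext (tensor_ext₃' _ _ _ h)

variable {M N L}

lemma tensorHom_id : tensorHom (𝟙 M) (𝟙 N) = 𝟙 (tensor M N) :=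
  tensor_hom_ext fun _ _ => by simp

lemma tensorHom_comp {M' M'' : BiMod k T S} {N' N'' : BiMod k S R} (f : M ⟶ M') (f' : M' ⟶ M'')
    (g : N ⟶ N') (g' : N' ⟶ N'') :
    tensorHom (f ≫ f') (g ≫ g') = tensorHom f g ≫ tensorHom f' g' :=
  tensor_hom_ext fun _ _ => by simp

lemma assoc_naturality {M' : BiMod k T S} {N' : BiMod k S R} {L' : BiMod k R Q}
    (f : M ⟶ M') (g : N ⟶ N') (h : L ⟶ L') :
    tensorHom (tensorHom f g) h ≫ (assoc M' N' L').hom =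
      (assoc M N L).hom ≫ tensorHom f (tensorHom g h) :=
  tensor_hom_ext₃ fun _ _ _ => by simp

lemma assoc_inv_naturality {M' : BiMod k T S} {N' : BiMod k S R} {L' : BiMod k R Q}
    (f : M ⟶ M') (g : N ⟶ N') (h : L ⟶ L') :
    tensorHom f (tensorHom g h) ≫ (assoc M' N' L').inv =
      (assoc M N L).inv ≫ tensorHom (tensorHom f g) h :=
  tensor_hom_ext₃' fun _ _ _ => by simp

lemma leftUnit_naturality {N N' : BiMod k S R} (f : N ⟶ N') :
    tensorHom (𝟙 (regular k S)) f ≫ (leftUnit N').hom = (leftUnit N).hom ≫ f :=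
  tensor_hom_ext fun _ _ => by simp [Hom.map_l]

lemma rightUnit_naturality {M M' : BiMod k T S} (f : M ⟶ M') :
    tensorHom f (𝟙 (regular k S)) ≫ (rightUnit M').hom = (rightUnit M).hom ≫ f :=
  tensor_hom_ext fun _ _ => by simp [Hom.map_r]

lemma tensor_hom_ext₄ {P : Type u} [Ring P] [Algebra k P] {X : BiMod k Q P} {Y : BiMod k T P}
    {f g : tensor (tensor (tensor M N) L) X ⟶ Y}
    (h : ∀ m x l y,
      Hom.lin f (tm (tensor (tensor M N) L) X (tm (tensor M N) L (tm M N m x) l) y) =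
        Hom.lin g (tm (tensor (tensor M N) L) X (tm (tensor M N) L (tm M N m x) l) y)) : f = g := by
  refine tensor_hom_ext fun z y => ?_
  exact LinearMap.congr_fun (f := Hom.lin f ∘ₗ (tm (tensor (tensor M N) L) X).flip y)
    (g := Hom.lin g ∘ₗ (tm (tensor (tensor M N) L) X).flip y)
    (tensor_ext₃ _ _ _ fun m x l => h m x l y) z

lemma tensorHom_add_left {M' : BiMod k T S} {N' : BiMod k S R} (f f' : M ⟶ M') (g : N ⟶ N') :
    tensorHom (f + f') g = tensorHom f g + tensorHom f' g :=
  tensor_hom_ext fun m x => by simp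

lemma tensorHom_add_right {M' : BiMod k T S} {N' : BiMod k S R} (f : M ⟶ M') (g g' : N ⟶ N') :
    tensorHom f (g + g') = tensorHom f g + tensorHom f g' :=
  tensor_hom_ext fun m x => by simp

lemma tensorHom_smul_left {M' : BiMod k T S} {N' : BiMod k S R} (c : k) (f : M ⟶ M')
    (g : N ⟶ N') : tensorHom (c • f) g = c • tensorHom f g :=
  tensor_hom_ext fun m x => by simp

lemma tensorHom_smul_right {M' : BiMod k T S} {N' : BiMod k S R} (c : k) (f : M ⟶ M')
    (g : N ⟶ N') : tensorHom f (c • g) = c • tensorHom f g :=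
  tensor_hom_ext fun m x => by simp

lemma tensor_pentagon {P : Type u} [Ring P] [Algebra k P] (X : BiMod k Q P) :
    tensorHom (𝟙 M) (assoc N L X).inv ≫ (assoc M (tensor N L) X).inv ≫
      tensorHom (assoc M N L).inv (𝟙 X) =
    (assoc M N (tensor L X)).inv ≫ (assoc (tensor M N) L X).inv := by
  rw [← cancel_epi (assoc M N (tensor L X)).hom, ← cancel_epi (assoc (tensor M N) L X).hom]
  exact tensor_hom_ext₄ fun m x l y => by simp

lemma tensor_triangle (M : BiMod k T S) (N : BiMod k S R) :
    (assoc M (regular k S) N).inv ≫ tensorHom (rightUnit M).hom (𝟙 N) =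
      tensorHom (𝟙 M) (leftUnit N).hom :=
  tensor_hom_ext₃' fun m s x => by
    have := tm_balanced M N ((ofReg k S).symm s) m x
    simpa using this

end Tensor
end BiMod

/-- Algebras over `k`, the objects of the bicategory of bimodules. -/
structure Alg (k : Type u) [Field k] : Type (u + 1) where
  carrier : Type u
  [ring : Ring carrier]
  [algebra : Algebra k carrier]

attribute [instance] Alg.ring Alg.algebra

namespace Alg

variable {k : Type u} [Field k]

instance : CategoryStruct.{u + 1} (Alg k) where
  Hom R S := BiMod k S.carrier R.carrier
  id R := BiMod.regular k R.carrier
  comp F G := BiMod.tensor G F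

section

/-- The category of `S`-`R`-bimodules. -/
abbrev homCat (R S : Alg k) : Category.{u + 1} (R ⟶ S) :=
  inferInstanceAs (Category (BiMod k S.carrier R.carrier))

attribute [local instance] homCat

open BiMod

/-- The bicategory of algebras, bimodules and bimodule homomorphisms. A `1`-morphism `R ⟶ S` is an
`S`-`R`-bimodule, and the composite of `F : R ⟶ S` with `G : S ⟶ T` is `G ⊗_S F`. -/
instance : Bicategory.{u + 1, u + 1} (Alg k) where
  homCategory R S := homCat R S
  whiskerLeft F _ _ η := tensorHom η (𝟙 F)
  whiskerRight η H := tensorHom (𝟙 H) η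
  associator F G H := (assoc H G F).symm
  leftUnitor F := rightUnit F
  rightUnitor F := leftUnit F
  whiskerLeft_id _ _ := tensorHom_id
  whiskerLeft_comp F _ _ _ η θ := by
    rw [← tensorHom_comp]; exact congrArg _ (Category.comp_id (𝟙 F)).symm
  id_whiskerLeft η := by
    rw [← Category.assoc, Iso.eq_comp_inv]; exact rightUnit_naturality η
  comp_whiskerLeft F G _ _ η := by
    rw [← Category.assoc, Iso.eq_comp_inv]
    have := assoc_inv_naturality η (𝟙 G) (𝟙 F)
    rw [tensorHom_id] at this
    exact this
  id_whiskerRight _ _ := tensorHom_id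
  comp_whiskerRight η θ F := by
    rw [← tensorHom_comp]; exact congrArg (fun t => tensorHom t _) (Category.comp_id (𝟙 F)).symm
  whiskerRight_id η := by
    rw [← Category.assoc, Iso.eq_comp_inv]; exact leftUnit_naturality η
  whiskerRight_comp η G H := by
    rw [Iso.eq_inv_comp]
    have := assoc_inv_naturality (𝟙 H) (𝟙 G) η
    rw [tensorHom_id] at this
    exact this.symm
  whisker_assoc F _ _ η H := by
    rw [← Category.assoc, Iso.eq_comp_inv]
    exact (assoc_inv_naturality (𝟙 H) η (𝟙 F))
  whisker_exchange {_ _ _ F G H I} η θ := by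
    change tensorHom θ (𝟙 F) ≫ tensorHom (𝟙 I) η = tensorHom (𝟙 H) η ≫ tensorHom θ (𝟙 G)
    rw [← tensorHom_comp, ← tensorHom_comp, Category.comp_id, Category.id_comp,
      Category.comp_id, Category.id_comp]
  pentagon F G H I := tensor_pentagon (M := I) (N := H) (L := G) F
  triangle F G := tensor_triangle G F

end

instance (R S : Alg k) : Preadditive (R ⟶ S) :=
  inferInstanceAs (Preadditive (BiMod k S.carrier R.carrier))
instance (R S : Alg k) : Linear k (R ⟶ S) :=
  inferInstanceAs (Linear k (BiMod k S.carrier R.carrier))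

lemma whiskerLeft_def {R S T : Alg k} (F : R ⟶ S) {G H : S ⟶ T} (η : G ⟶ H) :
    Bicategory.whiskerLeft F η = BiMod.tensorHom η (𝟙 F) := rfl

lemma whiskerRight_def {R S T : Alg k} {F G : R ⟶ S} (η : F ⟶ G) (H : S ⟶ T) :
    Bicategory.whiskerRight η H = BiMod.tensorHom (𝟙 H) η := rfl

lemma whiskerLeft_add {R S T : Alg k} (F : R ⟶ S) {G H : S ⟶ T} (η θ : G ⟶ H) :
    F ◁ (η + θ) = F ◁ η + F ◁ θ := BiMod.tensorHom_add_left _ _ _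

lemma whiskerRight_add {R S T : Alg k} {F G : R ⟶ S} (η θ : F ⟶ G) (H : S ⟶ T) :
    (η + θ) ▷ H = η ▷ H + θ ▷ H := BiMod.tensorHom_add_right _ _ _

lemma whiskerLeft_smul {R S T : Alg k} (c : k) (F : R ⟶ S) {G H : S ⟶ T} (η : G ⟶ H) :
    F ◁ (c • η) = c • F ◁ η := BiMod.tensorHom_smul_left _ _ _

lemma whiskerRight_smul {R S T : Alg k} (c : k) {F G : R ⟶ S} (η : F ⟶ G) (H : S ⟶ T) :
    (c • η) ▷ H = c • η ▷ H := BiMod.tensorHom_smul_right _ _ _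

end Alg

/-- The algebra `A_n`. It has the basis `e_0, …, e_n`, `a_1, …, a_n`, `b_1, …, b_n`, `c`; an element
is recorded by its coordinates `x₀` (at `e_0`), `x` (at `e_1, …, e_n`), `a`, `b`, `c`. The `e_i` are
orthogonal idempotents with sum `1`, and `a_i ∈ e_i A e_0`, `b_i ∈ e_0 A e_i`, `c ∈ e_0 A e_0`. The
only nonzero products of two elements among the `a_i`, `b_i`, `c` are `b_i a_i = c`.
In other words, `A_n` is the path algebra of the double of the star graph with centre `0` and
leaves `1, …, n`, modulo the relations `b_i a_i = b_j a_j`, `a_i b_j = 0` for all `i`, `j`: it is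
the zigzag algebra of the star graph modulo the span of the loops `a_i b_i` at the leaves. -/
@[ext]
structure StarAlg (k : Type u) (n : ℕ) : Type u where
  x₀ : k
  x : Fin n → k
  a : Fin n → k
  b : Fin n → k
  c : k

namespace StarAlg

variable {k : Type u} [Field k] {n : ℕ}

instance : Zero (StarAlg k n) := ⟨⟨0, 0, 0, 0, 0⟩⟩
instance : One (StarAlg k n) := ⟨⟨1, 1, 0, 0, 0⟩⟩
instance : Add (StarAlg k n) := ⟨fun p q => ⟨p.x₀ + q.x₀, p.x + q.x, p.a + q.a, p.b + q.b, p.c + q.c⟩⟩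
instance : Neg (StarAlg k n) := ⟨fun p => ⟨-p.x₀, -p.x, -p.a, -p.b, -p.c⟩⟩
instance : SMul k (StarAlg k n) := ⟨fun t p => ⟨t * p.x₀, t • p.x, t • p.a, t • p.b, t * p.c⟩⟩
instance : Mul (StarAlg k n) := ⟨fun p q =>
  { x₀ := p.x₀ * q.x₀
    x := p.x * q.x
    a := p.x * q.a + q.x₀ • p.a
    b := p.x₀ • q.b + p.b * q.x
    c := p.x₀ * q.c + p.c * q.x₀ + ∑ i, p.b i * q.a i }⟩

section Lemmas
variable (p q : StarAlg k n) (t : k) (i : Fin n)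
@[simp] lemma zero_x₀ : (0 : StarAlg k n).x₀ = 0 := rfl
@[simp] lemma zero_x : (0 : StarAlg k n).x i = 0 := rfl
@[simp] lemma zero_a : (0 : StarAlg k n).a i = 0 := rfl
@[simp] lemma zero_b : (0 : StarAlg k n).b i = 0 := rfl
@[simp] lemma zero_c : (0 : StarAlg k n).c = 0 := rfl
@[simp] lemma one_x₀ : (1 : StarAlg k n).x₀ = 1 := rfl
@[simp] lemma one_x : (1 : StarAlg k n).x i = 1 := rfl
@[simp] lemma one_a : (1 : StarAlg k n).a i = 0 := rfl
@[simp] lemma one_b : (1 : StarAlg k n).b i = 0 := rfl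
@[simp] lemma one_c : (1 : StarAlg k n).c = 0 := rfl
@[simp] lemma add_x₀ : (p + q).x₀ = p.x₀ + q.x₀ := rfl
@[simp] lemma add_x : (p + q).x i = p.x i + q.x i := rfl
@[simp] lemma add_a : (p + q).a i = p.a i + q.a i := rfl
@[simp] lemma add_b : (p + q).b i = p.b i + q.b i := rfl
@[simp] lemma add_c : (p + q).c = p.c + q.c := rfl
@[simp] lemma neg_x₀ : (-p).x₀ = -p.x₀ := rfl
@[simp] lemma neg_x : (-p).x i = -p.x i := rfl
@[simp] lemma neg_a : (-p).a i = -p.a i := rfl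
@[simp] lemma neg_b : (-p).b i = -p.b i := rfl
@[simp] lemma neg_c : (-p).c = -p.c := rfl
@[simp] lemma smul_x₀ : (t • p).x₀ = t * p.x₀ := rfl
@[simp] lemma smul_x : (t • p).x i = t * p.x i := rfl
@[simp] lemma smul_a : (t • p).a i = t * p.a i := rfl
@[simp] lemma smul_b : (t • p).b i = t * p.b i := rfl
@[simp] lemma smul_c : (t • p).c = t * p.c := rfl
@[simp] lemma mul_x₀ : (p * q).x₀ = p.x₀ * q.x₀ := rfl
@[simp] lemma mul_x : (p * q).x i = p.x i * q.x i := rfl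
@[simp] lemma mul_a : (p * q).a i = p.x i * q.a i + q.x₀ * p.a i := rfl
@[simp] lemma mul_b : (p * q).b i = p.x₀ * q.b i + p.b i * q.x i := rfl
@[simp] lemma mul_c : (p * q).c = p.x₀ * q.c + p.c * q.x₀ + ∑ i, p.b i * q.a i := rfl
end Lemmas

instance : AddCommGroup (StarAlg k n) where
  add_assoc _ _ _ := by ext <;> simp [add_assoc]
  zero_add _ := by ext <;> simp
  add_zero _ := by ext <;> simp
  neg_add_cancel _ := by ext <;> simp
  add_comm _ _ := by ext <;> simp [add_comm]
  nsmul := nsmulRec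
  zsmul := zsmulRec

instance : Module k (StarAlg k n) where
  one_smul _ := by ext <;> simp
  mul_smul _ _ _ := by ext <;> simp [mul_assoc]
  smul_zero _ := by ext <;> simp
  smul_add _ _ _ := by ext <;> simp [mul_add]
  add_smul _ _ _ := by ext <;> simp [add_mul]
  zero_smul _ := by ext <;> simp

instance : Ring (StarAlg k n) where
  __ := (inferInstance : AddCommGroup (StarAlg k n))
  left_distrib p q r := by ext <;> simp [mul_add, Finset.sum_add_distrib] <;> ring
  right_distrib p q r := by ext <;> simp [add_mul, mul_add, Finset.sum_add_distrib] <;> ring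
  zero_mul _ := by ext <;> simp
  mul_zero _ := by ext <;> simp
  mul_assoc p q r := by
    ext
    · simp [mul_assoc]
    · simp [mul_assoc]
    · simp; ring
    · simp; ring
    · simp only [mul_c, mul_x₀, mul_b, mul_a, add_mul, mul_add, Finset.sum_add_distrib,
        Finset.sum_mul, Finset.mul_sum]
      simp only [mul_assoc, mul_comm, mul_left_comm]
      ring
  one_mul _ := by ext <;> simp
  mul_one _ := by ext <;> simp

instance : Algebra k (StarAlg k n) :=
  Algebra.ofModule (fun t p q => by ext <;> simp [mul_add, Finset.mul_sum] <;> ring_nf)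
    (fun t p q => by
      ext
      · simp; ring
      · simp; ring
      · simp; ring
      · simp; ring
      · simp only [mul_c, smul_x₀, smul_c, smul_a, mul_add, Finset.mul_sum]
        simp only [mul_left_comm])

/-- The coordinates form a linear isomorphism. -/
def coords : StarAlg k n ≃ₗ[k] k × (Fin n → k) × (Fin n → k) × (Fin n → k) × k where
  toFun p := (p.x₀, p.x, p.a, p.b, p.c)
  invFun z := ⟨z.1, z.2.1, z.2.2.1, z.2.2.2.1, z.2.2.2.2⟩
  map_add' _ _ := rfl
  map_smul' _ _ := rfl
  left_inv _ := rfl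
  right_inv _ := rfl

instance : Module.Finite k (StarAlg k n) := Module.Finite.equiv (coords (k := k) (n := n)).symm

variable (k n)

/-- The idempotents `e_0, …, e_n`. -/
def e : Fin (n + 1) → StarAlg k n :=
  Fin.cases ⟨1, 0, 0, 0, 0⟩ fun i => ⟨0, Pi.single i 1, 0, 0, 0⟩

variable {n}

/-- The arrows `a_i ∈ e_i A e_0`. -/
def arrA (i : Fin n) : StarAlg k n := ⟨0, 0, Pi.single i 1, 0, 0⟩

/-- The arrows `b_i ∈ e_0 A e_i`. -/
def arrB (i : Fin n) : StarAlg k n := ⟨0, 0, 0, Pi.single i 1, 0⟩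

variable (n) in
/-- The loop `c ∈ e_0 A e_0`. -/
def arrC : StarAlg k n := ⟨0, 0, 0, 0, 1⟩

lemma e_zero_def : e k n 0 = ⟨1, 0, 0, 0, 0⟩ := rfl
lemma e_succ_def (i : Fin n) : e k n i.succ = ⟨0, Pi.single i 1, 0, 0, 0⟩ := rfl

lemma e_mul_self (i : Fin (n + 1)) : e k n i * e k n i = e k n i := by
  refine Fin.cases ?_ (fun j => ?_) i
  · ext <;> simp [e_zero_def]
  · ext l <;> simp [e_succ_def, Pi.single_apply]

lemma e_mul_of_ne {i j : Fin (n + 1)} (h : i ≠ j) : e k n i * e k n j = 0 := by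
  induction i using Fin.cases with
  | zero =>
    induction j using Fin.cases with
    | zero => exact absurd rfl h
    | succ j => ext <;> simp [e_zero_def, e_succ_def]
  | succ i =>
    induction j using Fin.cases with
    | zero => ext <;> simp [e_zero_def, e_succ_def]
    | succ j =>
      have h' : i ≠ j := fun h' => h (by rw [h'])
      ext l <;> simp [e_succ_def, Pi.single_apply]
      rintro rfl rfl
      exact h' rfl

lemma sum_e : ∑ i, e k n i = 1 := by
  apply (coords (k := k) (n := n)).injective
  rw [Fin.sum_univ_succ, map_add, map_sum]
  refine Prod.ext ?_ (Prod.ext ?_ (Prod.ext ?_ (Prod.ext ?_ ?_))) <;>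
    simp [coords, e_zero_def, e_succ_def, Prod.fst_sum, Prod.snd_sum]
  · funext j; simp [Finset.sum_apply, Pi.single_apply]
  · rfl
  · rfl

lemma e_mul_arrA (i : Fin n) : e k n i.succ * arrA k i = arrA k i := by
  ext l <;> simp [e_succ_def, arrA, Pi.single_apply]

lemma arrA_mul_e (i : Fin n) : arrA k i * e k n 0 = arrA k i := by
  ext l <;> simp [e_zero_def, arrA]

lemma e_mul_arrB (i : Fin n) : e k n 0 * arrB k i = arrB k i := by
  ext l <;> simp [e_zero_def, arrB]

lemma arrB_mul_e (i : Fin n) : arrB k i * e k n i.succ = arrB k i := by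
  ext l <;> simp [e_succ_def, arrB, Pi.single_apply]

lemma arrB_mul_arrA (i : Fin n) : arrB k i * arrA k i = arrC k n := by
  ext l <;> simp [arrA, arrB, arrC, Pi.single_apply]

lemma arrB_mul_arrA_of_ne {i j : Fin n} (h : i ≠ j) : arrB k i * arrA k j = 0 := by
  ext l <;> simp [arrA, arrB, Pi.single_apply, h.symm]

lemma arrA_mul_arrB (i j : Fin n) : arrA k i * arrB k j = 0 := by
  ext l <;> simp [arrA, arrB]

lemma e_mul_arrC : e k n 0 * arrC k n = arrC k n := by
  ext l <;> simp [e_zero_def, arrC]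

lemma arrC_mul_e : arrC k n * e k n 0 = arrC k n := by
  ext l <;> simp [e_zero_def, arrC]

end StarAlg

section InAdd
variable {𝒞 : Type*} [Category 𝒞] [Preadditive 𝒞] {𝒟 : Type*} [Category 𝒟] [Preadditive 𝒟]

/-- `M` belongs to `add G`: it is a retract of a finite direct sum of members of the family `G`. -/
def InAdd {ι : Type*} (G : ι → 𝒞) (M : 𝒞) : Prop :=
  ∃ (J : Type) (_ : Fintype J) (t : J → ι) (i : ∀ x, M ⟶ G (t x)) (p : ∀ x, G (t x) ⟶ M),
    ∑ x, i x ≫ p x = 𝟙 M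

namespace InAdd
variable {ι κ : Type*} {G : ι → 𝒞} {H : κ → 𝒞}

lemma of_mem (x : ι) : InAdd G (G x) :=
  ⟨Unit, inferInstance, fun _ => x, fun _ => 𝟙 _, fun _ => 𝟙 _, by simp⟩

lemma trans {M : 𝒞} (hM : InAdd G M) (hG : ∀ x, InAdd H (G x)) : InAdd H M := by
  obtain ⟨J, _, t, i, p, h⟩ := hM
  choose J' inst t' i' p' h' using hG
  refine ⟨Σ x, J' (t x), inferInstance, fun z => t' _ z.2, fun z => i z.1 ≫ i' _ z.2,
    fun z => p' _ z.2 ≫ p z.1, ?_⟩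
  rw [Fintype.sum_sigma, ← h]
  refine Finset.sum_congr rfl fun x _ => ?_
  calc ∑ y, (i x ≫ i' (t x) y) ≫ p' (t x) y ≫ p x
      = i x ≫ (∑ y, i' (t x) y ≫ p' (t x) y) ≫ p x := by
        simp only [Preadditive.sum_comp, Preadditive.comp_sum, Category.assoc]
    _ = i x ≫ p x := by rw [h', Category.id_comp]

lemma of_retract {M N : 𝒞} (f : M ⟶ N) (g : N ⟶ M) (h : f ≫ g = 𝟙 M) (hN : InAdd G N) :
    InAdd G M :=
  trans (G := fun _ : Unit => N)
    ⟨Unit, inferInstance, fun _ => (), fun _ => f, fun _ => g, by simp [h]⟩ fun _ => hN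

lemma of_iso {M N : 𝒞} (f : M ≅ N) (hN : InAdd G N) : InAdd G M :=
  of_retract f.hom f.inv f.hom_inv_id hN

lemma map (F : 𝒞 ⥤ 𝒟) [F.Additive] {M : 𝒞} (hM : InAdd G M) :
    InAdd (fun x => F.obj (G x)) (F.obj M) := by
  obtain ⟨J, _, t, i, p, h⟩ := hM
  refine ⟨J, inferInstance, t, fun x => F.map (i x), fun x => F.map (p x), ?_⟩
  simp only [← F.map_comp, ← F.map_sum, h, F.map_id]

end InAdd
end InAdd

namespace BiMod

lemma sum_lin {k S R : Type u} [Field k] [Ring S] [Algebra k S] [Ring R]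
    [Algebra k R] {M N : BiMod k S R} {J : Type*} (s : Finset J) (f : J → (M ⟶ N)) (x : M.V) :
    Hom.lin (∑ j ∈ s, f j : M ⟶ N) x = ∑ j ∈ s, Hom.lin (f j) x := by
  let φ : (M ⟶ N) →+ N.V :=
    { toFun := fun f => Hom.lin f x, map_zero' := rfl, map_add' := fun _ _ => rfl }
  exact map_sum φ f s

end BiMod

section Ideals
variable {k : Type u} [Field k] {A : Type u} [Ring A] [Algebra k A]

/-- The action of `k` by scalars, as a right action. -/
def scalarRight (k : Type u) [Field k] (V : Type u) [AddCommGroup V] [Module k V] :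
    kᵐᵒᵖ →ₐ[k] Module.End k V where
  toFun r := r.unop • LinearMap.id
  map_one' := by ext; simp
  map_mul' a b := by ext; simp [mul_smul]
  map_zero' := by ext; simp
  map_add' a b := by ext; simp [add_smul]
  commutes' c := by ext; simp

/-- The left `A`-module `A e`, as an `A`-`k`-bimodule. -/
def leftIdeal (k : Type u) [Field k] {A : Type u} [Ring A] [Algebra k A] (e : A) :
    BiMod k A k where
  V := LinearMap.range (LinearMap.mulRight k e)
  lact :=
    { toFun := fun s => (LinearMap.mulLeft k s).restrict (by
        rintro _ ⟨x, rfl⟩; exact ⟨s * x, mul_assoc _ _ _⟩)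
      map_one' := by ext; simp
      map_mul' := fun a b => by ext; simp [mul_assoc]
      map_zero' := by ext; simp
      map_add' := fun a b => by ext; simp [add_mul]
      commutes' := fun c => by ext; simp [Algebra.algebraMap_eq_smul_one] }
  ract := scalarRight k _
  comm s r x := by simp [scalarRight]

/-- The right `A`-module `e A`, as a `k`-`A`-bimodule. -/
def rightIdeal (k : Type u) [Field k] {A : Type u} [Ring A] [Algebra k A] (e : A) :
    BiMod k k A where
  V := LinearMap.range (LinearMap.mulLeft k e)
  lact := Algebra.lsmul k k _
  ract :=
    { toFun := fun s => (LinearMap.mulRight k s.unop).restrict (by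
        rintro _ ⟨x, rfl⟩; exact ⟨x * s.unop, (mul_assoc _ _ _).symm⟩)
      map_one' := by ext; simp
      map_mul' := fun a b => by ext; simp [mul_assoc]
      map_zero' := by ext; simp
      map_add' := fun a b => by ext; simp [mul_add]
      commutes' := fun c => by ext; simp [Algebra.algebraMap_eq_smul_one] }
  comm s r x := by simp

/-- The underlying element. -/
def leftVal (e : A) : (leftIdeal k e).V →ₗ[k] A := Submodule.subtype _
/-- The underlying element. -/
def rightVal (e : A) : (rightIdeal k e).V →ₗ[k] A := Submodule.subtype _

lemma leftVal_injective (e : A) : Function.Injective (leftVal (k := k) e) :=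
  Subtype.val_injective
lemma rightVal_injective (e : A) : Function.Injective (rightVal (k := k) e) :=
  Subtype.val_injective

@[simp] lemma leftVal_lact (e s : A) (x : (leftIdeal k e).V) :
    leftVal e ((leftIdeal k e).lact s x) = s * leftVal e x := rfl
@[simp] lemma leftVal_ract (e : A) (s : kᵐᵒᵖ) (x : (leftIdeal k e).V) :
    leftVal e ((leftIdeal k e).ract s x) = s.unop • leftVal e x := rfl
@[simp] lemma rightVal_ract (e : A) (s : Aᵐᵒᵖ) (x : (rightIdeal k e).V) :
    rightVal e ((rightIdeal k e).ract s x) = rightVal e x * s.unop := rfl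
@[simp] lemma rightVal_lact (e : A) (s : k) (x : (rightIdeal k e).V) :
    rightVal e ((rightIdeal k e).lact s x) = s • rightVal e x := rfl

lemma leftVal_mul (e : A) (he : e * e = e) (x : (leftIdeal k e).V) :
    leftVal e x * e = leftVal e x := by
  obtain ⟨_, y, rfl⟩ := x
  change y * e * e = y * e
  rw [mul_assoc, he]

lemma mul_rightVal (e : A) (he : e * e = e) (x : (rightIdeal k e).V) :
    e * rightVal e x = rightVal e x := by
  obtain ⟨_, y, rfl⟩ := x
  change e * (e * y) = e * y
  rw [← mul_assoc, he]

/-- The element `x` of `A e`. -/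
def leftMk (e x : A) (hx : x * e = x) : (leftIdeal k e).V := ⟨x, x, hx⟩
/-- The element `x` of `e A`. -/
def rightMk (e x : A) (hx : e * x = x) : (rightIdeal k e).V := ⟨x, x, hx⟩

@[simp] lemma leftVal_mk (e x : A) (hx : x * e = x) :
    leftVal (k := k) e (leftMk e x hx) = x := rfl
@[simp] lemma rightVal_mk (e x : A) (hx : e * x = x) :
    rightVal (k := k) e (rightMk e x hx) = x := rfl

/-- For `y ∈ A f`, right multiplication by `y` as a morphism of left modules `A e ⟶ A f`. -/
def rightMul (e f y : A) (hy : y * f = y) : leftIdeal k e ⟶ leftIdeal k f where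
  lin := LinearMap.codRestrict _ (LinearMap.mulRight k y ∘ₗ leftVal e)
    (fun x => ⟨leftVal e x * y, by simp [mul_assoc, hy]⟩)
  map_l s x := leftVal_injective (k := k) f (mul_assoc _ _ _)
  map_r s x := leftVal_injective (k := k) f (smul_mul_assoc _ _ _)

@[simp] lemma leftVal_rightMul (e f y : A) (hy : y * f = y) (x : (leftIdeal k e).V) :
    leftVal f (BiMod.Hom.lin (rightMul e f y hy) x) = leftVal e x * y := rfl

lemma rightMul_comp (e f g y z : A) (hy : y * f = y) (hz : z * g = z) :
    rightMul (k := k) e f y hy ≫ rightMul f g z hz =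
      rightMul e g (y * z) (by rw [mul_assoc, hz]) :=
  BiMod.hom_ext fun _ => leftVal_injective (k := k) _ (mul_assoc _ _ _)

lemma rightMul_eq_id (e y : A) (he : e * e = e) (hy : y * e = y) (h : e * y = e) :
    rightMul (k := k) e e y hy = 𝟙 _ :=
  BiMod.hom_ext fun x => leftVal_injective (k := k) _ (by
    change leftVal e x * y = leftVal e x
    rw [← leftVal_mul e he x, mul_assoc, h])

lemma rightMul_sum {J : Type*} (s : Finset J) (e f : A) (y : J → A) (hy : ∀ j, y j * f = y j) :
    ∑ j ∈ s, rightMul (k := k) e f (y j) (hy j) =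
      rightMul e f (∑ j ∈ s, y j) (by rw [Finset.sum_mul]; simp only [hy]) :=
  BiMod.hom_ext fun x => leftVal_injective (k := k) _ (by
    rw [BiMod.sum_lin, map_sum, leftVal_rightMul, Finset.mul_sum]; rfl)

lemma leftIdeal_retract (e : A) (he : e * e = e) :
    rightMul (k := k) e 1 e (mul_one _) ≫ rightMul 1 e e he = 𝟙 _ := by
  rw [rightMul_comp, rightMul_eq_id e _ he _ (by rw [he, he])]

lemma leftIdeal_sum {J : Type*} [Fintype J] (e : J → A) (he : ∀ j, e j * e j = e j)
    (h : ∑ j, e j = 1) :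
    ∑ j, rightMul (k := k) 1 (e j) (e j) (he j) ≫ rightMul (e j) 1 (e j) (mul_one _) =
      𝟙 (leftIdeal k (1 : A)) := by
  simp only [rightMul_comp]
  rw [rightMul_sum, rightMul_eq_id _ _ (mul_one _) _ (by simp [he, h])]

instance [Module.Finite k A] (e : A) : Module.Finite k (leftIdeal k e).V :=
  inferInstanceAs (Module.Finite k (LinearMap.range (LinearMap.mulRight k e)))
instance [Module.Finite k A] (e : A) : Module.Finite k (rightIdeal k e).V :=
  inferInstanceAs (Module.Finite k (LinearMap.range (LinearMap.mulLeft k e)))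

lemma tensor_finite {R S T : Type u} [Ring R] [Algebra k R] [Ring S] [Algebra k S] [Ring T]
    [Algebra k T] (M : BiMod k T S) (N : BiMod k S R) [Module.Finite k M.V]
    [Module.Finite k N.V] : Module.Finite k (BiMod.tensor M N).V :=
  inferInstanceAs (Module.Finite k ((M.V ⊗[k] N.V) ⧸ BiMod.tensorRel M N))

end Ideals

namespace Alg
variable {k : Type u} [Field k]

instance {R S T : Alg k} (F : R ⟶ S) : (precomp T F).Additive where
  map_add {_ _ f g} := whiskerLeft_add F f g
instance {R S T : Alg k} (F : S ⟶ T) : (postcomp R F).Additive where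
  map_add {_ _ f g} := whiskerRight_add f g F

/-- The ground field. -/
def ground (k : Type u) [Field k] : Alg k := ⟨k⟩

lemma ground_lact (V : BiMod k k k) (c : k) (x : V.V) : V.lact c x = c • x := by
  have := AlgHom.commutes V.lact c
  rw [Algebra.algebraMap_self_apply] at this
  rw [this]; rfl

lemma ground_ract (V : BiMod k k k) (c : kᵐᵒᵖ) (x : V.V) : V.ract c x = c.unop • x := by
  have := AlgHom.commutes V.ract c.unop
  have h2 : algebraMap k kᵐᵒᵖ c.unop = c := rfl
  rw [h2] at this
  rw [this]; rfl

/-- A morphism of `k`-`k`-bimodules from a linear map. -/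
def groundHom {V W : BiMod k k k} (f : V.V →ₗ[k] W.V) : V ⟶ W :=
  ⟨f, fun s x => by simp [ground_lact], fun s x => by simp [ground_ract]⟩

lemma inAdd_ground (V : ground k ⟶ ground k) (hV : Module.Finite k (BiMod.V V)) :
    InAdd (fun _ : Unit => 𝟙 (ground k)) V := by
  let b := Module.finBasis k (BiMod.V V)
  refine ⟨Fin (Module.finrank k (BiMod.V V)), inferInstance, fun _ => (),
    fun x => groundHom (V := V) (W := BiMod.regular k k)
      ((BiMod.ofReg k k).toLinearMap ∘ₗ b.coord x),
    fun x => groundHom (V := BiMod.regular k k) (W := V)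
      ((LinearMap.toSpanSingleton k _ (b x)) ∘ₗ (BiMod.ofReg k k).symm.toLinearMap), ?_⟩
  refine BiMod.hom_ext fun y => ?_
  rw [BiMod.sum_lin]
  exact b.sum_repr y

end Alg

namespace Bim
open Alg

variable (k : Type u) [Field k] (n : ℕ)

/-- `A_n` as an object of the bicategory of bimodules. -/
def A : Alg k := ⟨StarAlg k n⟩

variable {n} in
/-- The left module `A e_j`. -/
def Ae (j : Fin (n + 1)) : ground k ⟶ A k n := leftIdeal k (StarAlg.e k n j)

/-- The right module `e_0 A`. -/
def eA : A k n ⟶ ground k := rightIdeal k (StarAlg.e k n 0)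

/-- The left module `A`. -/
def leftReg : ground k ⟶ A k n := leftIdeal k (1 : StarAlg k n)

variable {n} in
/-- The bimodule `A e_j ⊗_k e_0 A`. -/
def proj (j : Fin (n + 1)) : A k n ⟶ A k n := eA k n ≫ Ae k j

/-- The generators `A` and `A e_j ⊗_k e_0 A`, `0 ≤ j ≤ n`. -/
def gens : Option (Fin (n + 1)) → (A k n ⟶ A k n)
  | none => 𝟙 (A k n)
  | some j => proj k j

/-- The bimodules in `add {A, A e_j ⊗_k e_0 A | 0 ≤ j ≤ n}`. -/
def IsB : ObjectProperty (A k n ⟶ A k n) := InAdd (gens k n)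

/-- The bimodules in `add {A e_j ⊗_k e_0 A | 0 ≤ j ≤ n}`. -/
def IsN : ObjectProperty (A k n ⟶ A k n) := InAdd (proj k (n := n))

/-- The finitely generated projective left `A`-modules: the direct summands of the modules `A^m`. -/
def IsProj : ObjectProperty (ground k ⟶ A k n) := InAdd fun _ : Unit => leftReg k n

lemma isProj_Ae (j : Fin (n + 1)) : IsProj k n (Ae k j) :=
  InAdd.of_retract (N := leftReg k n) _ _
    (leftIdeal_retract (StarAlg.e k n j) (StarAlg.e_mul_self k j))
    (InAdd.of_mem (G := fun _ : Unit => leftReg k n) ())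

lemma inAdd_Ae : InAdd (Ae k (n := n)) (leftReg k n) :=
  ⟨Fin (n + 1), inferInstance, id, _, _,
    leftIdeal_sum (StarAlg.e k n) (StarAlg.e_mul_self k) (StarAlg.sum_e k)⟩

lemma inAdd_ground_comp {R : Alg k} (V : ground k ⟶ ground k) (hV : Module.Finite k (BiMod.V V))
    (X : ground k ⟶ R) : InAdd (fun _ : Unit => X) (V ≫ X) :=
  ((inAdd_ground V hV).map (postcomp _ X)).trans
    fun _ => InAdd.of_iso (λ_ X) (InAdd.of_mem (G := fun _ : Unit => X) ())

lemma isProj_comp {X : ground k ⟶ A k n} {F : A k n ⟶ A k n} (hX : IsProj k n X)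
    (hF : IsB k n F) : IsProj k n (X ≫ F) := by
  refine (hX.map (postcomp _ F)).trans fun _ => ?_
  refine (hF.map (precomp _ (leftReg k n))).trans fun j => ?_
  cases j with
  | none => exact InAdd.of_iso (ρ_ _) (InAdd.of_mem (G := fun _ : Unit => leftReg k n) ())
  | some j =>
    refine InAdd.of_iso (α_ (leftReg k n) (eA k n) (Ae k j)).symm ?_
    refine (inAdd_ground_comp k _ ?_ (Ae k j)).trans fun _ => isProj_Ae k n j
    exact tensor_finite (rightIdeal k (StarAlg.e k n 0)) (leftIdeal k (1 : StarAlg k n))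

lemma isN_proj_comp (j : Fin (n + 1)) {F : A k n ⟶ A k n} (hF : IsB k n F) :
    IsN k n (proj k j ≫ F) := by
  refine InAdd.of_iso (α_ (eA k n) (Ae k j) F) ?_
  refine ((isProj_comp k n (isProj_Ae k n j) hF).map (precomp _ (eA k n))).trans fun _ => ?_
  exact ((inAdd_Ae k n).map (precomp _ (eA k n))).trans fun l =>
    InAdd.of_mem (G := proj k (n := n)) l

lemma isN_comp {X F : A k n ⟶ A k n} (hX : IsN k n X) (hF : IsB k n F) : IsN k n (X ≫ F) :=
  (hX.map (postcomp _ F)).trans fun j => isN_proj_comp k n j hF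

lemma isB_of_isN {X : A k n ⟶ A k n} (hX : IsN k n X) : IsB k n X :=
  hX.trans fun j => InAdd.of_mem (G := gens k n) (some j)

lemma isB_id : IsB k n (𝟙 (A k n)) := InAdd.of_mem (G := gens k n) none

lemma isB_comp {X F : A k n ⟶ A k n} (hX : IsB k n X) (hF : IsB k n F) : IsB k n (X ≫ F) := by
  refine (hX.map (postcomp _ F)).trans fun j => ?_
  cases j with
  | none => exact InAdd.of_iso (λ_ F) hF
  | some j => exact isB_of_isN k n (isN_proj_comp k n j hF)

variable {n}

section Corner
open BiMod

/-- Right multiplication by `a_j`, as a map `A e_j ⟶ A e_0`. -/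
def rhoM (j : Fin n) :
    leftIdeal k (StarAlg.e k n j.succ) ⟶ leftIdeal k (StarAlg.e k n 0) :=
  rightMul (StarAlg.e k n j.succ) (StarAlg.e k n 0) (StarAlg.arrA k j) (StarAlg.arrA_mul_e k j)

/-- The pure tensors in `e_0 A ⊗_A A f`. -/
abbrev ctm (f : StarAlg k n) (v : (rightIdeal k (StarAlg.e k n 0)).V) (x : (leftIdeal k f).V) :
    (tensor (rightIdeal k (StarAlg.e k n 0)) (leftIdeal k f)).V :=
  tm (rightIdeal k (StarAlg.e k n 0)) (leftIdeal k f) v x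

/-- The element `e_0 ⊗ b_j` of `e_0 A ⊗_A A e_j`. -/
def ctmB (j : Fin n) : (tensor (rightIdeal k (StarAlg.e k n 0))
    (leftIdeal k (StarAlg.e k n j.succ))).V :=
  ctm k _ (rightMk _ _ (StarAlg.e_mul_self k 0))
    (leftMk _ (StarAlg.arrB k j) (StarAlg.arrB_mul_e k j))

/-- The map `e_0 A ⊗_A A e_0 ⟶ e_0 A ⊗_A A e_j`, `v ⊗ y ↦ γ • e_0 ⊗ b_j`, where `γ` is the
coefficient of `c` in `v y`. -/
def tauM (j : Fin n) :
    tensor (rightIdeal k (StarAlg.e k n 0)) (leftIdeal k (StarAlg.e k n 0)) ⟶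
      tensor (rightIdeal k (StarAlg.e k n 0)) (leftIdeal k (StarAlg.e k n j.succ)) :=
  homLift (M := rightIdeal k (StarAlg.e k n 0)) (N := leftIdeal k (StarAlg.e k n 0))
    (LinearMap.mk₂ k (fun v y => (rightVal _ v * leftVal _ y).c • ctmB k j)
      (fun _ _ _ => by rw [map_add, add_mul, StarAlg.add_c, add_smul])
      (fun _ _ _ => by rw [map_smul, smul_mul_assoc, StarAlg.smul_c, mul_smul])
      (fun _ _ _ => by rw [map_add, mul_add, StarAlg.add_c, add_smul])
      (fun _ _ _ => by rw [map_smul, mul_smul_comm, StarAlg.smul_c, mul_smul]))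
    (fun s m x => by
      simp only [LinearMap.mk₂_apply, rightVal_ract, leftVal_lact, unop_op, mul_assoc])
    (fun t m x => by
      rw [ground_lact]
      simp only [LinearMap.mk₂_apply, rightVal_lact, smul_mul_assoc, StarAlg.smul_c, mul_smul])
    (fun t m x => by
      rw [ground_ract]
      simp only [LinearMap.mk₂_apply, leftVal_ract, mul_smul_comm, StarAlg.smul_c, mul_smul])

lemma tauM_tm (j : Fin n) (v : (rightIdeal k (StarAlg.e k n 0)).V)
    (y : (leftIdeal k (StarAlg.e k n 0)).V) :
    Hom.lin (tauM k j) (ctm k _ v y) = (rightVal _ v * leftVal _ y).c • ctmB k j :=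
  homLift_tm (M := rightIdeal k (StarAlg.e k n 0)) (N := leftIdeal k (StarAlg.e k n 0))
    _ _ _ _ v y

/-- In `e_0 A ⊗_A A f` we have `v ⊗ x = e_0 ⊗ v x`. -/
lemma ctm_eq {f : StarAlg k n} (hf : f * f = f) (v : (rightIdeal k (StarAlg.e k n 0)).V)
    (x : (leftIdeal k f).V) (z : StarAlg k n) (hz : rightVal _ v * leftVal _ x = z) :
    ctm k f v x = ctm k f (rightMk _ _ (StarAlg.e_mul_self k 0))
      (leftMk _ z (by rw [← hz, mul_assoc, leftVal_mul f hf])) := by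
  subst hz
  have h1 : v = (rightIdeal k (StarAlg.e k n 0)).ract (op (rightVal _ v))
      (rightMk _ _ (StarAlg.e_mul_self k 0)) :=
    rightVal_injective (k := k) _ (mul_rightVal _ (StarAlg.e_mul_self k 0) v).symm
  conv_lhs => rw [h1, ctm, tm_balanced]
  rfl

lemma corner_b (j : Fin n) (v : (rightIdeal k (StarAlg.e k n 0)).V)
    (x : (leftIdeal k (StarAlg.e k n j.succ)).V) :
    ∃ γ : k, rightVal _ v * leftVal _ x = γ • StarAlg.arrB k j := by
  refine ⟨(rightVal _ v * leftVal _ x).b j, ?_⟩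
  rw [← mul_rightVal _ (StarAlg.e_mul_self k 0) v,
    ← leftVal_mul _ (StarAlg.e_mul_self k j.succ) x]
  generalize rightVal _ v = p
  generalize leftVal _ x = q
  ext l <;> simp [StarAlg.e_zero_def, StarAlg.e_succ_def, StarAlg.arrB, Pi.single_apply]
  split_ifs with h
  · rw [h]
  · simp

lemma ctm_succ (j : Fin n) (v : (rightIdeal k (StarAlg.e k n 0)).V)
    (x : (leftIdeal k (StarAlg.e k n j.succ)).V) (γ : k)
    (h : rightVal _ v * leftVal _ x = γ • StarAlg.arrB k j) :
    ctm k _ v x = γ • ctmB k j := by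
  rw [ctm_eq k (StarAlg.e_mul_self k j.succ) v x _ h, ctmB, ctm, ctm, ← map_smul]
  rfl

lemma rhoM_tm (j : Fin n) (v : (rightIdeal k (StarAlg.e k n 0)).V)
    (x : (leftIdeal k (StarAlg.e k n j.succ)).V) :
    Hom.lin (tensorHom (𝟙 (rightIdeal k (StarAlg.e k n 0))) (rhoM k j)) (ctm k _ v x) =
      ctm k _ v (Hom.lin (rhoM k j) x) :=
  tensorHom_tm (𝟙 (rightIdeal k (StarAlg.e k n 0))) (rhoM k j) v x

lemma rhoM_val (j : Fin n) (v : (rightIdeal k (StarAlg.e k n 0)).V)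
    (x : (leftIdeal k (StarAlg.e k n j.succ)).V) (γ : k)
    (h : rightVal _ v * leftVal _ x = γ • StarAlg.arrB k j) :
    rightVal _ v * leftVal _ (Hom.lin (rhoM k j) x) = γ • StarAlg.arrC k n := by
  rw [rhoM, leftVal_rightMul, ← mul_assoc, h, smul_mul_assoc, StarAlg.arrB_mul_arrA]

lemma tauM_rhoM_tm (i j : Fin n) (v : (rightIdeal k (StarAlg.e k n 0)).V)
    (x : (leftIdeal k (StarAlg.e k n i.succ)).V) (γ : k)
    (h : rightVal _ v * leftVal _ x = γ • StarAlg.arrB k i) :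
    Hom.lin (tauM k j) (Hom.lin (tensorHom (𝟙 (rightIdeal k (StarAlg.e k n 0))) (rhoM k i))
      (ctm k _ v x)) = γ • ctmB k j := by
  rw [rhoM_tm, tauM_tm, rhoM_val k i v x γ h]
  simp [StarAlg.arrC]

lemma rhoM_tauM (j : Fin n) :
    tensorHom (𝟙 (rightIdeal k (StarAlg.e k n 0))) (rhoM k j) ≫ tauM k j = 𝟙 _ := by
  refine tensor_hom_ext fun v x => ?_
  obtain ⟨γ, h⟩ := corner_b k j v x
  exact (tauM_rhoM_tm k j j v x γ h).trans (ctm_succ k j v x γ h).symm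

lemma rhoM_tauM_rhoM (i j : Fin n) :
    tensorHom (𝟙 (rightIdeal k (StarAlg.e k n 0))) (rhoM k i) ≫ tauM k j ≫
      tensorHom (𝟙 (rightIdeal k (StarAlg.e k n 0))) (rhoM k j) =
    tensorHom (𝟙 (rightIdeal k (StarAlg.e k n 0))) (rhoM k i) := by
  refine tensor_hom_ext fun v x => ?_
  obtain ⟨γ, h⟩ := corner_b k i v x
  change Hom.lin (tensorHom (𝟙 (rightIdeal k (StarAlg.e k n 0))) (rhoM k j))
    (Hom.lin (tauM k j) (Hom.lin (tensorHom (𝟙 _) (rhoM k i)) (ctm k _ v x))) =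
    Hom.lin (tensorHom (𝟙 _) (rhoM k i)) (ctm k _ v x)
  rw [tauM_rhoM_tm k i j v x γ h, map_smul, ctmB, rhoM_tm, rhoM_tm,
    ctm_eq k (StarAlg.e_mul_self k 0) v _ _ (rhoM_val k i v x γ h),
    ctm_eq k (StarAlg.e_mul_self k 0) _ _ (StarAlg.arrC k n) ?_, ctm, ctm, ← map_smul]
  · rfl
  · rw [rhoM, leftVal_rightMul, rightVal_mk, leftVal_mk, ← mul_assoc, StarAlg.e_mul_arrB,
      StarAlg.arrB_mul_arrA]

end Corner

/-- Right multiplication by `a_j`, as a morphism `A e_j ⟶ A e_0`. -/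
def rho (j : Fin n) : Ae k j.succ ⟶ Ae k (0 : Fin (n + 1)) := rhoM k j

/-- A left inverse of the map `e_0 A ⊗_A A e_j ⟶ e_0 A ⊗_A A e_0` induced by `rho k j`. -/
def tau (j : Fin n) : Ae k (0 : Fin (n + 1)) ≫ eA k n ⟶ Ae k j.succ ≫ eA k n := tauM k j

lemma rho_tau (j : Fin n) : rho k j ▷ eA k n ≫ tau k j = 𝟙 (Ae k j.succ ≫ eA k n) :=
  rhoM_tauM k j

lemma rho_tau_rho (i j : Fin n) :
    rho k i ▷ eA k n ≫ tau k j ≫ rho k j ▷ eA k n = rho k i ▷ eA k n :=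
  rhoM_tauM_rhoM k i j

/-- The property of `N` that the maps `N ⊗_A A e_j ⟶ N ⊗_A A e_0` induced by the `rho`'s are
split monomorphisms and have the same image. -/
def Balanced (N : A k n ⟶ A k n) : Prop :=
  ∀ j : Fin n, ∃ t : Ae k (0 : Fin (n + 1)) ≫ N ⟶ Ae k j.succ ≫ N, rho k j ▷ N ≫ t = 𝟙 _ ∧
    ∀ i : Fin n, rho k i ▷ N ≫ t ≫ rho k j ▷ N = rho k i ▷ N

lemma balanced_comp (l : Fin (n + 1)) : Balanced k (eA k n ≫ Ae k l) := by
  refine fun j => ⟨(α_ _ _ _).inv ≫ tau k j ▷ Ae k l ≫ (α_ _ _ _).hom, ?_, fun i => ?_⟩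
  · have := congrArg (fun t => t ▷ Ae k l) (rho_tau k j)
    simp only [Bicategory.comp_whiskerRight, Bicategory.id_whiskerRight] at this
    rw [Bicategory.whiskerRight_comp]
    simp [reassoc_of% this]
  · have := congrArg (fun t => t ▷ Ae k l) (rho_tau_rho k i j)
    simp only [Bicategory.comp_whiskerRight] at this
    rw [Bicategory.whiskerRight_comp, Bicategory.whiskerRight_comp]
    simp [reassoc_of% this]

lemma balanced_proj (l : Fin (n + 1)) : Balanced k (proj k l) := balanced_comp k l

lemma balanced_of_isN {N : A k n ⟶ A k n} (hN : IsN k n N) : Balanced k N := by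
  intro j
  obtain ⟨J, _, l, i, p, h⟩ := hN
  choose t ht ht' using fun x => balanced_proj k (l x) j
  have key : ∀ m : Fin n, rho k m ▷ N ≫ (∑ x, Ae k 0 ◁ i x ≫ t x ≫ Ae k j.succ ◁ p x) =
      ∑ x, Ae k m.succ ◁ i x ≫ (rho k m ▷ proj k (l x) ≫ t x) ≫ Ae k j.succ ◁ p x := by
    intro m
    rw [Preadditive.comp_sum]
    refine Finset.sum_congr rfl fun x _ => ?_
    rw [← whisker_exchange_assoc, Category.assoc]
  have hsum : ∀ m : Fin (n + 1), ∑ x, Ae k m ◁ i x ≫ Ae k m ◁ p x = 𝟙 (Ae k m ≫ N) := by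
    intro m
    have := congrArg (fun f => (precomp _ (Ae k m)).map f) h
    rw [Functor.map_sum] at this
    simp only [Functor.map_comp] at this
    exact this.trans (CategoryTheory.Functor.map_id _ _)
  refine ⟨∑ x, Ae k 0 ◁ i x ≫ t x ≫ Ae k j.succ ◁ p x, ?_, fun m => ?_⟩
  · rw [key]
    simp only [ht, Category.id_comp]
    exact hsum _
  · rw [← Category.assoc, key, Preadditive.sum_comp]
    have : ∀ x, (Ae k m.succ ◁ i x ≫ (rho k m ▷ proj k (l x) ≫ t x) ≫ Ae k j.succ ◁ p x) ≫
        rho k j ▷ N = rho k m ▷ N ≫ (Ae k 0 ◁ i x ≫ Ae k 0 ◁ p x) := by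
      intro x
      simp only [Category.assoc]
      rw [whisker_exchange, ← whisker_exchange_assoc]
      rw [reassoc_of% ht' x m]
    simp only [this]
    rw [← Preadditive.comp_sum, hsum, Category.comp_id]

end Bim

/-- Small `k`-linear categories (small with respect to a universe that contains the category of
all bimodules over algebras in `Type u`). -/
structure LinCat (k : Type u) [Field k] : Type (u + 2) where
  carrier : Type (u + 1)
  [category : Category.{u + 1} carrier]
  [preadditive : Preadditive carrier]
  [linear : Linear k carrier]

attribute [instance] LinCat.category LinCat.preadditive LinCat.linear

namespace LinCat

variable {k : Type u} [Field k]

/-- `k`-linear functors. -/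
structure Hom (C D : LinCat k) where
  functor : C.carrier ⥤ D.carrier
  [additive : functor.Additive]
  [linear : functor.Linear k]

attribute [instance] Hom.additive Hom.linear

/-- Natural transformations. -/
@[ext]
structure Hom₂ {C D : LinCat k} (F G : Hom C D) where
  nat : F.functor ⟶ G.functor

instance : CategoryStruct (LinCat k) where
  Hom C D := Hom C D
  id C := { functor := 𝟭 C.carrier }
  comp F G := { functor := F.functor ⋙ G.functor }

section

/-- The category of `k`-linear functors. -/
abbrev homCat (C D : LinCat k) : Category (C ⟶ D) where
  Hom F G := Hom₂ F G
  id F := ⟨𝟙 F.functor⟩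
  comp α β := ⟨α.nat ≫ β.nat⟩

attribute [local instance] homCat

/-- An isomorphism of `k`-linear functors from a natural isomorphism. -/
abbrev isoMk {C D : LinCat k} {F G : C ⟶ D} (e : F.functor ≅ G.functor) : F ≅ G where
  hom := ⟨e.hom⟩
  inv := ⟨e.inv⟩
  hom_inv_id := Hom₂.ext e.hom_inv_id
  inv_hom_id := Hom₂.ext e.inv_hom_id

lemma ext' {C D : LinCat k} {F G : C ⟶ D} {α β : F ⟶ G}
    (h : ∀ X, α.nat.app X = β.nat.app X) : α = β :=
  Hom₂.ext (NatTrans.ext (funext h))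

instance : Bicategory (LinCat k) where
  homCategory C D := homCat C D
  whiskerLeft F _ _ α := ⟨F.functor.whiskerLeft α.nat⟩
  whiskerRight α G := ⟨Functor.whiskerRight α.nat G.functor⟩
  associator F G H := isoMk (Functor.associator F.functor G.functor H.functor)
  leftUnitor F := isoMk F.functor.leftUnitor
  rightUnitor F := isoMk F.functor.rightUnitor
  whiskerLeft_id _ _ := ext' fun _ => rfl
  whiskerLeft_comp _ _ _ _ _ _ := ext' fun _ => rfl
  id_whiskerLeft α := ext' fun X => ((Category.id_comp _).trans (Category.comp_id _)).symm
  comp_whiskerLeft F G _ _ α := ext' fun X => ((Category.id_comp _).trans (Category.comp_id _)).symm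
  id_whiskerRight F G := ext' fun X => G.functor.map_id _
  comp_whiskerRight α β G := ext' fun X => G.functor.map_comp _ _
  whiskerRight_id α := ext' fun X => ((Category.id_comp _).trans (Category.comp_id _)).symm
  whiskerRight_comp α G H := ext' fun X => ((Category.id_comp _).trans (Category.comp_id _)).symm
  whisker_assoc F _ _ α H := ext' fun X => ((Category.id_comp _).trans (Category.comp_id _)).symm
  whisker_exchange α β := ext' fun X => (β.nat.naturality (α.nat.app X)).symm
  pentagon F G H I := ext' fun X => by
    change I.functor.map (𝟙 _) ≫ 𝟙 _ ≫ 𝟙 _ = 𝟙 _ ≫ 𝟙 _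
    simp
  triangle F G := ext' fun X => by
    change 𝟙 _ ≫ 𝟙 _ = G.functor.map (𝟙 _)
    simp

end

section Lemmas

variable {C D E F : LinCat k}

@[simp] lemma id_functor : Hom.functor (𝟙 C) = 𝟭 C.carrier := rfl
@[simp] lemma comp_functor (G : C ⟶ D) (H : D ⟶ E) :
    Hom.functor (G ≫ H) = Hom.functor G ⋙ Hom.functor H := rfl
@[simp] lemma id_nat_app (G : C ⟶ D) (X : C.carrier) :
    (Hom₂.nat (𝟙 G)).app X = 𝟙 ((Hom.functor G).obj X) := rfl
@[simp] lemma comp_nat_app {G H K : C ⟶ D} (α : G ⟶ H) (β : H ⟶ K) (X : C.carrier) :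
    (Hom₂.nat (α ≫ β)).app X = (Hom₂.nat α).app X ≫ (Hom₂.nat β).app X := rfl
@[simp] lemma whiskerLeft_nat_app (G : C ⟶ D) {H K : D ⟶ E} (α : H ⟶ K) (X : C.carrier) :
    (Hom₂.nat (G ◁ α)).app X = (Hom₂.nat α).app ((Hom.functor G).obj X) := rfl
@[simp] lemma whiskerRight_nat_app {G H : C ⟶ D} (α : G ⟶ H) (K : D ⟶ E) (X : C.carrier) :
    (Hom₂.nat (α ▷ K)).app X = (Hom.functor K).map ((Hom₂.nat α).app X) := rfl
@[simp] lemma associator_hom_nat_app (G : C ⟶ D) (H : D ⟶ E) (K : E ⟶ F) (X : C.carrier) :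
    (Hom₂.nat (α_ G H K).hom).app X =
      𝟙 ((Hom.functor K).obj ((Hom.functor H).obj ((Hom.functor G).obj X))) := rfl
@[simp] lemma associator_inv_nat_app (G : C ⟶ D) (H : D ⟶ E) (K : E ⟶ F) (X : C.carrier) :
    (Hom₂.nat (α_ G H K).inv).app X =
      𝟙 ((Hom.functor K).obj ((Hom.functor H).obj ((Hom.functor G).obj X))) := rfl
@[simp] lemma leftUnitor_hom_nat_app (G : C ⟶ D) (X : C.carrier) :
    (Hom₂.nat (λ_ G).hom).app X = 𝟙 ((Hom.functor G).obj X) := rfl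
@[simp] lemma leftUnitor_inv_nat_app (G : C ⟶ D) (X : C.carrier) :
    (Hom₂.nat (λ_ G).inv).app X = 𝟙 ((Hom.functor G).obj X) := rfl
@[simp] lemma rightUnitor_hom_nat_app (G : C ⟶ D) (X : C.carrier) :
    (Hom₂.nat (ρ_ G).hom).app X = 𝟙 ((Hom.functor G).obj X) := rfl
@[simp] lemma rightUnitor_inv_nat_app (G : C ⟶ D) (X : C.carrier) :
    (Hom₂.nat (ρ_ G).inv).app X = 𝟙 ((Hom.functor G).obj X) := rfl

end Lemmas

end LinCat

/-- The type of objects of the bicategory `B_n`, which has a single object. Its `1`-morphisms are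
the bimodules in `add {A, A e_j ⊗_k e_0 A | 0 ≤ j ≤ n}`, its `2`-morphisms are all bimodule
homomorphisms, and the composite of `F` with `G` is `G ⊗_A F`. -/
structure StarB (k : Type u) [Field k] (n : ℕ) : Type

namespace StarB

variable {k : Type u} [Field k] {n : ℕ}

open Bim

instance : CategoryStruct.{u + 1} (StarB k n) where
  Hom _ _ := (IsB k n).FullSubcategory
  id _ := ⟨𝟙 (A k n), isB_id k n⟩
  comp F G := ⟨F.obj ≫ G.obj, isB_comp k n F.property G.property⟩

section

/-- The category of `1`-morphisms of `B_n`. -/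
abbrev homCat (i j : StarB k n) : Category.{u + 1} (i ⟶ j) :=
  inferInstanceAs (Category (IsB k n).FullSubcategory)

attribute [local instance] homCat

instance : Bicategory.{u + 1, u + 1} (StarB k n) where
  homCategory i j := homCat i j
  whiskerLeft F _ _ α := ObjectProperty.homMk (F.obj ◁ α.hom)
  whiskerRight α G := ObjectProperty.homMk (α.hom ▷ G.obj)
  associator F G H := ObjectProperty.isoMk _ (α_ F.obj G.obj H.obj)
  leftUnitor F := ObjectProperty.isoMk _ (λ_ F.obj)
  rightUnitor F := ObjectProperty.isoMk _ (ρ_ F.obj)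
  whiskerLeft_id F G := ObjectProperty.hom_ext _ (whiskerLeft_id F.obj G.obj)
  whiskerLeft_comp F _ _ _ α β := ObjectProperty.hom_ext _ (whiskerLeft_comp F.obj α.hom β.hom)
  id_whiskerLeft α := ObjectProperty.hom_ext _ (id_whiskerLeft α.hom)
  comp_whiskerLeft F G _ _ α := ObjectProperty.hom_ext _ (comp_whiskerLeft F.obj G.obj α.hom)
  id_whiskerRight F G := ObjectProperty.hom_ext _ (id_whiskerRight F.obj G.obj)
  comp_whiskerRight α β G := ObjectProperty.hom_ext _ (comp_whiskerRight α.hom β.hom G.obj)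
  whiskerRight_id α := ObjectProperty.hom_ext _ (whiskerRight_id α.hom)
  whiskerRight_comp α G H := ObjectProperty.hom_ext _ (whiskerRight_comp α.hom G.obj H.obj)
  whisker_assoc F _ _ α H := ObjectProperty.hom_ext _ (whisker_assoc F.obj α.hom H.obj)
  whisker_exchange α β := ObjectProperty.hom_ext _ (whisker_exchange α.hom β.hom)
  pentagon F G H I := ObjectProperty.hom_ext _ (Bicategory.pentagon F.obj G.obj H.obj I.obj)
  triangle F G := ObjectProperty.hom_ext _ (Bicategory.triangle F.obj G.obj)

end

instance (i j : StarB k n) : Preadditive (i ⟶ j) :=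
  inferInstanceAs (Preadditive (IsB k n).FullSubcategory)
instance (i j : StarB k n) : Linear k (i ⟶ j) :=
  inferInstanceAs (Linear k (IsB k n).FullSubcategory)

end StarB

/-- The objects of `[B_n, Cat_k]_k`: pseudofunctors `B_n ⥤ Cat_k` that are `k`-linear on
`2`-morphisms. -/
structure LinRep (k : Type u) [Field k] (n : ℕ) : Type (u + 2) where
  toPseudofunctor : StarB k n ⥤ᵖ LinCat k
  map₂_add : ∀ {i j : StarB k n} {F G : i ⟶ j} (α β : F ⟶ G)
    (X : (toPseudofunctor.obj i).carrier),
    (LinCat.Hom₂.nat (toPseudofunctor.map₂ (α + β))).app X =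
      (LinCat.Hom₂.nat (toPseudofunctor.map₂ α)).app X +
        (LinCat.Hom₂.nat (toPseudofunctor.map₂ β)).app X
  map₂_smul : ∀ {i j : StarB k n} {F G : i ⟶ j} (c : k) (α : F ⟶ G)
    (X : (toPseudofunctor.obj i).carrier),
    (LinCat.Hom₂.nat (toPseudofunctor.map₂ (c • α))).app X =
      c • (LinCat.Hom₂.nat (toPseudofunctor.map₂ α)).app X

namespace LinRep

variable {k : Type u} [Field k] {n : ℕ}

instance : CategoryStruct (LinRep k n) where
  Hom M N := M.toPseudofunctor ⟶ N.toPseudofunctor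
  id M := 𝟙 M.toPseudofunctor
  comp Φ Ψ := Pseudofunctor.StrongTrans.vcomp Φ Ψ

section

/-- The category of strong transformations and modifications. -/
abbrev homCat (M N : LinRep k n) : Category (M ⟶ N) :=
  inferInstanceAs (Category (M.toPseudofunctor ⟶ N.toPseudofunctor))

attribute [local instance] homCat

/-- Strong transformations as `1`-morphisms and modifications as `2`-morphisms. -/
instance : Bicategory (LinRep k n) where
  homCategory M N := homCat M N
  whiskerLeft Φ _ _ m := whiskerLeft (B := StarB k n ⥤ᵖ LinCat k) Φ m
  whiskerRight m Φ := whiskerRight (B := StarB k n ⥤ᵖ LinCat k) m Φ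
  associator Φ Ψ Ξ := associator (B := StarB k n ⥤ᵖ LinCat k) Φ Ψ Ξ
  leftUnitor Φ := leftUnitor (B := StarB k n ⥤ᵖ LinCat k) Φ
  rightUnitor Φ := rightUnitor (B := StarB k n ⥤ᵖ LinCat k) Φ
  whiskerLeft_id _ _ := whiskerLeft_id (B := StarB k n ⥤ᵖ LinCat k) _ _
  whiskerLeft_comp _ _ _ _ _ _ := whiskerLeft_comp (B := StarB k n ⥤ᵖ LinCat k) _ _ _
  id_whiskerLeft _ := id_whiskerLeft (B := StarB k n ⥤ᵖ LinCat k) _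
  comp_whiskerLeft _ _ _ _ _ := comp_whiskerLeft (B := StarB k n ⥤ᵖ LinCat k) _ _ _
  id_whiskerRight _ _ := id_whiskerRight (B := StarB k n ⥤ᵖ LinCat k) _ _
  comp_whiskerRight _ _ _ := comp_whiskerRight (B := StarB k n ⥤ᵖ LinCat k) _ _ _
  whiskerRight_id _ := whiskerRight_id (B := StarB k n ⥤ᵖ LinCat k) _
  whiskerRight_comp _ _ _ := whiskerRight_comp (B := StarB k n ⥤ᵖ LinCat k) _ _ _
  whisker_assoc _ _ _ _ _ := whisker_assoc (B := StarB k n ⥤ᵖ LinCat k) _ _ _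
  whisker_exchange _ _ := whisker_exchange (B := StarB k n ⥤ᵖ LinCat k) _ _
  pentagon _ _ _ _ := Bicategory.pentagon (B := StarB k n ⥤ᵖ LinCat k) _ _ _ _
  triangle _ _ := Bicategory.triangle (B := StarB k n ⥤ᵖ LinCat k) _ _

end

end LinRep

section SubRep

variable {k : Type u} [Field k] {n : ℕ}
open Bim

/-- A family of bimodules that is stable under tensoring with the bimodules in `B_n`. -/
structure StableFamily (R : Alg k) (n : ℕ) where
  prop : ObjectProperty (R ⟶ A k n)
  comp_mem : ∀ {X : R ⟶ A k n} {F : A k n ⟶ A k n}, prop X → IsB k n F → prop (X ≫ F)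

variable {R : Alg k} (Q : StableFamily R n)

/-- The category of bimodules in the family. -/
def StableFamily.cat : LinCat k := ⟨Q.prop.FullSubcategory⟩

/-- The functor `F ⊗_A -`. -/
def StableFamily.act (F : (IsB k n).FullSubcategory) : Q.cat ⟶ Q.cat :=
  { functor :=
      { obj := fun X => ⟨X.obj ≫ F.obj, Q.comp_mem X.property F.property⟩
        map := fun f => ObjectProperty.homMk (f.hom ▷ F.obj)
        map_id := fun X => ObjectProperty.hom_ext _ (id_whiskerRight _ _)
        map_comp := fun f g => ObjectProperty.hom_ext _ (comp_whiskerRight _ _ _) }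
    additive := ⟨fun {_ _ f g} => ObjectProperty.hom_ext _ (Alg.whiskerRight_add f.hom g.hom F.obj)⟩
    linear := ⟨fun {_ _} f c => ObjectProperty.hom_ext _ (Alg.whiskerRight_smul c f.hom F.obj)⟩ }

/-- The natural transformation `F ⊗_A - ⟶ G ⊗_A -` induced by a bimodule homomorphism. -/
def StableFamily.actMap {F G : (IsB k n).FullSubcategory} (α : F ⟶ G) : Q.act F ⟶ Q.act G :=
  ⟨{ app := fun X => ObjectProperty.homMk (X.obj ◁ α.hom)
     naturality := fun X Y f => ObjectProperty.hom_ext _ (whisker_exchange f.hom α.hom).symm }⟩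

/-- The natural isomorphism `A ⊗_A X ≅ X`. -/
def StableFamily.actId : Q.act ⟨𝟙 (A k n), isB_id k n⟩ ≅ 𝟙 Q.cat :=
  LinCat.isoMk (NatIso.ofComponents (fun X => ObjectProperty.isoMk _ (ρ_ X.obj))
    (fun f => ObjectProperty.hom_ext _ (rightUnitor_naturality f.hom)))

/-- The natural isomorphism `(G ⊗_A F) ⊗_A X ≅ G ⊗_A (F ⊗_A X)`. -/
def StableFamily.actComp (F G : (IsB k n).FullSubcategory) :
    Q.act ⟨F.obj ≫ G.obj, isB_comp k n F.property G.property⟩ ≅ Q.act F ≫ Q.act G :=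
  LinCat.isoMk (NatIso.ofComponents
    (fun X => ObjectProperty.isoMk _ (α_ X.obj F.obj G.obj).symm)
    (fun f => ObjectProperty.hom_ext _
      (associator_inv_naturality_left f.hom F.obj G.obj)))

/-- The birepresentation of `B_n` on a stable family of bimodules, given by tensor products
over `A`. -/
def StableFamily.rep : LinRep k n where
  toPseudofunctor :=
    { obj := fun _ => Q.cat
      map := fun F => Q.act F
      map₂ := fun α => Q.actMap α
      mapId := fun _ => Q.actId
      mapComp := fun F G => Q.actComp F G
      map₂_id := fun F => LinCat.ext' fun X => ObjectProperty.hom_ext _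
        (whiskerLeft_id _ _)
      map₂_comp := fun α β => LinCat.ext' fun X => ObjectProperty.hom_ext _
        (whiskerLeft_comp _ _ _)
      map₂_whisker_left := fun F G H α => LinCat.ext' fun X => ObjectProperty.hom_ext _ (by
        change X.obj ◁ F.obj ◁ α.hom = (α_ X.obj F.obj G.obj).inv ≫ (X.obj ≫ F.obj) ◁ α.hom ≫
          (α_ X.obj F.obj H.obj).hom
        simp)
      map₂_whisker_right := fun {_ _ _ F G} α H => LinCat.ext' fun X =>
        ObjectProperty.hom_ext _ (by
          change X.obj ◁ α.hom ▷ H.obj = (α_ X.obj F.obj H.obj).inv ≫ (X.obj ◁ α.hom) ▷ H.obj ≫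
            (α_ X.obj G.obj H.obj).hom
          simp)
      map₂_associator := fun F G H => LinCat.ext' fun X => ObjectProperty.hom_ext _ (by
        change X.obj ◁ (α_ F.obj G.obj H.obj).hom = (α_ X.obj (F.obj ≫ G.obj) H.obj).inv ≫
          (α_ X.obj F.obj G.obj).inv ▷ H.obj ≫ 𝟙 _ ≫ (α_ (X.obj ≫ F.obj) G.obj H.obj).hom ≫
          (α_ X.obj F.obj (G.obj ≫ H.obj)).hom
        simp)
      map₂_left_unitor := fun F => LinCat.ext' fun X => ObjectProperty.hom_ext _ (by
        change X.obj ◁ (λ_ F.obj).hom = (α_ X.obj (𝟙 _) F.obj).inv ≫ (ρ_ X.obj).hom ▷ F.obj ≫ 𝟙 _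
        simp)
      map₂_right_unitor := fun F => LinCat.ext' fun X => ObjectProperty.hom_ext _ (by
        change X.obj ◁ (ρ_ F.obj).hom = (α_ X.obj F.obj (𝟙 _)).inv ≫ (ρ_ (X.obj ≫ F.obj)).hom ≫
          𝟙 _
        simp) }
  map₂_add α β X := ObjectProperty.hom_ext _ (Alg.whiskerLeft_add _ _ _)
  map₂_smul c α X := ObjectProperty.hom_ext _ (Alg.whiskerLeft_smul _ _ _)

/-- The strong transformation `F ↦ F ⊗_A Y` between the birepresentations on two stable
families, for a bimodule `Y`. -/
def StableFamily.precomp {R' : Alg k} {Q : StableFamily R n} {Q' : StableFamily R' n}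
    (Y : R' ⟶ R) (hY : ∀ X, Q.prop X → Q'.prop (Y ≫ X)) : Q.rep ⟶ Q'.rep :=
  { app := fun _ =>
      { functor :=
          { obj := fun X => ⟨Y ≫ X.obj, hY _ X.property⟩
            map := fun f => ObjectProperty.homMk (Y ◁ f.hom)
            map_id := fun X => ObjectProperty.hom_ext _ (whiskerLeft_id _ _)
            map_comp := fun f g => ObjectProperty.hom_ext _ (whiskerLeft_comp _ _ _) }
        additive := ⟨fun {_ _ f g} => ObjectProperty.hom_ext _
          (Alg.whiskerLeft_add Y f.hom g.hom)⟩
        linear := ⟨fun {_ _} f c => ObjectProperty.hom_ext _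
          (Alg.whiskerLeft_smul c Y f.hom)⟩ }
    naturality := fun F => LinCat.isoMk (NatIso.ofComponents
      (fun X => ObjectProperty.isoMk _ (α_ Y X.obj F.obj).symm)
      (fun f => ObjectProperty.hom_ext _
        (associator_inv_naturality_middle Y f.hom F.obj)))
    naturality_naturality := fun {_ _ F G} α => LinCat.ext' fun X =>
      ObjectProperty.hom_ext _ (associator_inv_naturality_right Y X.obj α.hom)
    naturality_id := fun _ => LinCat.ext' fun X => ObjectProperty.hom_ext _ (by
      change (α_ Y X.obj (𝟙 _)).inv ≫ (ρ_ (Y ≫ X.obj)).hom = Y ◁ (ρ_ X.obj).hom ≫ 𝟙 _ ≫ 𝟙 _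
      simp)
    naturality_comp := fun F G => LinCat.ext' fun X => ObjectProperty.hom_ext _ (by
      change (α_ Y X.obj (F.obj ≫ G.obj)).inv ≫ (α_ (Y ≫ X.obj) F.obj G.obj).inv =
        Y ◁ (α_ X.obj F.obj G.obj).inv ≫ 𝟙 _ ≫ (α_ Y (X.obj ≫ F.obj) G.obj).inv ≫ 𝟙 _ ≫
          (α_ Y X.obj F.obj).inv ▷ G.obj ≫ 𝟙 _
      simp) }

/-- The strong transformation given by an inclusion of stable families. -/
def StableFamily.incl {Q Q' : StableFamily R n} (h : ∀ X, Q.prop X → Q'.prop X) :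
    Q.rep ⟶ Q'.rep :=
  { app := fun _ =>
      { functor :=
          { obj := fun X => ⟨X.obj, h _ X.property⟩
            map := fun f => ObjectProperty.homMk f.hom
            map_id := fun X => rfl
            map_comp := fun f g => rfl }
        additive := ⟨fun {_ _ f g} => rfl⟩
        linear := ⟨fun {_ _} f c => rfl⟩ }
    naturality := fun F => LinCat.isoMk (NatIso.ofComponents
      (fun X => Iso.refl (⟨X.obj ≫ F.obj, _⟩ : Q'.prop.FullSubcategory))
      (fun f => ObjectProperty.hom_ext _ (by
        change (f.hom ▷ F.obj) ≫ 𝟙 _ = 𝟙 _ ≫ f.hom ▷ F.obj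
        simp)))
    naturality_naturality := fun {_ _ F G} α => LinCat.ext' fun X =>
      ObjectProperty.hom_ext _ (by
        change X.obj ◁ α.hom ≫ 𝟙 _ = 𝟙 _ ≫ X.obj ◁ α.hom
        simp)
    naturality_id := fun _ => LinCat.ext' fun X => ObjectProperty.hom_ext _ (by
      change 𝟙 _ ≫ (ρ_ X.obj).hom = (ρ_ X.obj).hom ≫ 𝟙 _ ≫ 𝟙 _
      simp)
    naturality_comp := fun F G => LinCat.ext' fun X => ObjectProperty.hom_ext _ (by
      change 𝟙 _ ≫ (α_ X.obj F.obj G.obj).inv =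
        (α_ X.obj F.obj G.obj).inv ≫ 𝟙 _ ≫ 𝟙 _ ≫ 𝟙 _ ≫ 𝟙 _ ▷ G.obj ≫ 𝟙 _
      simp) }

end SubRep

section Reps

variable (k : Type u) [Field k] (n : ℕ)
open Bim

/-- The principal birepresentation `P = B_n(i, -)`, where `F` acts on `B_n(i, i)` as `F ⊗_A -`. -/
def repP : LinRep k n := StableFamily.rep ⟨IsB k n, isB_comp k n⟩

/-- The subbirepresentation `N` of `P` on `add {A e_j ⊗_k e_0 A | 0 ≤ j ≤ n}`. -/
def repN : LinRep k n := StableFamily.rep ⟨IsN k n, isN_comp k n⟩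

/-- The cell birepresentation `C`, on the category `A-proj`, where `F` acts as `F ⊗_A -`. -/
def repC : LinRep k n := StableFamily.rep ⟨IsProj k n, isProj_comp k n⟩

/-- The inclusion `Γ : N ⟶ P`. -/
def Gam : repN k n ⟶ repP k n := StableFamily.incl fun _ => isB_of_isN k n

variable {n} in
/-- The transformation `Θ_j = - ⊗_A A e_j : P ⟶ C`. -/
def Theta (j : Fin (n + 1)) : repP k n ⟶ repC k n :=
  StableFamily.precomp (Ae k j) fun _ => isProj_comp k n (isProj_Ae k n j)

end Reps

section Modif

variable {k : Type u} [Field k] {n : ℕ}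
open Bim

variable (k) in
lemma exists_smap (i j : Fin n) {N : A k n ⟶ A k n} (hN : IsN k n N) :
    ∃ s : Ae k i.succ ≫ N ⟶ Ae k j.succ ≫ N, s ≫ rho k j ▷ N = rho k i ▷ N := by
  obtain ⟨t, -, h⟩ := balanced_of_isN k hN j
  exact ⟨rho k i ▷ N ≫ t, by rw [Category.assoc, h i]⟩

lemma mono_rho (j : Fin n) {N : A k n ⟶ A k n} (hN : IsN k n N) : Mono (rho k j ▷ N) := by
  obtain ⟨t, h, -⟩ := balanced_of_isN k hN j
  exact mono_of_mono_fac h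

variable (k) in
/-- For `N` in `add {A e_l ⊗_k e_0 A}`, the map `N ⊗_A A e_i ⟶ N ⊗_A A e_j`
(that is, `N e_i ⟶ N e_j`) obtained by composing right multiplication by `a_i`
with the inverse of right multiplication by `a_j` on its image. -/
def smap (i j : Fin n) {N : A k n ⟶ A k n} (hN : IsN k n N) :
    Ae k i.succ ≫ N ⟶ Ae k j.succ ≫ N := (exists_smap k i j hN).choose

/-- This property characterizes `smap`, since `rho k j ▷ N` is a monomorphism. -/
lemma smap_rho (i j : Fin n) {N : A k n ⟶ A k n} (hN : IsN k n N) :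
    smap k i j hN ≫ rho k j ▷ N = rho k i ▷ N := (exists_smap k i j hN).choose_spec

lemma smap_smap (i j : Fin n) {N : A k n ⟶ A k n} (hN : IsN k n N) :
    smap k i j hN ≫ smap k j i hN = 𝟙 _ := by
  have := mono_rho i hN
  rw [← cancel_mono (rho k i ▷ N), Category.assoc, smap_rho, smap_rho, Category.id_comp]

lemma smap_naturality (i j : Fin n) {N N' : A k n ⟶ A k n} (hN : IsN k n N) (hN' : IsN k n N')
    (f : N ⟶ N') : Ae k i.succ ◁ f ≫ smap k i j hN' = smap k i j hN ≫ Ae k j.succ ◁ f := by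
  have := mono_rho j hN'
  rw [← cancel_mono (rho k j ▷ N'), Category.assoc, Category.assoc, smap_rho,
    whisker_exchange, whisker_exchange, ← Category.assoc, smap_rho]

lemma smap_comp (i j : Fin n) {N F : A k n ⟶ A k n} (hN : IsN k n N) (hF : IsN k n (N ≫ F)) :
    smap k i j hF ≫ (α_ _ _ _).inv = (α_ _ _ _).inv ≫ smap k i j hN ▷ F := by
  have := mono_rho j hF
  rw [← cancel_mono (α_ _ _ _).hom, ← cancel_mono (rho k j ▷ (N ≫ F))]
  simp only [Category.assoc, Iso.inv_hom_id, Category.comp_id, smap_rho]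
  rw [Bicategory.whiskerRight_comp, Bicategory.whiskerRight_comp]
  have := congrArg (fun t => t ▷ F) (smap_rho i j hN)
  simp only [comp_whiskerRight] at this
  simp [reassoc_of% this]

variable (k) in
/-- The components of `s_{i,j}`. -/
def smapIso (i j : Fin n) (N : (IsN k n).FullSubcategory) :
    (⟨Ae k i.succ ≫ N.obj, isProj_comp k n (isProj_Ae k n _) (isB_of_isN k n N.property)⟩ :
      (IsProj k n).FullSubcategory) ≅
    ⟨Ae k j.succ ≫ N.obj, isProj_comp k n (isProj_Ae k n _) (isB_of_isN k n N.property)⟩ :=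
  ObjectProperty.isoMk _
    { hom := smap k i j N.property
      inv := smap k j i N.property
      hom_inv_id := smap_smap i j N.property
      inv_hom_id := smap_smap j i N.property }

variable (k) in
/-- The invertible modification `s_{i,j} : Θ_i ∘ Γ ≅ Θ_j ∘ Γ`, for leaves `i`, `j`. -/
def sIso (i j : Fin n) : Gam k n ≫ Theta k i.succ ≅ Gam k n ≫ Theta k j.succ :=
  Pseudofunctor.StrongTrans.isoMk
    (fun _ => LinCat.isoMk (NatIso.ofComponents (fun N => smapIso k i j N)
      (fun {N N'} f => ObjectProperty.hom_ext _
        (smap_naturality i j N.property N'.property f.hom))))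
    (fun F => LinCat.ext' fun N => ObjectProperty.hom_ext _ (by
      change smap k i j (isN_comp k n N.property F.property) ≫ 𝟙 _ ≫ Ae k j.succ ◁ 𝟙 (N.obj ≫ F.obj) ≫ 𝟙 _ ≫
          (α_ (Ae k j.succ) N.obj F.obj).inv ≫ 𝟙 _ =
        (𝟙 _ ≫ Ae k i.succ ◁ 𝟙 (N.obj ≫ F.obj) ≫ 𝟙 _ ≫ (α_ (Ae k i.succ) N.obj F.obj).inv ≫ 𝟙 _) ≫
          smap k i j N.property ▷ F.obj
      simpa using smap_comp i j N.property (isN_comp k n N.property F.property)))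

end Modif

section Colimits

variable {𝒞 : Type u} [Bicategory.{w, v} 𝒞]

/-- `(w, W, ζ)` is a bicategorical coisoinserter of the family of parallel pairs
`F j, G j : p ⟶ c`: for every `d`, precomposition with `W` is an equivalence from the category of
`1`-morphisms `w ⟶ d` to the category of `1`-morphisms `H : c ⟶ d` equipped with invertible
`2`-morphisms `F j ≫ H ≅ G j ≫ H`. -/
structure IsCoisoinserter {ι : Type} {p c w : 𝒞} (F G : ι → (p ⟶ c)) (W : c ⟶ w)
    (ζ : ∀ j, F j ≫ W ≅ G j ≫ W) : Prop where
  exists_desc : ∀ {d : 𝒞} (H : c ⟶ d) (γ : ∀ j, F j ≫ H ≅ G j ≫ H),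
    ∃ (H' : w ⟶ d) (γ' : H ≅ W ≫ H'), ∀ j,
      (γ j).hom ≫ G j ◁ γ'.hom ≫ (α_ (G j) W H').inv =
        F j ◁ γ'.hom ≫ (α_ (F j) W H').inv ≫ (ζ j).hom ▷ H'
  existsUnique_hom : ∀ {d : 𝒞} (U V : w ⟶ d) (η : W ≫ U ⟶ W ≫ V),
    (∀ j, (ζ j).hom ▷ U ≫ (α_ (G j) W U).hom ≫ G j ◁ η ≫ (α_ (G j) W V).inv =
      (α_ (F j) W U).hom ≫ F j ◁ η ≫ (α_ (F j) W V).inv ≫ (ζ j).hom ▷ V) →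
    ∃! θ : U ⟶ V, W ◁ θ = η

/-- `(r, R)` is a bicategorical coequifier of the family of parallel pairs of `2`-morphisms
`α j, β j : f j ⟶ g j`, where `f j, g j : p ⟶ w`: for every `d`, precomposition with `R` is an
equivalence from the category of `1`-morphisms `r ⟶ d` to the full subcategory of the
`1`-morphisms `H : w ⟶ d` with `α j ▷ H = β j ▷ H` for all `j`. -/
structure IsCoequifier {ι : Type} {p w r : 𝒞} {f g : ι → (p ⟶ w)} (α β : ∀ j, f j ⟶ g j)
    (R : w ⟶ r) : Prop where
  whisker_eq : ∀ j, α j ▷ R = β j ▷ R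
  exists_desc : ∀ {d : 𝒞} (H : w ⟶ d), (∀ j, α j ▷ H = β j ▷ H) →
    ∃ H' : r ⟶ d, Nonempty (H ≅ R ≫ H')
  existsUnique_hom : ∀ {d : 𝒞} (U V : r ⟶ d) (η : R ≫ U ⟶ R ≫ V), ∃! θ : U ⟶ V, R ◁ θ = η

end Colimits

section SimpleTransitive

variable {k : Type u} [Field k] {n : ℕ}

/-- A `k`-linear category is finitary if it is equivalent, by a `k`-linear functor, to the
category of finitely generated projective modules over a finite dimensional `k`-algebra. -/
def LinCat.IsFinitary (C : LinCat k) : Prop :=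
  ∃ (R : Type u) (_ : Ring R) (_ : Algebra k R), Module.Finite k R ∧
    ∃ e : C.carrier ⥤ ObjectProperty.FullSubcategory (C := ModuleCat.{u} R)
      (fun M => Module.Finite R M ∧ Module.Projective R M),
      e.IsEquivalence ∧ e.Additive ∧ e.Linear k

namespace LinRep

/-- The action `M F` of a `1`-morphism `F`. -/
def act (M : LinRep k n) {i j : StarB k n} (F : i ⟶ j) :
    (M.toPseudofunctor.obj i).carrier ⥤ (M.toPseudofunctor.obj j).carrier :=
  LinCat.Hom.functor (M.toPseudofunctor.map F)

/-- `B_n`-stable ideals of a birepresentation. -/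
structure StableIdeal (M : LinRep k n) where
  hom : ∀ (i : StarB k n) (X Y : (M.toPseudofunctor.obj i).carrier), Submodule k (X ⟶ Y)
  precomp_mem : ∀ {i : StarB k n} {X Y Z : (M.toPseudofunctor.obj i).carrier} (f : X ⟶ Y)
    {g : Y ⟶ Z}, g ∈ hom i Y Z → f ≫ g ∈ hom i X Z
  postcomp_mem : ∀ {i : StarB k n} {X Y Z : (M.toPseudofunctor.obj i).carrier} {f : X ⟶ Y}
    (g : Y ⟶ Z), f ∈ hom i X Y → f ≫ g ∈ hom i X Z
  act_mem : ∀ {i j : StarB k n} (F : i ⟶ j) {X Y : (M.toPseudofunctor.obj i).carrier}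
    {f : X ⟶ Y}, f ∈ hom i X Y → (M.act F).map f ∈ hom j ((M.act F).obj X) ((M.act F).obj Y)

/-- A stable ideal is proper if, for some object `i`, it is neither zero nor everything at `i`. -/
def StableIdeal.IsProper {M : LinRep k n} (I : M.StableIdeal) : Prop :=
  ∃ i, (∃ X Y, I.hom i X Y ≠ ⊥) ∧ ∃ X Y, I.hom i X Y ≠ ⊤

/-- A birepresentation is simple transitive if it is finitary, nonzero, and has no proper stable
ideals. -/
structure IsSimpleTransitive (M : LinRep k n) : Prop where
  finitary : ∀ i, (M.toPseudofunctor.obj i).IsFinitary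
  nonzero : ∃ (i : StarB k n) (X : (M.toPseudofunctor.obj i).carrier), 𝟙 X ≠ 0
  not_isProper : ∀ I : M.StableIdeal, ¬ I.IsProper

end LinRep

end SimpleTransitive

/-- An enumeration of the blocks, other than `{0}`, of a set partition of `{0, …, n}`: there are
`r` such blocks, the `m`-th one has `size m` elements, and it consists of the leaves
`idx m 0, …, idx m (size m - 1)`, listed without repetition. The leaf `i : Fin n` stands for the
element `i + 1` of `{0, …, n}`. -/
structure BlockEnumeration {n : ℕ} (P : Finpartition (Finset.univ : Finset (Fin (n + 1)))) where
  r : ℕ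
  size : Fin r → ℕ
  idx : ∀ m, Fin (size m) → Fin n
  idx_injective : ∀ m, Function.Injective (idx m)
  block_injective : Function.Injective
    fun m => Finset.univ.image fun l => (idx m l).succ
  mem_parts : ∀ p : Finset (Fin (n + 1)),
    (∃ m, (Finset.univ.image fun l => (idx m l).succ) = p) ↔ p ∈ P.parts ∧ p ≠ {0}

namespace BlockEnumeration

variable {n : ℕ} {P : Finpartition (Finset.univ : Finset (Fin (n + 1)))}
  (E : BlockEnumeration P)

/-- The positions `(m, l)` such that the `m`-th block has both an `l`-th and an `(l+1)`-st
element. -/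
def Pos : Type := Σ m : Fin E.r, {l : ℕ // l + 1 < E.size m}

variable {E}

/-- The leaf in position `(m, l)`. -/
def Pos.fst (x : E.Pos) : Fin n := E.idx x.1 ⟨x.2.1, (Nat.lt_succ_self _).trans x.2.2⟩

/-- The leaf in position `(m, l + 1)`. -/
def Pos.snd (x : E.Pos) : Fin n := E.idx x.1 ⟨x.2.1 + 1, x.2.2⟩

end BlockEnumeration

/-- The data of the construction of `C^{WR}` from a set partition with enumerated blocks.
`(CW, OmW, x)` is the iterated coisoinserter of the transformations `Θ_i : P ⟶ C`: it universally
adds an isomorphism `OmW ∘ Θ_i ≅ OmW ∘ Θ_{i'}` for any two consecutive elements `i`, `i'` of a block.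
`(CWR, OmR)` is the multiple coequifier which universally identifies, for all such `i`, `i'`, the
two modifications `x • Γ` and `OmW • s_{i,i'}` from `OmW ∘ Θ_i ∘ Γ` to `OmW ∘ Θ_{i'} ∘ Γ`. Both
colimits are taken in `[B_n, Cat_k]_k`. -/
structure WRConstruction (k : Type u) [Field k] {n : ℕ}
    {P : Finpartition (Finset.univ : Finset (Fin (n + 1)))} (E : BlockEnumeration P) where
  CW : LinRep k n
  OmW : repC k n ⟶ CW
  x : ∀ z : E.Pos, Theta k z.fst.succ ≫ OmW ≅ Theta k z.snd.succ ≫ OmW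
  isCoisoinserter : IsCoisoinserter (fun z : E.Pos => Theta k z.fst.succ)
    (fun z : E.Pos => Theta k z.snd.succ) OmW x
  CWR : LinRep k n
  OmR : CW ⟶ CWR
  isCoequifier : IsCoequifier
    (f := fun z : E.Pos => (Gam k n ≫ Theta k z.fst.succ) ≫ OmW)
    (g := fun z : E.Pos => (Gam k n ≫ Theta k z.snd.succ) ≫ OmW)
    (fun z => (α_ (Gam k n) (Theta k z.fst.succ) OmW).hom ≫ Gam k n ◁ (x z).hom ≫
      (α_ (Gam k n) (Theta k z.snd.succ) OmW).inv)
    (fun z => (sIso k z.fst z.snd).hom ▷ OmW) OmR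

end StarBirep

end

noncomputable section

namespace StarBirep

/-! ### Linear categories by generators and relations -/

section Presentations

variable {k : Type u} [Field k]

/-! Existence. Both colimits are constructed by generators and relations. The coisoinserter of the
pairs `F z`, `G z` keeps the objects of the target `c` and adjoins formal mutually inverse arrows
between `F z X` and `G z X`, natural in `X`. A 1-morphism `B` sends the arrow at `X` to the arrow at
`B X`, conjugated by the structure isomorphisms of `F z` and `G z`. The coequifier adds relations
only. The universal properties are `LinRep.isCoisoinserter` and `LinRep.isCoequifier`.

Independence of choices. The two colimits together have one universal property,
`IsRelativeCoisoinserter`: they classify transformations out of `C` with isomorphisms that restrict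
along `Γ` to the given modifications. Two solutions are therefore equivalent, and simple
transitivity passes along equivalences, so it suffices to study the explicit model.

In the model the objects are those of `A-proj`. Its morphisms are generated by those of `A-proj` and
by isomorphisms `x_B : B ⊗ A e_i ≅ B ⊗ A e_i'`, natural in `B`, for consecutive leaves of a block;
when `B` lies in `N`, the isomorphism `x_B` is the prescribed one.

The model does not collapse. The functor `e_0 A ⊗_A -` extends to it (`exists_corner`): `e_0 A ⊗_A
B` is in `add (e_0 A)`, and for such bimodules right multiplications by `a_i` and `a_i'` are
injective with the same image, so the required isomorphisms exist and agree with the prescribed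
ones. Call the extension the corner functor. On `A-proj` it is faithful, since a nonzero element of
`e_i A e_j` is not annihilated by `e_0 A` from the left. Hence `A-proj` embeds in the model.

The model is not too large. By naturality every `x_B` is controlled by `x_A` and by prescribed
values. Naturality along the multiplication `A e_0 ⊗ e_0 A ⟶ A` and along a comultiplication `A ⟶ A
e_0 ⊗ e_0 A` given by a Casimir element shows that `x_A : A e_i ≅ A e_i'` carries `b_i` to `b_i'`
and `a_i` to `a_i'` (`bHat_normX`, `normX_rho`). The spaces `e_i A e_j` are so small that every
morphism of the model then comes, along these isomorphisms, from a morphism in `A-proj` between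
modules `A e_j` with `j` the first element of a block (`isSpanned`). So the model is equivalent to
the category of finitely generated projective modules over the opposite endomorphism algebra of the
sum of these `A e_j`, and the corner functor is faithful on all of it.

No proper ideals. Acting by `A e_l ⊗ e_0 A` on a morphism `f` gives `A e_l ⊗_k` (corner of `f`), up
to isomorphism (`wrAct_projB`). If `f` is nonzero, its corner is a nonzero linear map, through which
the identity of `k` factors. Hence a stable ideal containing `f` contains the identities of all `A
e_l`, and so everything. -/

/-- Formal expressions in the morphisms of a `k`-linear category and in additional arrows `gen`. -/
inductive Word {C : LinCat k} (gen : C.carrier → C.carrier → Type (u + 1)) :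
    C.carrier → C.carrier → Type (u + 1)
  | of {X Y : C.carrier} (f : X ⟶ Y) : Word gen X Y
  | gen {X Y : C.carrier} (g : gen X Y) : Word gen X Y
  | comp {X Y Z : C.carrier} (f : Word gen X Y) (g : Word gen Y Z) : Word gen X Z
  | add {X Y : C.carrier} (f g : Word gen X Y) : Word gen X Y
  | smul {X Y : C.carrier} (c : k) (f : Word gen X Y) : Word gen X Y

/-- Additional arrows and relations between the morphisms that can be formed with them. -/
structure LinCat.Presentation (C : LinCat k) where
  gen : C.carrier → C.carrier → Type (u + 1)
  rel : ∀ {X Y : C.carrier}, Word gen X Y → Word gen X Y → Prop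

namespace LinCat.Presentation

variable {C : LinCat k} (S : C.Presentation)

/-- The congruence generated by the relations. -/
inductive Eqv : ∀ {X Y : C.carrier}, Word S.gen X Y → Word S.gen X Y → Prop
  | rel {X Y : C.carrier} {f g : Word S.gen X Y} : S.rel f g → Eqv f g
  | refl {X Y : C.carrier} (f : Word S.gen X Y) : Eqv f f
  | symm {X Y : C.carrier} {f g : Word S.gen X Y} : Eqv f g → Eqv g f
  | trans {X Y : C.carrier} {f g h : Word S.gen X Y} : Eqv f g → Eqv g h → Eqv f h
  | comp {X Y Z : C.carrier} {f f' : Word S.gen X Y} {g g' : Word S.gen Y Z} :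
      Eqv f f' → Eqv g g' → Eqv (f.comp g) (f'.comp g')
  | add {X Y : C.carrier} {f f' g g' : Word S.gen X Y} :
      Eqv f f' → Eqv g g' → Eqv (f.add g) (f'.add g')
  | smul {X Y : C.carrier} (c : k) {f f' : Word S.gen X Y} :
      Eqv f f' → Eqv (f.smul c) (f'.smul c)
  | of_comp {X Y Z : C.carrier} (f : X ⟶ Y) (g : Y ⟶ Z) :
      Eqv (.of (f ≫ g)) (.comp (.of f) (.of g))
  | of_add {X Y : C.carrier} (f g : X ⟶ Y) : Eqv (.of (f + g)) (.add (.of f) (.of g))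
  | of_smul {X Y : C.carrier} (c : k) (f : X ⟶ Y) : Eqv (.of (c • f)) (.smul c (.of f))
  | id_comp {X Y : C.carrier} (f : Word S.gen X Y) : Eqv (.comp (.of (𝟙 X)) f) f
  | comp_id {X Y : C.carrier} (f : Word S.gen X Y) : Eqv (.comp f (.of (𝟙 Y))) f
  | assoc {X Y Z T : C.carrier} (f : Word S.gen X Y) (g : Word S.gen Y Z) (h : Word S.gen Z T) :
      Eqv (.comp (.comp f g) h) (.comp f (.comp g h))
  | add_assoc {X Y : C.carrier} (f g h : Word S.gen X Y) :
      Eqv (.add (.add f g) h) (.add f (.add g h))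
  | add_comm {X Y : C.carrier} (f g : Word S.gen X Y) : Eqv (.add f g) (.add g f)
  | zero_add {X Y : C.carrier} (f : Word S.gen X Y) : Eqv (.add (.of 0) f) f
  | one_smul {X Y : C.carrier} (f : Word S.gen X Y) : Eqv (.smul 1 f) f
  | zero_smul {X Y : C.carrier} (f : Word S.gen X Y) : Eqv (.smul 0 f) (.of 0)
  | mul_smul {X Y : C.carrier} (c d : k) (f : Word S.gen X Y) :
      Eqv (.smul (c * d) f) (.smul c (.smul d f))
  | smul_add {X Y : C.carrier} (c : k) (f g : Word S.gen X Y) :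
      Eqv (.smul c (.add f g)) (.add (.smul c f) (.smul c g))
  | add_smul {X Y : C.carrier} (c d : k) (f : Word S.gen X Y) :
      Eqv (.smul (c + d) f) (.add (.smul c f) (.smul d f))
  | add_comp {X Y Z : C.carrier} (f f' : Word S.gen X Y) (g : Word S.gen Y Z) :
      Eqv (.comp (.add f f') g) (.add (.comp f g) (.comp f' g))
  | comp_add {X Y Z : C.carrier} (f : Word S.gen X Y) (g g' : Word S.gen Y Z) :
      Eqv (.comp f (.add g g')) (.add (.comp f g) (.comp f g'))
  | smul_comp {X Y Z : C.carrier} (c : k) (f : Word S.gen X Y) (g : Word S.gen Y Z) :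
      Eqv (.comp (.smul c f) g) (.smul c (.comp f g))
  | comp_smul {X Y Z : C.carrier} (c : k) (f : Word S.gen X Y) (g : Word S.gen Y Z) :
      Eqv (.comp f (.smul c g)) (.smul c (.comp f g))

/-- The setoid of words modulo the relations. -/
def setoid (X Y : C.carrier) : Setoid (Word S.gen X Y) :=
  ⟨S.Eqv, .refl, .symm, .trans⟩

/-- The objects of the presented category are those of `C`. -/
structure Obj (S : C.Presentation) where
  as : C.carrier

variable {S}

instance : CategoryStruct.{u + 1} S.Obj where
  Hom X Y := Quotient (S.setoid X.as Y.as)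
  id X := Quotient.mk (S.setoid _ _) (.of (𝟙 X.as))
  comp f g := Quotient.map₂ (sa := S.setoid _ _) (sb := S.setoid _ _) (sc := S.setoid _ _)
    Word.comp (fun _ _ h _ _ h' => Eqv.comp h h') f g

/-- The morphism represented by a word. -/
def cls {X Y : C.carrier} (f : Word S.gen X Y) : (⟨X⟩ : S.Obj) ⟶ ⟨Y⟩ :=
  Quotient.mk (S.setoid X Y) f

lemma cls_eq {X Y : C.carrier} {f g : Word S.gen X Y} (h : S.Eqv f g) : cls f = cls g :=
  Quotient.sound (s := S.setoid X Y) h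

lemma cls_surjective {X Y : S.Obj} (f : X ⟶ Y) : ∃ f' : Word S.gen X.as Y.as, cls f' = f :=
  Quotient.exists_rep f

instance : Category.{u + 1} S.Obj where
  id_comp f := by obtain ⟨f, rfl⟩ := cls_surjective f; exact cls_eq (.id_comp f)
  comp_id f := by obtain ⟨f, rfl⟩ := cls_surjective f; exact cls_eq (.comp_id f)
  assoc f g h := by
    obtain ⟨f, rfl⟩ := cls_surjective f
    obtain ⟨g, rfl⟩ := cls_surjective g
    obtain ⟨h, rfl⟩ := cls_surjective h
    exact cls_eq (.assoc f g h)

variable {X Y : S.Obj}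

instance : Add (X ⟶ Y) :=
  ⟨Quotient.map₂ (sa := S.setoid _ _) (sb := S.setoid _ _) (sc := S.setoid _ _)
    Word.add (fun _ _ h _ _ h' => Eqv.add h h')⟩

instance : SMul k (X ⟶ Y) :=
  ⟨fun c => Quotient.map (sa := S.setoid _ _) (sb := S.setoid _ _)
    (Word.smul c) (fun _ _ h => Eqv.smul c h)⟩

instance : Zero (X ⟶ Y) := ⟨cls (.of 0)⟩

instance : Neg (X ⟶ Y) := ⟨fun f => (-1 : k) • f⟩

lemma hom_zero_smul (f : X ⟶ Y) : (0 : k) • f = 0 := by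
  obtain ⟨f, rfl⟩ := cls_surjective f; exact cls_eq (.zero_smul f)

lemma hom_add_smul (c d : k) (f : X ⟶ Y) : (c + d) • f = c • f + d • f := by
  obtain ⟨f, rfl⟩ := cls_surjective f; exact cls_eq (.add_smul c d f)

lemma hom_one_smul (f : X ⟶ Y) : (1 : k) • f = f := by
  obtain ⟨f, rfl⟩ := cls_surjective f; exact cls_eq (.one_smul f)

lemma hom_add_comm (f g : X ⟶ Y) : f + g = g + f := by
  obtain ⟨f, rfl⟩ := cls_surjective f
  obtain ⟨g, rfl⟩ := cls_surjective g
  exact cls_eq (.add_comm f g)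

lemma hom_zero_add (f : X ⟶ Y) : 0 + f = f := by
  obtain ⟨f, rfl⟩ := cls_surjective f; exact cls_eq (.zero_add f)

instance : AddCommGroup (X ⟶ Y) where
  add_assoc f g h := by
    obtain ⟨f, rfl⟩ := cls_surjective f
    obtain ⟨g, rfl⟩ := cls_surjective g
    obtain ⟨h, rfl⟩ := cls_surjective h
    exact cls_eq (.add_assoc f g h)
  zero_add := hom_zero_add
  add_zero f := (hom_add_comm _ _).trans (hom_zero_add f)
  neg_add_cancel f := by
    -- Negation is scalar multiplication by `-1`, so words need no separate constructor for it.
    calc (-1 : k) • f + f = (-1 : k) • f + (1 : k) • f := by rw [hom_one_smul]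
      _ = 0 := by rw [← hom_add_smul, neg_add_cancel, hom_zero_smul]
  add_comm := hom_add_comm
  nsmul := nsmulRec
  zsmul := zsmulRec

lemma hom_smul_add (c : k) (f g : X ⟶ Y) : c • (f + g) = c • f + c • g := by
  obtain ⟨f, rfl⟩ := cls_surjective f
  obtain ⟨g, rfl⟩ := cls_surjective g
  exact cls_eq (.smul_add c f g)

instance : Module k (X ⟶ Y) where
  one_smul := hom_one_smul
  mul_smul c d f := by
    obtain ⟨f, rfl⟩ := cls_surjective f; exact cls_eq (.mul_smul c d f)
  smul_zero c := by
    -- No relation is imposed for `c • 0`; additivity gives `c • 0 = c • 0 + c • 0`, which forces it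
    -- to vanish.
    have := hom_smul_add c (0 : X ⟶ Y) 0
    rwa [zero_add, left_eq_add] at this
  smul_add := hom_smul_add
  add_smul := hom_add_smul
  zero_smul := hom_zero_smul

instance : Preadditive S.Obj where
  add_comp X Y Z f f' g := by
    obtain ⟨f, rfl⟩ := cls_surjective f
    obtain ⟨f', rfl⟩ := cls_surjective f'
    obtain ⟨g, rfl⟩ := cls_surjective g
    exact cls_eq (.add_comp f f' g)
  comp_add X Y Z f g g' := by
    obtain ⟨f, rfl⟩ := cls_surjective f
    obtain ⟨g', rfl⟩ := cls_surjective g'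
    obtain ⟨g, rfl⟩ := cls_surjective g
    exact cls_eq (.comp_add f g g')

instance : Linear k S.Obj where
  smul_comp X Y Z c f g := by
    obtain ⟨f, rfl⟩ := cls_surjective f
    obtain ⟨g, rfl⟩ := cls_surjective g
    exact cls_eq (.smul_comp c f g)
  comp_smul X Y Z f c g := by
    obtain ⟨f, rfl⟩ := cls_surjective f
    obtain ⟨g, rfl⟩ := cls_surjective g
    exact cls_eq (.comp_smul c f g)

variable (S)

/-- The `k`-linear category obtained from `C` by adding the generators and the relations. -/
def cat : LinCat k := ⟨S.Obj⟩

/-- The canonical functor, which is the identity on objects. -/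
def incl : C ⟶ S.cat :=
  { functor :=
      { obj := fun X => (⟨X⟩ : S.Obj)
        map := fun f => cls (.of f)
        map_id := fun X => rfl
        map_comp := fun f g => cls_eq (.of_comp f g) }
    additive := ⟨fun {_ _ f g} => cls_eq (.of_add f g)⟩
    linear := ⟨fun {_ _} f c => cls_eq (.of_smul c f)⟩ }

/-- The canonical functor, as a functor. -/
abbrev Q : C.carrier ⥤ S.cat.carrier := LinCat.Hom.functor S.incl

/-- The additional morphisms. -/
def arr {X Y : C.carrier} (g : S.gen X Y) : S.Q.obj X ⟶ S.Q.obj Y := cls (.gen g)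

instance : S.Q.Additive := LinCat.Hom.additive S.incl
instance : S.Q.Linear k := LinCat.Hom.linear S.incl

/-- Morphisms are classes of words, so this is structural induction on a representing word. -/
lemma induction {motive : ∀ {X Y : C.carrier}, (S.Q.obj X ⟶ S.Q.obj Y) → Prop}
    (of : ∀ {X Y : C.carrier} (f : X ⟶ Y), motive (S.Q.map f))
    (arr : ∀ {X Y : C.carrier} (g : S.gen X Y), motive (S.arr g))
    (comp : ∀ {X Y Z : C.carrier} (f : S.Q.obj X ⟶ S.Q.obj Y) (g : S.Q.obj Y ⟶ S.Q.obj Z),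
      motive f → motive g → motive (f ≫ g))
    (add : ∀ {X Y : C.carrier} (f g : S.Q.obj X ⟶ S.Q.obj Y),
      motive f → motive g → motive (f + g))
    (smul : ∀ {X Y : C.carrier} (c : k) (f : S.Q.obj X ⟶ S.Q.obj Y),
      motive f → motive (c • f))
    {X Y : C.carrier} (f : S.Q.obj X ⟶ S.Q.obj Y) : motive f := by
  have key : ∀ {X Y : C.carrier} (f : Word S.gen X Y), motive (cls f) := by
    intro X Y f
    induction f with
    | of f => exact of f
    | gen g => exact arr g
    | comp f g hf hg => exact comp _ _ hf hg
    | add f g hf hg => exact add _ _ hf hg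
    | smul c f hf => exact smul c _ hf
  obtain ⟨f, rfl⟩ := cls_surjective f
  exact key f

section Desc

variable {S} {D : LinCat k} (H : C ⟶ D)
  (φ : ∀ {X Y : C.carrier}, S.gen X Y → ((LinCat.Hom.functor H).obj X ⟶ (LinCat.Hom.functor H).obj Y))

/-- The value of a word. -/
def eval {X Y : C.carrier} :
    Word S.gen X Y → ((LinCat.Hom.functor H).obj X ⟶ (LinCat.Hom.functor H).obj Y)
  | .of f => (LinCat.Hom.functor H).map f
  | .gen g => φ g
  | .comp f g => eval f ≫ eval g
  | .add f g => eval f + eval g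
  | .smul c f => c • eval f

variable (hφ : ∀ {X Y : C.carrier} (f g : Word S.gen X Y), S.rel f g → eval H φ f = eval H φ g)

include hφ in
-- Besides the imposed relations, the congruence contains only the axioms of a linear category and
-- of a linear functor, and these hold in the target.
lemma eval_eq {X Y : C.carrier} {f g : Word S.gen X Y} (h : S.Eqv f g) :
    eval H φ f = eval H φ g := by
  induction h with
  | rel h => exact hφ _ _ h
  | refl => rfl
  | symm _ h => exact h.symm
  | trans _ _ h h' => exact h.trans h'
  | comp _ _ h h' => simp only [eval, h, h']
  | add _ _ h h' => simp only [eval, h, h']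
  | smul _ _ h => simp only [eval, h]
  | add_comm => simp only [eval, add_comm]
  | mul_smul => simp only [eval, mul_smul]
  | add_smul => simp only [eval, add_smul]
  | add_assoc => simp only [eval, add_assoc]
  | _ => simp [eval]

/-- The functor induced by a functor and by the images of the generators. -/
def desc : S.cat ⟶ D :=
  { functor :=
      { obj := fun X => (LinCat.Hom.functor H).obj X.as
        map := fun {X Y} f => Quotient.lift (s := S.setoid X.as Y.as) (eval H φ)
          (fun _ _ h => eval_eq H φ hφ h) f
        map_id := fun X => (LinCat.Hom.functor H).map_id _
        map_comp := fun f g => by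
          obtain ⟨f, rfl⟩ := cls_surjective f
          obtain ⟨g, rfl⟩ := cls_surjective g
          rfl }
    additive := ⟨fun {_ _ f g} => by
      obtain ⟨f, rfl⟩ := cls_surjective f
      obtain ⟨g, rfl⟩ := cls_surjective g
      rfl⟩
    linear := ⟨fun {_ _} f c => by
      obtain ⟨f, rfl⟩ := cls_surjective f
      rfl⟩ }

end Desc

/-- Naturality of a family of morphisms only has to be checked on the morphisms of `C` and
on the generators. -/
lemma naturality_of_gen {D : LinCat k} {U V : S.cat ⟶ D}
    (η : ∀ X : C.carrier, (LinCat.Hom.functor U).obj (S.Q.obj X) ⟶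
      (LinCat.Hom.functor V).obj (S.Q.obj X))
    (of : ∀ {X Y : C.carrier} (f : X ⟶ Y), (LinCat.Hom.functor U).map (S.Q.map f) ≫ η Y =
      η X ≫ (LinCat.Hom.functor V).map (S.Q.map f))
    (arr : ∀ {X Y : C.carrier} (g : S.gen X Y), (LinCat.Hom.functor U).map (S.arr g) ≫ η Y =
      η X ≫ (LinCat.Hom.functor V).map (S.arr g)) {X Y : C.carrier} (f : S.Q.obj X ⟶ S.Q.obj Y) :
    (LinCat.Hom.functor U).map f ≫ η Y = η X ≫ (LinCat.Hom.functor V).map f := by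
  refine S.induction (motive := fun {X Y} f => (LinCat.Hom.functor U).map f ≫ η Y =
    η X ≫ (LinCat.Hom.functor V).map f) of arr ?_ ?_ ?_ f
  · intro X Y Z f g hf hg
    rw [Functor.map_comp, Functor.map_comp, Category.assoc, hg, reassoc_of% hf]
  · intro X Y f g hf hg
    rw [Functor.map_add, Functor.map_add, Preadditive.add_comp, Preadditive.comp_add, hf, hg]
  · intro X Y c f hf
    rw [Functor.map_smul, Functor.map_smul, Linear.smul_comp, Linear.comp_smul, hf]

/-- A natural transformation from its components. -/
def natTrans {D : LinCat k} {U V : S.cat ⟶ D}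
    (η : ∀ X : C.carrier, (LinCat.Hom.functor U).obj (S.Q.obj X) ⟶
      (LinCat.Hom.functor V).obj (S.Q.obj X))
    (of : ∀ {X Y : C.carrier} (f : X ⟶ Y), (LinCat.Hom.functor U).map (S.Q.map f) ≫ η Y =
      η X ≫ (LinCat.Hom.functor V).map (S.Q.map f))
    (arr : ∀ {X Y : C.carrier} (g : S.gen X Y), (LinCat.Hom.functor U).map (S.arr g) ≫ η Y =
      η X ≫ (LinCat.Hom.functor V).map (S.arr g)) : U ⟶ V :=
  ⟨{ app := fun X => η X.as
     naturality := fun _ _ f => S.naturality_of_gen η of arr f }⟩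

/-- A natural isomorphism from its components. -/
def natIso {D : LinCat k} {U V : S.cat ⟶ D}
    (η : ∀ X : C.carrier, (LinCat.Hom.functor U).obj (S.Q.obj X) ≅
      (LinCat.Hom.functor V).obj (S.Q.obj X))
    (of : ∀ {X Y : C.carrier} (f : X ⟶ Y), (LinCat.Hom.functor U).map (S.Q.map f) ≫ (η Y).hom =
      (η X).hom ≫ (LinCat.Hom.functor V).map (S.Q.map f))
    (arr : ∀ {X Y : C.carrier} (g : S.gen X Y), (LinCat.Hom.functor U).map (S.arr g) ≫ (η Y).hom =
      (η X).hom ≫ (LinCat.Hom.functor V).map (S.arr g)) : U ≅ V :=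
  LinCat.isoMk (NatIso.ofComponents (fun X => η X.as)
    (fun f => S.naturality_of_gen (fun X => (η X).hom) of arr f))

end LinCat.Presentation

end Presentations

/-! ### Birepresentations by generators and relations -/

section RepPresentations

variable {k : Type u} [Field k] {n : ℕ}

/-- The components of an isomorphism of `k`-linear functors. -/
def LinCat.appIso {C D : LinCat k} {F G : C ⟶ D} (e : F ≅ G) (X : C.carrier) :
    (LinCat.Hom.functor F).obj X ≅ (LinCat.Hom.functor G).obj X where
  hom := (LinCat.Hom₂.nat e.hom).app X
  inv := (LinCat.Hom₂.nat e.inv).app X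
  hom_inv_id := congrArg (fun t => (LinCat.Hom₂.nat t).app X) e.hom_inv_id
  inv_hom_id := congrArg (fun t => (LinCat.Hom₂.nat t).app X) e.inv_hom_id

namespace LinRep

section Components

variable {M N L T : LinRep k n}

/-- The functor underlying a strong transformation. -/
def ap (Φ : M ⟶ N) (i : StarB k n) :
    (M.toPseudofunctor.obj i).carrier ⥤ (N.toPseudofunctor.obj i).carrier :=
  LinCat.Hom.functor (Pseudofunctor.StrongTrans.app Φ i)

instance (Φ : M ⟶ N) (i : StarB k n) : (ap Φ i).Additive :=
  LinCat.Hom.additive (Pseudofunctor.StrongTrans.app Φ i)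
instance (Φ : M ⟶ N) (i : StarB k n) : (ap Φ i).Linear k :=
  LinCat.Hom.linear (Pseudofunctor.StrongTrans.app Φ i)
instance {i j : StarB k n} (F : i ⟶ j) : (M.act F).Additive :=
  LinCat.Hom.additive (M.toPseudofunctor.map F)
instance {i j : StarB k n} (F : i ⟶ j) : (M.act F).Linear k :=
  LinCat.Hom.linear (M.toPseudofunctor.map F)

/-- The compatibility of a strong transformation with the actions. -/
def nat (Φ : M ⟶ N) {i j : StarB k n} (F : i ⟶ j) (X : (M.toPseudofunctor.obj i).carrier) :
    (ap Φ j).obj ((M.act F).obj X) ≅ (N.act F).obj ((ap Φ i).obj X) :=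
  LinCat.appIso (Pseudofunctor.StrongTrans.naturality Φ F) X

lemma nat_naturality (Φ : M ⟶ N) {i j : StarB k n} (F : i ⟶ j)
    {X Y : (M.toPseudofunctor.obj i).carrier} (f : X ⟶ Y) :
    (ap Φ j).map ((M.act F).map f) ≫ (nat Φ F Y).hom =
      (nat Φ F X).hom ≫ (N.act F).map ((ap Φ i).map f) :=
  (LinCat.Hom₂.nat (Pseudofunctor.StrongTrans.naturality Φ F).hom).naturality f

/-- The components of the action of a `2`-morphism. -/
def map₂ (M : LinRep k n) {i j : StarB k n} {F G : i ⟶ j} (α : F ⟶ G)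
    (X : (M.toPseudofunctor.obj i).carrier) : (M.act F).obj X ⟶ (M.act G).obj X :=
  (LinCat.Hom₂.nat (M.toPseudofunctor.map₂ α)).app X

/-- The unit constraint of the action. -/
def unit (M : LinRep k n) (i : StarB k n) (X : (M.toPseudofunctor.obj i).carrier) :
    (M.act (𝟙 i)).obj X ≅ X :=
  LinCat.appIso (M.toPseudofunctor.mapId i) X

/-- The multiplication constraint of the action. -/
def mult (M : LinRep k n) {i j l : StarB k n} (F : i ⟶ j) (G : j ⟶ l)
    (X : (M.toPseudofunctor.obj i).carrier) :
    (M.act (F ≫ G)).obj X ≅ (M.act G).obj ((M.act F).obj X) :=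
  LinCat.appIso (M.toPseudofunctor.mapComp F G) X

lemma nat_map₂ (Φ : M ⟶ N) {i j : StarB k n} {F G : i ⟶ j} (α : F ⟶ G)
    (X : (M.toPseudofunctor.obj i).carrier) :
    (ap Φ j).map (M.map₂ α X) ≫ (nat Φ G X).hom =
      (nat Φ F X).hom ≫ N.map₂ α ((ap Φ i).obj X) :=
  congrArg (fun t => (LinCat.Hom₂.nat t).app X)
    (Pseudofunctor.StrongTrans.naturality_naturality Φ α)

lemma nat_unit (Φ : M ⟶ N) {i : StarB k n} (X : (M.toPseudofunctor.obj i).carrier) :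
    (nat Φ (𝟙 i) X).hom ≫ (N.unit i ((ap Φ i).obj X)).hom = (ap Φ i).map (M.unit i X).hom := by
  refine (congrArg (fun t => (LinCat.Hom₂.nat t).app X)
    (Pseudofunctor.StrongTrans.naturality_id Φ i)).trans ?_
  -- The remaining factors are components of unitors of `LinCat k`, which are identities. Unitors
  -- and associators disappear in this way throughout.
  exact (congrArg (_ ≫ ·) (Category.comp_id _)).trans (Category.comp_id _)

lemma nat_mult (Φ : M ⟶ N) {i j l : StarB k n} (F : i ⟶ j) (G : j ⟶ l)
    (X : (M.toPseudofunctor.obj i).carrier) :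
    (nat Φ (F ≫ G) X).hom ≫ (N.mult F G ((ap Φ i).obj X)).hom =
      (ap Φ l).map (M.mult F G X).hom ≫ (nat Φ G ((M.act F).obj X)).hom ≫
        (N.act G).map (nat Φ F X).hom := by
  refine (congrArg (fun t => (LinCat.Hom₂.nat t).app X)
    (Pseudofunctor.StrongTrans.naturality_comp Φ F G)).trans ?_
  refine congrArg (_ ≫ ·) ((Category.id_comp _).trans (congrArg (_ ≫ ·) ?_))
  exact (Category.id_comp _).trans (Category.comp_id _)

/-- A strong transformation from its components. -/
def mkTrans (H : ∀ i, M.toPseudofunctor.obj i ⟶ N.toPseudofunctor.obj i)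
    (ν : ∀ {i j : StarB k n} (F : i ⟶ j),
      M.toPseudofunctor.map F ≫ H j ≅ H i ≫ N.toPseudofunctor.map F)
    (h₂ : ∀ {i j : StarB k n} {F G : i ⟶ j} (α : F ⟶ G) (X : (M.toPseudofunctor.obj i).carrier),
      (LinCat.Hom.functor (H j)).map (M.map₂ α X) ≫ (LinCat.appIso (ν G) X).hom =
        (LinCat.appIso (ν F) X).hom ≫ N.map₂ α ((LinCat.Hom.functor (H i)).obj X))
    (h_id : ∀ {i : StarB k n} (X : (M.toPseudofunctor.obj i).carrier),
      (LinCat.appIso (ν (𝟙 i)) X).hom ≫ (N.unit i ((LinCat.Hom.functor (H i)).obj X)).hom =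
        (LinCat.Hom.functor (H i)).map (M.unit i X).hom)
    (h_comp : ∀ {i j l : StarB k n} (F : i ⟶ j) (G : j ⟶ l)
      (X : (M.toPseudofunctor.obj i).carrier),
      (LinCat.appIso (ν (F ≫ G)) X).hom ≫
          (N.mult F G ((LinCat.Hom.functor (H i)).obj X)).hom =
        (LinCat.Hom.functor (H l)).map (M.mult F G X).hom ≫
          (LinCat.appIso (ν G) ((M.act F).obj X)).hom ≫
            (N.act G).map (LinCat.appIso (ν F) X).hom) : M ⟶ N :=
  { app := H
    naturality := ν
    naturality_naturality := fun α => LinCat.ext' fun X => h₂ α X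
    naturality_id := fun i => LinCat.ext' fun X => (h_id X).trans
      ((congrArg (_ ≫ ·) (Category.comp_id _)).trans (Category.comp_id _)).symm
    naturality_comp := fun F G => LinCat.ext' fun X => (h_comp F G X).trans
      (congrArg (_ ≫ ·) ((Category.id_comp _).trans (congrArg (_ ≫ ·)
        ((Category.id_comp _).trans (Category.comp_id _))))).symm }

variable {Φ Ψ Ξ : M ⟶ N}

/-- The components of a modification. -/
def cpt (m : Φ ⟶ Ψ) (i : StarB k n) (X : (M.toPseudofunctor.obj i).carrier) :
    (ap Φ i).obj X ⟶ (ap Ψ i).obj X :=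
  (LinCat.Hom₂.nat (m.as.app i)).app X

lemma hom_ext₂ {m m' : Φ ⟶ Ψ} (h : ∀ i X, cpt m i X = cpt m' i X) : m = m' :=
  Pseudofunctor.StrongTrans.homCategory.ext fun i => LinCat.ext' fun X => h i X

lemma cpt_naturality (m : Φ ⟶ Ψ) {i : StarB k n} {X Y : (M.toPseudofunctor.obj i).carrier}
    (f : X ⟶ Y) : (ap Φ i).map f ≫ cpt m i Y = cpt m i X ≫ (ap Ψ i).map f :=
  (LinCat.Hom₂.nat (m.as.app i)).naturality f

lemma cpt_nat (m : Φ ⟶ Ψ) {i j : StarB k n} (F : i ⟶ j)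
    (X : (M.toPseudofunctor.obj i).carrier) :
    cpt m j ((M.act F).obj X) ≫ (nat Ψ F X).hom =
      (nat Φ F X).hom ≫ (N.act F).map (cpt m i X) :=
  congrArg (fun t => (LinCat.Hom₂.nat t).app X) (m.as.naturality F)

/-- A modification from its components. -/
def mkHom (η : ∀ i, Pseudofunctor.StrongTrans.app Φ i ⟶ Pseudofunctor.StrongTrans.app Ψ i)
    (h : ∀ {i j : StarB k n} (F : i ⟶ j) (X : (M.toPseudofunctor.obj i).carrier),
      (LinCat.Hom₂.nat (η j)).app ((M.act F).obj X) ≫ (nat Ψ F X).hom =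
        (nat Φ F X).hom ≫ (N.act F).map ((LinCat.Hom₂.nat (η i)).app X)) : Φ ⟶ Ψ :=
  ⟨{ app := η
     naturality := fun F => LinCat.ext' fun X => h F X }⟩

@[simp] lemma cpt_comp (m : Φ ⟶ Ψ) (m' : Ψ ⟶ Ξ) (i : StarB k n)
    (X : (M.toPseudofunctor.obj i).carrier) : cpt (m ≫ m') i X = cpt m i X ≫ cpt m' i X := rfl
@[simp] lemma cpt_id (i : StarB k n) (X : (M.toPseudofunctor.obj i).carrier) :
    cpt (𝟙 Φ) i X = 𝟙 _ := rfl
/-- The components of an invertible modification. -/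
def cptIso (e : Φ ≅ Ψ) (i : StarB k n) (X : (M.toPseudofunctor.obj i).carrier) :
    (ap Φ i).obj X ≅ (ap Ψ i).obj X where
  hom := cpt e.hom i X
  inv := cpt e.inv i X
  hom_inv_id := by rw [← cpt_comp, e.hom_inv_id, cpt_id]
  inv_hom_id := by rw [← cpt_comp, e.inv_hom_id, cpt_id]

lemma nat_comp (Φ : M ⟶ N) (Ψ : N ⟶ L) {i j : StarB k n} (F : i ⟶ j)
    (X : (M.toPseudofunctor.obj i).carrier) :
    (nat (Φ ≫ Ψ) F X).hom = (ap Ψ j).map (nat Φ F X).hom ≫ (nat Ψ F ((ap Φ i).obj X)).hom := by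
  refine (Category.id_comp _).trans (congrArg (_ ≫ ·) ?_)
  exact (Category.id_comp _).trans (Category.comp_id _)

end Components

end LinRep

/-- Generators and relations to be added to a birepresentation, with an action on the generators
that respects the relations and is natural. -/
structure LinRep.Presentation (c : LinRep k n) where
  pres : ∀ i : StarB k n, (c.toPseudofunctor.obj i).Presentation
  act : ∀ {i j : StarB k n} (F : i ⟶ j) {X Y : (c.toPseudofunctor.obj i).carrier},
    (pres i).gen X Y →
      ((pres j).Q.obj ((c.act F).obj X) ⟶ (pres j).Q.obj ((c.act F).obj Y))
  act_rel : ∀ {i j : StarB k n} (F : i ⟶ j) {X Y : (c.toPseudofunctor.obj i).carrier}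
    (f g : Word (pres i).gen X Y), (pres i).rel f g →
      LinCat.Presentation.eval (c.toPseudofunctor.map F ≫ (pres j).incl) (act F) f =
        LinCat.Presentation.eval (c.toPseudofunctor.map F ≫ (pres j).incl) (act F) g
  act_map₂ : ∀ {i j : StarB k n} {F G : i ⟶ j} (α : F ⟶ G)
    {X Y : (c.toPseudofunctor.obj i).carrier} (g : (pres i).gen X Y),
      act F g ≫ (pres j).Q.map ((LinCat.Hom₂.nat (c.toPseudofunctor.map₂ α)).app Y) =
        (pres j).Q.map ((LinCat.Hom₂.nat (c.toPseudofunctor.map₂ α)).app X) ≫ act G g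
  act_id : ∀ {i : StarB k n} {X Y : (c.toPseudofunctor.obj i).carrier} (g : (pres i).gen X Y),
      act (𝟙 i) g ≫ (pres i).Q.map ((LinCat.Hom₂.nat (c.toPseudofunctor.mapId i).hom).app Y) =
        (pres i).Q.map ((LinCat.Hom₂.nat (c.toPseudofunctor.mapId i).hom).app X) ≫ (pres i).arr g
  act_comp : ∀ {i j l : StarB k n} (F : i ⟶ j) (G : j ⟶ l)
    {X Y : (c.toPseudofunctor.obj i).carrier} (g : (pres i).gen X Y),
      act (F ≫ G) g ≫
          (pres l).Q.map ((LinCat.Hom₂.nat (c.toPseudofunctor.mapComp F G).hom).app Y) =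
        (pres l).Q.map ((LinCat.Hom₂.nat (c.toPseudofunctor.mapComp F G).hom).app X) ≫
          (LinCat.Hom.functor (LinCat.Presentation.desc
            (c.toPseudofunctor.map G ≫ (pres l).incl) (act G) (act_rel G))).map (act F g)

namespace LinRep.Presentation

variable {c : LinRep k n} (S : c.Presentation)

/-- The action of a `1`-morphism. -/
def map {i j : StarB k n} (F : i ⟶ j) : (S.pres i).cat ⟶ (S.pres j).cat :=
  LinCat.Presentation.desc (c.toPseudofunctor.map F ≫ (S.pres j).incl) (S.act F) (S.act_rel F)

lemma Q_naturality {i j : StarB k n} {F G : (c.toPseudofunctor.obj i) ⟶ (c.toPseudofunctor.obj j)}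
    (α : F ⟶ G) {X Y : (c.toPseudofunctor.obj i).carrier} (f : X ⟶ Y) :
    (S.pres j).Q.map ((LinCat.Hom.functor F).map f) ≫
        (S.pres j).Q.map ((LinCat.Hom₂.nat α).app Y) =
      (S.pres j).Q.map ((LinCat.Hom₂.nat α).app X) ≫
        (S.pres j).Q.map ((LinCat.Hom.functor G).map f) := by
  rw [← Functor.map_comp, ← Functor.map_comp, NatTrans.naturality]

/-- The birepresentation obtained by adding the generators and the relations. -/
def rep : LinRep k n where
  toPseudofunctor :=
    { obj := fun i => (S.pres i).cat
      map := fun F => S.map F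
      map₂ := fun {i j F G} α => (S.pres i).natTrans (U := S.map F) (V := S.map G)
        (fun X => (S.pres j).Q.map ((LinCat.Hom₂.nat (c.toPseudofunctor.map₂ α)).app X))
        (fun f => S.Q_naturality _ f) (fun g => S.act_map₂ α g)
      mapId := fun i => (S.pres i).natIso (U := S.map (𝟙 i)) (V := 𝟙 _)
        (fun X => (S.pres i).Q.mapIso (LinCat.appIso (c.toPseudofunctor.mapId i) X))
        (fun f => S.Q_naturality (c.toPseudofunctor.mapId i).hom f) (fun g => S.act_id g)
      mapComp := fun {i j l} F G => (S.pres i).natIso (U := S.map (F ≫ G)) (V := S.map F ≫ S.map G)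
        (fun X => (S.pres l).Q.mapIso (LinCat.appIso (c.toPseudofunctor.mapComp F G) X))
        (fun f => S.Q_naturality (c.toPseudofunctor.mapComp F G).hom f)
        (fun g => S.act_comp F G g)
      map₂_id := fun {i j} F => LinCat.ext' fun X =>
        (congrArg (fun t => (S.pres j).Q.map ((LinCat.Hom₂.nat t).app X.as))
          (c.toPseudofunctor.map₂_id F)).trans ((S.pres j).Q.map_id _)
      map₂_comp := fun {i j _ _ _} α β => LinCat.ext' fun X =>
        (congrArg (fun t => (S.pres j).Q.map ((LinCat.Hom₂.nat t).app X.as))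
          (c.toPseudofunctor.map₂_comp α β)).trans ((S.pres j).Q.map_comp _ _)
      map₂_whisker_left := fun {i j l} F G H α => LinCat.ext' fun X =>
        (congrArg (fun t => (S.pres l).Q.map ((LinCat.Hom₂.nat t).app X.as))
          (c.toPseudofunctor.map₂_whisker_left F α)).trans (by
            simp only [LinCat.comp_nat_app, Functor.map_comp]; rfl)
      map₂_whisker_right := fun {i j l F G} α H => LinCat.ext' fun X =>
        (congrArg (fun t => (S.pres l).Q.map ((LinCat.Hom₂.nat t).app X.as))
          (c.toPseudofunctor.map₂_whisker_right α H)).trans (by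
            simp only [LinCat.comp_nat_app, Functor.map_comp]; rfl)
      map₂_associator := fun {_ _ _ l} F G H => LinCat.ext' fun X =>
        (congrArg (fun t => (S.pres l).Q.map ((LinCat.Hom₂.nat t).app X.as))
          (c.toPseudofunctor.map₂_associator F G H)).trans (by
            simp only [LinCat.comp_nat_app, Functor.map_comp]
            congr 3)
      map₂_left_unitor := fun {_ j} F => LinCat.ext' fun X =>
        (congrArg (fun t => (S.pres j).Q.map ((LinCat.Hom₂.nat t).app X.as))
          (c.toPseudofunctor.map₂_left_unitor F)).trans (by
            simp only [LinCat.comp_nat_app, Functor.map_comp]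
            congr 2)
      map₂_right_unitor := fun {_ j} F => LinCat.ext' fun X =>
        (congrArg (fun t => (S.pres j).Q.map ((LinCat.Hom₂.nat t).app X.as))
          (c.toPseudofunctor.map₂_right_unitor F)).trans (by
            simp only [LinCat.comp_nat_app, Functor.map_comp]
            congr 2) }
  map₂_add {i j _ _} α β X :=
    (congrArg (S.pres j).Q.map (c.map₂_add α β X.as)).trans ((S.pres j).Q.map_add)
  map₂_smul {i j _ _} r α X :=
    (congrArg (S.pres j).Q.map (c.map₂_smul r α X.as)).trans ((S.pres j).Q.map_smul _ _)

/-- The canonical transformation, which is the identity on objects. -/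
def toRep : c ⟶ S.rep :=
  LinRep.mkTrans (fun i => (S.pres i).incl)
    (fun {i j} F => LinCat.isoMk (NatIso.ofComponents (fun X => Iso.refl _)
      (fun f => (Category.comp_id _).trans (Category.id_comp _).symm)))
    (fun α X => (Category.comp_id _).trans (Category.id_comp _).symm)
    (fun X => Category.id_comp _)
    (fun {i j l} F G X => (Category.id_comp _).trans
      ((congrArg ((S.pres l).Q.map (c.mult F G X).hom ≫ ·) ((Category.id_comp _).trans
        ((S.rep.act G).map_id _))).trans (Category.comp_id _)).symm)

/-- The structure isomorphisms of `S.toRep` are identities. -/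
lemma nat_toRep_comp {d : LinRep k n} (U : S.rep ⟶ d) {i j : StarB k n} (F : i ⟶ j)
    (X : (c.toPseudofunctor.obj i).carrier) :
    (LinRep.nat (S.toRep ≫ U) F X).hom = (LinRep.nat U F ((S.pres i).Q.obj X)).hom :=
  (LinRep.nat_comp S.toRep U F X).trans
    ((congrArg (· ≫ _) ((LinRep.ap U j).map_id _)).trans (Category.id_comp _))

variable {S} in
/-- The transformation induced by a transformation and by the images of the generators. -/
def desc {d : LinRep k n} (H : c ⟶ d)
    (φ : ∀ (i : StarB k n) {X Y : (c.toPseudofunctor.obj i).carrier}, (S.pres i).gen X Y →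
      ((LinRep.ap H i).obj X ⟶ (LinRep.ap H i).obj Y))
    (hφ : ∀ (i : StarB k n) {X Y : (c.toPseudofunctor.obj i).carrier}
      (f g : Word (S.pres i).gen X Y), (S.pres i).rel f g →
      LinCat.Presentation.eval (Pseudofunctor.StrongTrans.app H i) (φ i) f =
        LinCat.Presentation.eval (Pseudofunctor.StrongTrans.app H i) (φ i) g)
    (h : ∀ {i j : StarB k n} (F : i ⟶ j) {X Y : (c.toPseudofunctor.obj i).carrier}
      (g : (S.pres i).gen X Y),
      (LinCat.Hom.functor (LinCat.Presentation.desc (Pseudofunctor.StrongTrans.app H j)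
          (φ j) (hφ j))).map (S.act F g) ≫ (LinRep.nat H F Y).hom =
        (LinRep.nat H F X).hom ≫ (d.act F).map (φ i g)) : S.rep ⟶ d :=
  LinRep.mkTrans
    (fun i => LinCat.Presentation.desc (Pseudofunctor.StrongTrans.app H i) (φ i) (hφ i))
    (fun {i j} F => (S.pres i).natIso
      (U := S.map F ≫ LinCat.Presentation.desc (Pseudofunctor.StrongTrans.app H j) (φ j) (hφ j))
      (V := LinCat.Presentation.desc (Pseudofunctor.StrongTrans.app H i) (φ i) (hφ i) ≫
        d.toPseudofunctor.map F)
      (fun X => LinRep.nat H F X) (fun f => LinRep.nat_naturality H F f) (fun g => h F g))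
    (fun α X => LinRep.nat_map₂ H α X.as)
    (fun X => LinRep.nat_unit H X.as)
    (fun F G X => LinRep.nat_mult H F G X.as)

/-- The comparison of a transformation with the one that it induces. -/
def descIso {d : LinRep k n} (H : c ⟶ d)
    (φ : ∀ (i : StarB k n) {X Y : (c.toPseudofunctor.obj i).carrier}, (S.pres i).gen X Y →
      ((LinRep.ap H i).obj X ⟶ (LinRep.ap H i).obj Y)) (hφ) (h) :
    H ≅ S.toRep ≫ desc H φ hφ h where
  hom := LinRep.mkHom (fun i => 𝟙 (Pseudofunctor.StrongTrans.app H i)) (fun F X => by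
    rw [nat_toRep_comp]
    exact (Category.id_comp _).trans
      ((congrArg (_ ≫ ·) ((d.act F).map_id _)).trans (Category.comp_id _)).symm)
  inv := LinRep.mkHom (fun i => 𝟙 (Pseudofunctor.StrongTrans.app H i)) (fun F X => by
    rw [nat_toRep_comp]
    exact (Category.id_comp _).trans
      ((congrArg (_ ≫ ·) ((d.act F).map_id _)).trans (Category.comp_id _)).symm)
  hom_inv_id := LinRep.hom_ext₂ fun i X => Category.id_comp _
  inv_hom_id := LinRep.hom_ext₂ fun i X => Category.id_comp _

/-- Since `S.toRep` is the identity on objects, the components of `η` already are the components of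
`θ`. Only naturality with respect to the new arrows has to be assumed; compatibility with the action
is inherited from `η`. -/
lemma existsUnique_hom {d : LinRep k n} (U V : S.rep ⟶ d) (η : S.toRep ≫ U ⟶ S.toRep ≫ V)
    (h : ∀ (i : StarB k n) {X Y : (c.toPseudofunctor.obj i).carrier} (g : (S.pres i).gen X Y),
      (LinRep.ap U i).map ((S.pres i).arr g) ≫ LinRep.cpt η i Y =
        LinRep.cpt η i X ≫ (LinRep.ap V i).map ((S.pres i).arr g)) :
    ∃! θ : U ⟶ V, S.toRep ◁ θ = η := by
  refine ⟨LinRep.mkHom (fun i => (S.pres i).natTrans (fun X => LinRep.cpt η i X)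
    (fun f => LinRep.cpt_naturality η f) (fun g => h i g)) (fun {i j} F X => ?_),
    LinRep.hom_ext₂ fun i X => rfl, fun θ hθ => LinRep.hom_ext₂ fun i X => ?_⟩
  · have := LinRep.cpt_nat η F X.as
    rw [nat_toRep_comp, nat_toRep_comp] at this
    exact this
  · exact congrArg (fun t => LinRep.cpt t i X.as) hθ

end LinRep.Presentation

end RepPresentations

/-! ### Construction of coisoinserters -/

section Coisoinserter

variable {k : Type u} [Field k] {n : ℕ}

/-- This transfers every identity proved for the forward generators to the backward ones. -/
lemma iso_square_inv {𝒞 : Type*} [Category 𝒞] {X Y X' Y' : 𝒞} (e : X ≅ Y) (e' : X' ≅ Y')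
    {a : X ⟶ X'} {b : Y ⟶ Y'} (h : e.hom ≫ b = a ≫ e'.hom) : e.inv ≫ a = b ≫ e'.inv := by
  rw [Iso.inv_comp_eq, ← Category.assoc, h, Category.assoc, e'.hom_inv_id, Category.comp_id]

namespace LinRep

/-- An invertible modification from its components. -/
def mkIso {M N : LinRep k n} {Φ Ψ : M ⟶ N}
    (η : ∀ i, Pseudofunctor.StrongTrans.app Φ i ≅ Pseudofunctor.StrongTrans.app Ψ i)
    (h : ∀ {i j : StarB k n} (F : i ⟶ j) (X : (M.toPseudofunctor.obj i).carrier),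
      (LinCat.Hom₂.nat (η j).hom).app ((M.act F).obj X) ≫ (nat Ψ F X).hom =
        (nat Φ F X).hom ≫ (N.act F).map ((LinCat.Hom₂.nat (η i).hom).app X)) : Φ ≅ Ψ :=
  Pseudofunctor.StrongTrans.isoMk η (fun F => LinCat.ext' fun X => h F X)

variable {p c : LinRep k n} {ι : Type} (F G : ι → (p ⟶ c))

/-- Formal isomorphisms between the values of `F z` and `G z`. -/
inductive IsoGen (i : StarB k n) : (c.toPseudofunctor.obj i).carrier →
    (c.toPseudofunctor.obj i).carrier → Type (u + 1)
  | fwd (z : ι) (X : (p.toPseudofunctor.obj i).carrier) :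
      IsoGen i ((ap (F z) i).obj X) ((ap (G z) i).obj X)
  | bwd (z : ι) (X : (p.toPseudofunctor.obj i).carrier) :
      IsoGen i ((ap (G z) i).obj X) ((ap (F z) i).obj X)

/-- The relations that make `IsoGen` a family of natural isomorphisms. -/
inductive IsoRel (i : StarB k n) : ∀ {X Y : (c.toPseudofunctor.obj i).carrier},
    Word (IsoGen F G i) X Y → Word (IsoGen F G i) X Y → Prop
  | fwd_bwd (z : ι) (X : (p.toPseudofunctor.obj i).carrier) :
      IsoRel i (.comp (.gen (.fwd z X)) (.gen (.bwd z X))) (.of (𝟙 _))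
  | bwd_fwd (z : ι) (X : (p.toPseudofunctor.obj i).carrier) :
      IsoRel i (.comp (.gen (.bwd z X)) (.gen (.fwd z X))) (.of (𝟙 _))
  | nat (z : ι) {X Y : (p.toPseudofunctor.obj i).carrier} (f : X ⟶ Y) :
      IsoRel i (.comp (.of ((ap (F z) i).map f)) (.gen (.fwd z Y)))
        (.comp (.gen (.fwd z X)) (.of ((ap (G z) i).map f)))

/-- The presentation of the coisoinserter at an object. -/
def isoPres (i : StarB k n) : (c.toPseudofunctor.obj i).Presentation where
  gen := IsoGen F G i
  rel := IsoRel F G i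

/-- The universal isomorphisms. -/
def univIso (i : StarB k n) (z : ι) (X : (p.toPseudofunctor.obj i).carrier) :
    (isoPres F G i).Q.obj ((ap (F z) i).obj X) ≅ (isoPres F G i).Q.obj ((ap (G z) i).obj X) where
  hom := (isoPres F G i).arr (.fwd z X)
  inv := (isoPres F G i).arr (.bwd z X)
  hom_inv_id := LinCat.Presentation.cls_eq (.rel (.fwd_bwd z X))
  inv_hom_id := LinCat.Presentation.cls_eq (.rel (.bwd_fwd z X))

lemma univIso_naturality (i : StarB k n) (z : ι) {X Y : (p.toPseudofunctor.obj i).carrier}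
    (f : X ⟶ Y) :
    (isoPres F G i).Q.map ((ap (F z) i).map f) ≫ (univIso F G i z Y).hom =
      (univIso F G i z X).hom ≫ (isoPres F G i).Q.map ((ap (G z) i).map f) :=
  LinCat.Presentation.cls_eq (.rel (.nat z f))

/-- The action of a `1`-morphism on the universal isomorphisms. -/
def univIsoAct {i j : StarB k n} (B : i ⟶ j) (z : ι) (X : (p.toPseudofunctor.obj i).carrier) :
    (isoPres F G j).Q.obj ((c.act B).obj ((ap (F z) i).obj X)) ≅
      (isoPres F G j).Q.obj ((c.act B).obj ((ap (G z) i).obj X)) :=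
  ((isoPres F G j).Q.mapIso (nat (F z) B X)).symm ≪≫ univIso F G j z ((p.act B).obj X) ≪≫
    (isoPres F G j).Q.mapIso (nat (G z) B X)

lemma univIsoAct_hom {i j : StarB k n} (B : i ⟶ j) (z : ι)
    (X : (p.toPseudofunctor.obj i).carrier) :
    (univIsoAct F G B z X).hom = (isoPres F G j).Q.map (nat (F z) B X).inv ≫
      (univIso F G j z ((p.act B).obj X)).hom ≫ (isoPres F G j).Q.map (nat (G z) B X).hom := rfl

lemma Q_map_nat_univIsoAct {i j : StarB k n} (B : i ⟶ j) (z : ι)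
    (X : (p.toPseudofunctor.obj i).carrier) :
    (isoPres F G j).Q.map (nat (F z) B X).hom ≫ (univIsoAct F G B z X).hom =
      (univIso F G j z ((p.act B).obj X)).hom ≫ (isoPres F G j).Q.map (nat (G z) B X).hom := by
  rw [univIsoAct_hom, ← Functor.map_comp_assoc, Iso.hom_inv_id,
    CategoryTheory.Functor.map_id, Category.id_comp]

/-- The action of a `1`-morphism on the generators. -/
def isoGenAct {i j : StarB k n} (B : i ⟶ j) : ∀ {X Y : (c.toPseudofunctor.obj i).carrier},
    IsoGen F G i X Y →
      ((isoPres F G j).Q.obj ((c.act B).obj X) ⟶ (isoPres F G j).Q.obj ((c.act B).obj Y))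
  | _, _, .fwd z X => (univIsoAct F G B z X).hom
  | _, _, .bwd z X => (univIsoAct F G B z X).inv

/-- The images of the generators are isomorphisms by construction. Their naturality is that of the
universal isomorphisms at the translated objects, conjugated by the naturality squares of `F z` and
`G z`. -/
lemma isoGenAct_rel {i j : StarB k n} (B : i ⟶ j) {X Y : (c.toPseudofunctor.obj i).carrier}
    (f g : Word (IsoGen F G i) X Y) (h : IsoRel F G i f g) :
    LinCat.Presentation.eval (S := isoPres F G i)
        (c.toPseudofunctor.map B ≫ (isoPres F G j).incl) (isoGenAct F G B) f =
      LinCat.Presentation.eval (S := isoPres F G i)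
        (c.toPseudofunctor.map B ≫ (isoPres F G j).incl) (isoGenAct F G B) g := by
  cases h with
  | fwd_bwd z X =>
    exact (univIsoAct F G B z X).hom_inv_id.trans
      (CategoryTheory.Functor.map_id (c.act B ⋙ (isoPres F G j).Q) _).symm
  | bwd_fwd z X =>
    exact (univIsoAct F G B z X).inv_hom_id.trans
      (CategoryTheory.Functor.map_id (c.act B ⋙ (isoPres F G j).Q) _).symm
  | @nat z X Y f =>
    change (isoPres F G j).Q.map ((c.act B).map ((ap (F z) i).map f)) ≫ (univIsoAct F G B z Y).hom =
      (univIsoAct F G B z X).hom ≫ (isoPres F G j).Q.map ((c.act B).map ((ap (G z) i).map f))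
    -- Precomposing with the structure isomorphism of `F z` removes the inverse hidden in
    -- `univIsoAct`, after which both sides only involve universal isomorphisms.
    rw [← cancel_epi ((isoPres F G j).Q.map (LinRep.nat (F z) B X).hom),
      reassoc_of% Q_map_nat_univIsoAct F G B z X, ← Functor.map_comp_assoc, ← Functor.map_comp,
      ← nat_naturality, ← nat_naturality, Functor.map_comp_assoc, Q_map_nat_univIsoAct,
      reassoc_of% (@univIso_naturality), Functor.map_comp]

/-- The coherence of `F z` and `G z` with composition (`nat_mult`) reduces the claim to naturality
of the universal isomorphism along the constraint `p.mult B B' X`. -/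
lemma univIsoAct_comp {i j l : StarB k n} (B : i ⟶ j) (B' : j ⟶ l) (z : ι)
    (X : (p.toPseudofunctor.obj i).carrier) :
    (univIsoAct F G (B ≫ B') z X).hom ≫
        (isoPres F G l).Q.map (c.mult B B' ((ap (G z) i).obj X)).hom =
      (isoPres F G l).Q.map (c.mult B B' ((ap (F z) i).obj X)).hom ≫
        (isoPres F G l).Q.map ((c.act B').map (nat (F z) B X).inv) ≫
          (univIsoAct F G B' z ((p.act B).obj X)).hom ≫
            (isoPres F G l).Q.map ((c.act B').map (nat (G z) B X).hom) := by
  rw [← cancel_epi ((isoPres F G l).Q.map (nat (F z) (B ≫ B') X).hom),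
    reassoc_of% Q_map_nat_univIsoAct F G (B ≫ B') z X, ← Functor.map_comp,
    ← Functor.map_comp_assoc, nat_mult, nat_mult]
  simp only [Functor.map_comp, Category.assoc]
  have hc : (isoPres F G l).Q.map ((c.act B').map (nat (F z) B X).hom) ≫
      (isoPres F G l).Q.map ((c.act B').map (nat (F z) B X).inv) = 𝟙 _ :=
    ((c.act B' ⋙ (isoPres F G l).Q).mapIso (nat (F z) B X)).hom_inv_id
  rw [← reassoc_of% (@univIso_naturality), reassoc_of% hc]
  congr 1
  rw [reassoc_of% Q_map_nat_univIsoAct]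

/-- The coisoinserter, as a presentation. -/
def coisoPres : c.Presentation where
  pres := isoPres F G
  act B := isoGenAct F G B
  act_rel B := isoGenAct_rel F G B
  act_map₂ {i j B B'} α X Y g := by
    -- The three compatibilities of the action are checked on forward arrows only. Each combines one
    -- coherence law of the transformations `F z`, `G z` with naturality of the universal
    -- isomorphism.
    have key : ∀ z X, (univIsoAct F G B z X).hom ≫
        (isoPres F G j).Q.map (c.map₂ α ((ap (G z) i).obj X)) =
        (isoPres F G j).Q.map (c.map₂ α ((ap (F z) i).obj X)) ≫ (univIsoAct F G B' z X).hom := by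
      intro z X
      rw [← cancel_epi ((isoPres F G j).Q.map (nat (F z) B X).hom),
        reassoc_of% Q_map_nat_univIsoAct F G B z X, ← Functor.map_comp_assoc, ← Functor.map_comp,
        ← nat_map₂, ← nat_map₂, Functor.map_comp_assoc, Q_map_nat_univIsoAct,
        reassoc_of% (@univIso_naturality), Functor.map_comp]
    cases g with
    | fwd z X => exact key z X
    | bwd z X => exact iso_square_inv _ _ (key z X)
  act_id {i X Y} g := by
    have key : ∀ z X, (univIsoAct F G (𝟙 i) z X).hom ≫
        (isoPres F G i).Q.map (c.unit i ((ap (G z) i).obj X)).hom =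
        (isoPres F G i).Q.map (c.unit i ((ap (F z) i).obj X)).hom ≫ (univIso F G i z X).hom := by
      intro z X
      rw [← cancel_epi ((isoPres F G i).Q.map (nat (F z) (𝟙 i) X).hom),
        reassoc_of% Q_map_nat_univIsoAct F G (𝟙 i) z X, ← Functor.map_comp_assoc,
        ← Functor.map_comp, nat_unit, nat_unit, univIso_naturality]
    cases g with
    | fwd z X => exact key z X
    | bwd z X => exact iso_square_inv _ _ (key z X)
  act_comp {i j l} B B' X Y g := by
    let A := LinCat.Hom.functor (LinCat.Presentation.desc (S := isoPres F G j)
      (c.toPseudofunctor.map B' ≫ (isoPres F G l).incl) (isoGenAct F G B') (isoGenAct_rel F G B'))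
    have key : ∀ z X, (univIsoAct F G (B ≫ B') z X).hom ≫
        (isoPres F G l).Q.map (c.mult B B' ((ap (G z) i).obj X)).hom =
        (isoPres F G l).Q.map (c.mult B B' ((ap (F z) i).obj X)).hom ≫
          A.map (univIsoAct F G B z X).hom := by
      intro z X
      have h : A.map (univIsoAct F G B z X).hom =
          (isoPres F G l).Q.map ((c.act B').map (nat (F z) B X).inv) ≫
            (univIsoAct F G B' z ((p.act B).obj X)).hom ≫
              (isoPres F G l).Q.map ((c.act B').map (nat (G z) B X).hom) :=
        (A.map_comp _ _).trans (congrArg (_ ≫ ·) (A.map_comp _ _))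
      exact (univIsoAct_comp F G B B' z X).trans (congrArg (_ ≫ ·) h.symm)
    cases g with
    | fwd z X => exact key z X
    | bwd z X =>
      exact iso_square_inv (univIsoAct F G (B ≫ B') z X)
        (A.mapIso (univIsoAct F G B z X)) (key z X)

/-- The coisoinserter. -/
def coiso : LinRep k n := (coisoPres F G).rep

/-- The canonical transformation to the coisoinserter. -/
def toCoiso : c ⟶ coiso F G := (coisoPres F G).toRep

/-- The universal invertible modifications. -/
def coisoIso (z : ι) : F z ≫ toCoiso F G ≅ G z ≫ toCoiso F G :=
  mkIso (fun i => LinCat.isoMk (NatIso.ofComponents (univIso F G i z)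
    (fun f => univIso_naturality F G i z f))) (fun {i j} B X => by
      -- The transformation `toCoiso` contributes identity constraints. The modification axiom is
      -- then precisely the formula that defined the action on the generators.
      have h : ∀ Φ : p ⟶ c, (nat (Φ ≫ toCoiso F G) B X).hom =
          (isoPres F G j).Q.map (nat Φ B X).hom := fun Φ =>
        (nat_comp Φ (toCoiso F G) B X).trans (Category.comp_id _)
      rw [h, h]
      exact (Q_map_nat_univIsoAct F G B z X).symm)

/-- The generators go to the components of `γ z` and of its inverse, and the relations hold because
`γ z` is a natural isomorphism. -/
lemma isCoisoinserter : IsCoisoinserter F G (toCoiso F G) (coisoIso F G) where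
  exists_desc {d} H γ := by
    let φ : ∀ (i : StarB k n) {X Y : (c.toPseudofunctor.obj i).carrier}, IsoGen F G i X Y →
        ((ap H i).obj X ⟶ (ap H i).obj Y) := fun i X Y g =>
      match g with
      | .fwd z X => cpt (γ z).hom i X
      | .bwd z X => cpt (γ z).inv i X
    have hφ : ∀ (i : StarB k n) {X Y : (c.toPseudofunctor.obj i).carrier}
        (f g : Word (IsoGen F G i) X Y), IsoRel F G i f g →
        LinCat.Presentation.eval (S := isoPres F G i) (Pseudofunctor.StrongTrans.app H i) (φ i) f =
          LinCat.Presentation.eval (S := isoPres F G i)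
            (Pseudofunctor.StrongTrans.app H i) (φ i) g := by
      intro i X Y f g h
      cases h with
      | fwd_bwd z X =>
        exact (cptIso (γ z) i X).hom_inv_id.trans (CategoryTheory.Functor.map_id (ap H i) _).symm
      | bwd_fwd z X =>
        exact (cptIso (γ z) i X).inv_hom_id.trans (CategoryTheory.Functor.map_id (ap H i) _).symm
      | nat z f => exact cpt_naturality (γ z).hom f
    let A := fun j => LinCat.Hom.functor (LinCat.Presentation.desc (S := isoPres F G j)
      (Pseudofunctor.StrongTrans.app H j) (φ j) (hφ j))
    -- The modification axiom for `γ z`, rearranged, says that the induced functor is compatible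
    -- with the action on the forward generators.
    have key : ∀ {i j : StarB k n} (B : i ⟶ j) (z : ι) (X : (p.toPseudofunctor.obj i).carrier),
        (A j).map (univIsoAct F G B z X).hom ≫ (nat H B ((ap (G z) i).obj X)).hom =
        (nat H B ((ap (F z) i).obj X)).hom ≫ (d.act B).map (cpt (γ z).hom i X) := by
      intro i j B z X
      have h : (A j).map (univIsoAct F G B z X).hom = (ap H j).map (nat (F z) B X).inv ≫
          cpt (γ z).hom j ((p.act B).obj X) ≫ (ap H j).map (nat (G z) B X).hom :=
        ((A j).map_comp _ _).trans (congrArg (_ ≫ ·) ((A j).map_comp _ _))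
      have := cpt_nat (γ z).hom B X
      rw [nat_comp, nat_comp] at this
      refine (congrArg (· ≫ _) h).trans ((Category.assoc _ _ _).trans
        ((congrArg (_ ≫ ·) (Category.assoc _ _ _)).trans ?_))
      exact (Iso.inv_comp_eq ((ap H j).mapIso (nat (F z) B X))).mpr
        (this.trans (Category.assoc _ _ _))
    refine ⟨LinRep.Presentation.desc (S := coisoPres F G) H φ hφ ?_,
      (coisoPres F G).descIso H φ hφ _, fun z => ?_⟩
    · intro i j B X Y g
      cases g with
      | fwd z X => exact key B z X
      | bwd z X =>
        exact iso_square_inv ((A j).mapIso (univIsoAct F G B z X))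
          ((d.act B).mapIso (cptIso (γ z) i X)) (key B z X)
    · refine hom_ext₂ fun i X => ?_
      exact ((congrArg (_ ≫ ·) (Category.id_comp _)).trans (Category.comp_id _)).trans
        ((Category.id_comp _).trans (Category.id_comp _)).symm
  existsUnique_hom {d} U V η h := by
    have key : ∀ (i : StarB k n) (z : ι) (X : (p.toPseudofunctor.obj i).carrier),
        (ap U i).map (univIso F G i z X).hom ≫ cpt η i ((ap (G z) i).obj X) =
          cpt η i ((ap (F z) i).obj X) ≫ (ap V i).map (univIso F G i z X).hom := by
      intro i z X
      refine Eq.trans ?_ ((congrArg (fun t => cpt t i X) (h z)).trans ?_)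
      · exact ((congrArg (_ ≫ ·) ((Category.id_comp _).trans (Category.comp_id _)))).symm
      · exact (Category.id_comp _).trans (congrArg (_ ≫ ·) (Category.id_comp _))
    refine (coisoPres F G).existsUnique_hom U V η ?_
    intro i X Y g
    cases g with
    | fwd z X => exact key i z X
    | bwd z X =>
      exact iso_square_inv ((ap U i).mapIso (univIso F G i z X))
        ((ap V i).mapIso (univIso F G i z X)) (key i z X)

end LinRep

end Coisoinserter

/-! ### Construction of coequifiers, and the explicit model -/

section Coequifier

variable {k : Type u} [Field k] {n : ℕ}

namespace LinRep

variable {p w : LinRep k n} {ι : Type} {f g : ι → (p ⟶ w)} (α β : ∀ z, f z ⟶ g z)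

/-- The relations that identify the components of `α z` and `β z`. -/
inductive EqRel (i : StarB k n) : ∀ {X Y : (w.toPseudofunctor.obj i).carrier},
    Word (fun _ _ => PEmpty) X Y → Word (fun _ _ => PEmpty) X Y → Prop
  | mk (z : ι) (X : (p.toPseudofunctor.obj i).carrier) :
      EqRel i (.of (cpt (α z) i X)) (.of (cpt (β z) i X))

/-- The presentation of the coequifier at an object. -/
def eqPres (i : StarB k n) : (w.toPseudofunctor.obj i).Presentation where
  gen _ _ := PEmpty
  rel := EqRel α β i

lemma eqPres_map_eq (i : StarB k n) (z : ι) (X : (p.toPseudofunctor.obj i).carrier) :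
    (eqPres α β i).Q.map (cpt (α z) i X) = (eqPres α β i).Q.map (cpt (β z) i X) :=
  LinCat.Presentation.cls_eq (.rel (.mk z X))

/-- Acting on a component of a modification gives, up to fixed isomorphisms, another component of
it. Relations between components are therefore automatically stable under the action. -/
lemma act_map_cpt {p w : LinRep k n} {Φ Ψ : p ⟶ w} (m : Φ ⟶ Ψ) {i j : StarB k n} (B : i ⟶ j)
    (X : (p.toPseudofunctor.obj i).carrier) :
    (w.act B).map (cpt m i X) =
      (nat Φ B X).inv ≫ cpt m j ((p.act B).obj X) ≫ (nat Ψ B X).hom := by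
  rw [cpt_nat, Iso.inv_hom_id_assoc]

/-- The coequifier, as a presentation. -/
def coeqPres : w.Presentation where
  pres := eqPres α β
  act B _ _ g := g.elim
  act_rel {i j} B X Y f g h := by
    cases h with
    | mk z X =>
      change (eqPres α β j).Q.map ((w.act B).map (cpt (α z) i X)) =
        (eqPres α β j).Q.map ((w.act B).map (cpt (β z) i X))
      rw [act_map_cpt, act_map_cpt]
      simp only [Functor.map_comp]
      rw [eqPres_map_eq]
  act_map₂ _ _ _ g := g.elim
  act_id g := g.elim
  act_comp _ _ _ _ g := g.elim

/-- The coequifier. -/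
def coeq : LinRep k n := (coeqPres α β).rep

/-- The canonical transformation to the coequifier. -/
def toCoeq : w ⟶ coeq α β := (coeqPres α β).toRep

/-- No arrows are added, so a transformation descends as soon as it identifies the components, and
modifications descend without further conditions. -/
lemma isCoequifier : IsCoequifier α β (toCoeq α β) where
  whisker_eq z := hom_ext₂ fun i X => eqPres_map_eq α β i z X
  exists_desc {d} H h := by
    refine ⟨LinRep.Presentation.desc (S := coeqPres α β) H (fun _ _ _ g => g.elim)
      (fun i X Y f g h' => ?_) (fun _ _ _ g => g.elim), ⟨(coeqPres α β).descIso H _ _ _⟩⟩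
    cases h' with
    | mk z X => exact congrArg (fun t => cpt t i X) (h z)
  existsUnique_hom U V η := (coeqPres α β).existsUnique_hom U V η fun _ _ _ g => g.elim

end LinRep

/-- The construction of `C^{WR}` by generators and relations. -/
def wrConstruction (k : Type u) [Field k] {n : ℕ}
    {P : Finpartition (Finset.univ : Finset (Fin (n + 1)))} (E : BlockEnumeration P) :
    WRConstruction k E where
  CW := LinRep.coiso (fun z : E.Pos => Theta k z.fst.succ) (fun z : E.Pos => Theta k z.snd.succ)
  OmW := LinRep.toCoiso _ _
  x := LinRep.coisoIso _ _
  isCoisoinserter := LinRep.isCoisoinserter _ _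
  CWR := LinRep.coeq _ _
  OmR := LinRep.toCoeq _ _
  isCoequifier := LinRep.isCoequifier _ _

end Coequifier

/-! ### The joint universal property and its uniqueness -/

section Uniqueness

variable {𝒞 : Type u} [Bicategory.{w, v} 𝒞] {ι : Type} {q p c : 𝒞} (Γ : q ⟶ p)
  (F G : ι → (p ⟶ c)) (s : ∀ z, Γ ≫ F z ⟶ Γ ≫ G z)

/-- `(r, O, ξ)` is universal among the `1`-morphisms `O : c ⟶ r` equipped with invertible
`2`-morphisms `ξ z : F z ≫ O ≅ G z ≫ O` that restrict along `Γ` to the given `2`-morphisms `s z`. -/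
structure IsRelativeCoisoinserter {r : 𝒞} (O : c ⟶ r) (ξ : ∀ z, F z ≫ O ≅ G z ≫ O) : Prop where
  whisker_eq : ∀ z, Γ ◁ (ξ z).hom = (α_ Γ (F z) O).inv ≫ s z ▷ O ≫ (α_ Γ (G z) O).hom
  exists_desc : ∀ {d : 𝒞} (H : c ⟶ d) (γ : ∀ z, F z ≫ H ≅ G z ≫ H),
    (∀ z, Γ ◁ (γ z).hom = (α_ Γ (F z) H).inv ≫ s z ▷ H ≫ (α_ Γ (G z) H).hom) →
    ∃ (H' : r ⟶ d) (γ' : H ≅ O ≫ H'), ∀ z,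
      (γ z).hom ≫ G z ◁ γ'.hom ≫ (α_ (G z) O H').inv =
        F z ◁ γ'.hom ≫ (α_ (F z) O H').inv ≫ (ξ z).hom ▷ H'
  existsUnique_hom : ∀ {d : 𝒞} (U V : r ⟶ d) (η : O ≫ U ⟶ O ≫ V),
    (∀ z, (ξ z).hom ▷ U ≫ (α_ (G z) O U).hom ≫ G z ◁ η ≫ (α_ (G z) O V).inv =
      (α_ (F z) O U).hom ≫ F z ◁ η ≫ (α_ (F z) O V).inv ≫ (ξ z).hom ▷ V) →
    ∃! θ : U ⟶ V, O ◁ θ = η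

variable {Γ F G s}

/-- Everything descends in two stages, along `W` by the coisoinserter and then along `R` by the
coequifier. Merging the stages permits two constructions to be compared without first comparing
their intermediate objects. -/
lemma IsCoisoinserter.isRelativeCoisoinserter {w r : 𝒞} {W : c ⟶ w}
    {ζ : ∀ z, F z ≫ W ≅ G z ≫ W} (hW : IsCoisoinserter F G W ζ) {R : w ⟶ r}
    (hR : IsCoequifier (f := fun z => (Γ ≫ F z) ≫ W) (g := fun z => (Γ ≫ G z) ≫ W)
      (fun z => (α_ Γ (F z) W).hom ≫ Γ ◁ (ζ z).hom ≫ (α_ Γ (G z) W).inv)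
      (fun z => s z ▷ W) R) :
    IsRelativeCoisoinserter Γ F G s (W ≫ R)
      (fun z => (α_ (F z) W R).symm ≪≫ whiskerRightIso (ζ z) R ≪≫ α_ (G z) W R) where
  whisker_eq z := by
    have := hR.whisker_eq z
    simp only [comp_whiskerRight, whisker_assoc] at this
    have h2 : Γ ◁ (ζ z).hom ▷ R = (α_ Γ (F z ≫ W) R).inv ≫ (α_ Γ (F z) W).inv ▷ R ≫
      s z ▷ W ▷ R ≫ (α_ Γ (G z) W).hom ▷ R ≫ (α_ Γ (G z ≫ W) R).hom := by
      rw [← this]; simp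
    simp [h2]
  exists_desc {d} H γ h := by
    obtain ⟨H', γ', hγ'⟩ := hW.exists_desc H γ
    -- This solves the compatibility for `(ζ z).hom ▷ H'`, so that the restriction hypothesis on `γ`
    -- can be used.
    have e : ∀ z, (ζ z).hom ▷ H' = (α_ (F z) W H').hom ≫ F z ◁ γ'.inv ≫ (γ z).hom ≫
        G z ◁ γ'.hom ≫ (α_ (G z) W H').inv := fun z => by
      rw [hγ', whiskerLeft_inv_hom_assoc, Iso.hom_inv_id_assoc]
    -- The hypothesis that `γ` restricts to `s` along `Γ` becomes, after conjugation by `γ'`, the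
    -- statement that `H'` coequifies the pairs.
    obtain ⟨H'', ⟨δ⟩⟩ := hR.exists_desc H' (fun z => by
      have h3 : s z ▷ (W ≫ H') = (Γ ≫ F z) ◁ γ'.inv ≫ s z ▷ H ≫ (Γ ≫ G z) ◁ γ'.hom := by
        rw [← whisker_exchange, whiskerLeft_inv_hom_assoc]
      have h4 : s z ▷ W ▷ H' = (α_ _ _ _).hom ≫ s z ▷ (W ≫ H') ≫ (α_ _ _ _).inv := by simp
      rw [h4, h3]
      simp only [comp_whiskerRight, whisker_assoc, e, Bicategory.whiskerLeft_comp, h]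
      simp)
    refine ⟨H'', γ' ≪≫ whiskerLeftIso W δ ≪≫ (α_ W R H'').symm, fun z => ?_⟩
    have h1 : (γ z).hom ≫ G z ◁ γ'.hom =
        F z ◁ γ'.hom ≫ (α_ (F z) W H').inv ≫ (ζ z).hom ▷ H' ≫ (α_ (G z) W H').hom := by
      have := hγ' z =≫ (α_ (G z) W H').hom
      simpa using this
    -- Naturality moves `δ` past `ζ z`, so that the compatibility of `γ'` extends to the composite
    -- comparison.
    have h2 := (whisker_exchange (ζ z).hom δ.hom).symm
    simp only [comp_whiskerLeft, whiskerRight_comp, Category.assoc] at h2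
    have h3 := (α_ (F z) W H').inv ≫= h2 =≫ (α_ (G z) W (R ≫ H'')).hom
    simp at h3
    simp [reassoc_of% h1, reassoc_of% h3]
  existsUnique_hom {d} U V η h := by
    obtain ⟨θ₁, h₁, h₁'⟩ := hW.existsUnique_hom (R ≫ U) (R ≫ V)
      ((α_ W R U).inv ≫ η ≫ (α_ W R V).hom) (fun z => by
        have := ((α_ (F z ≫ W) R U).inv ≫ (α_ (F z) W R).hom ▷ U) ≫= h z =≫
          ((α_ (G z) (W ≫ R) V).hom ≫ G z ◁ (α_ W R V).hom ≫ (α_ (G z) W (R ≫ V)).inv)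
        simp at this ⊢
        exact this)
    obtain ⟨θ, h₂, h₂'⟩ := hR.existsUnique_hom U V θ₁
    refine ⟨θ, ?_, fun θ' h' => h₂' θ' (h₁' _ ?_)⟩
    · change (W ≫ R) ◁ θ = η
      rw [comp_whiskerLeft, h₂, h₁]
      simp
    · change W ◁ R ◁ θ' = _
      rw [← h']
      simp

/-- The comparison and its inverse both descend, and uniqueness of descended 2-morphisms makes the
two results mutually inverse. -/
lemma IsRelativeCoisoinserter.exists_iso {r : 𝒞} {O : c ⟶ r} {ξ : ∀ z, F z ≫ O ≅ G z ≫ O}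
    (h : IsRelativeCoisoinserter Γ F G s O ξ) {d : 𝒞} (U V : r ⟶ d) (η : O ≫ U ≅ O ≫ V)
    (hη : ∀ z, (ξ z).hom ▷ U ≫ (α_ (G z) O U).hom ≫ G z ◁ η.hom ≫ (α_ (G z) O V).inv =
      (α_ (F z) O U).hom ≫ F z ◁ η.hom ≫ (α_ (F z) O V).inv ≫ (ξ z).hom ▷ V) :
    Nonempty (U ≅ V) := by
  obtain ⟨θ, hθ, -⟩ := h.existsUnique_hom U V η.hom hη
  obtain ⟨θ', hθ', -⟩ := h.existsUnique_hom V U η.inv (fun z => by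
    have := ((α_ (F z) O V).hom ≫ F z ◁ η.inv ≫ (α_ (F z) O U).inv) ≫= hη z =≫
      ((α_ (G z) O V).hom ≫ G z ◁ η.inv ≫ (α_ (G z) O U).inv)
    simpa using this.symm)
  refine ⟨θ, θ', ?_, ?_⟩
  · refine (h.existsUnique_hom U U (𝟙 _) (fun z => by simp)).unique ?_ ?_
    · rw [Bicategory.whiskerLeft_comp, hθ, hθ', Iso.hom_inv_id]
    · simp
  · refine (h.existsUnique_hom V V (𝟙 _) (fun z => by simp)).unique ?_ ?_
    · rw [Bicategory.whiskerLeft_comp, hθ, hθ', Iso.inv_hom_id]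
    · simp

/-- Precomposed with `O`, both `Φ ≫ Ψ` and the identity give `O` up to isomorphism. The
compatibilities `he` and `he'` ensure that this comparison respects `ξ`, so it descends. -/
lemma IsRelativeCoisoinserter.comp_iso_id {r r' : 𝒞} {O : c ⟶ r} {O' : c ⟶ r'}
    {ξ : ∀ z, F z ≫ O ≅ G z ≫ O} {ξ' : ∀ z, F z ≫ O' ≅ G z ≫ O'}
    (h : IsRelativeCoisoinserter Γ F G s O ξ) {Φ : r ⟶ r'} {Ψ : r' ⟶ r} (e : O' ≅ O ≫ Φ)
    (he : ∀ z, (ξ' z).hom ≫ G z ◁ e.hom ≫ (α_ (G z) O Φ).inv =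
      F z ◁ e.hom ≫ (α_ (F z) O Φ).inv ≫ (ξ z).hom ▷ Φ) (e' : O ≅ O' ≫ Ψ)
    (he' : ∀ z, (ξ z).hom ≫ G z ◁ e'.hom ≫ (α_ (G z) O' Ψ).inv =
      F z ◁ e'.hom ≫ (α_ (F z) O' Ψ).inv ≫ (ξ' z).hom ▷ Ψ) : Nonempty (Φ ≫ Ψ ≅ 𝟙 r) := by
  refine h.exists_iso _ _
    ((α_ O Φ Ψ).symm ≪≫ whiskerRightIso e.symm Ψ ≪≫ e'.symm ≪≫ (ρ_ O).symm) fun z => ?_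
  have h1 : (ξ z).hom ▷ Φ = (α_ (F z) O Φ).hom ≫ F z ◁ e.inv ≫ (ξ' z).hom ≫ G z ◁ e.hom ≫
      (α_ (G z) O Φ).inv := by
    rw [he, whiskerLeft_inv_hom_assoc, Iso.hom_inv_id_assoc]
  have h2 : (ξ' z).hom ▷ Ψ = (α_ (F z) O' Ψ).hom ≫ F z ◁ e'.inv ≫ (ξ z).hom ≫ G z ◁ e'.hom ≫
      (α_ (G z) O' Ψ).inv := by
    rw [he', whiskerLeft_inv_hom_assoc, Iso.hom_inv_id_assoc]
  simp [h1, h2]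

/-- Each universal object receives the comparison induced by the structure on the other, and
`comp_iso_id` applies in both orders. -/
lemma IsRelativeCoisoinserter.exists_equivalence {r r' : 𝒞} {O : c ⟶ r} {O' : c ⟶ r'}
    {ξ : ∀ z, F z ≫ O ≅ G z ≫ O} {ξ' : ∀ z, F z ≫ O' ≅ G z ≫ O'}
    (h : IsRelativeCoisoinserter Γ F G s O ξ) (h' : IsRelativeCoisoinserter Γ F G s O' ξ') :
    ∃ (Φ : r ⟶ r') (Ψ : r' ⟶ r), Nonempty (Φ ≫ Ψ ≅ 𝟙 r) ∧ Nonempty (Ψ ≫ Φ ≅ 𝟙 r') := by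
  obtain ⟨Φ, e, he⟩ := h.exists_desc O' ξ' h'.whisker_eq
  obtain ⟨Ψ, e', he'⟩ := h'.exists_desc O ξ h.whisker_eq
  exact ⟨Φ, Ψ, h.comp_iso_id e he e' he', h'.comp_iso_id e' he' e he⟩

end Uniqueness

/-! ### Invariance of simple transitivity under equivalence -/

section Transfer

variable {k : Type u} [Field k] {n : ℕ}

namespace LinRep

variable {M N : LinRep k n} {Φ : M ⟶ N} {Ψ : N ⟶ M}

/-- The components of an isomorphism between a composite and an identity. -/
def retIso (e : Φ ≫ Ψ ≅ 𝟙 M) (i : StarB k n) (X : (M.toPseudofunctor.obj i).carrier) :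
    (ap Ψ i).obj ((ap Φ i).obj X) ≅ X := cptIso e i X

lemma retIso_naturality (e : Φ ≫ Ψ ≅ 𝟙 M) (i : StarB k n)
    {X Y : (M.toPseudofunctor.obj i).carrier} (f : X ⟶ Y) :
    (ap Ψ i).map ((ap Φ i).map f) ≫ (retIso e i Y).hom = (retIso e i X).hom ≫ f :=
  cpt_naturality e.hom f

/-- The components of an equivalence of birepresentations. -/
def apEquivalence (e : Φ ≫ Ψ ≅ 𝟙 M) (e' : Ψ ≫ Φ ≅ 𝟙 N) (i : StarB k n) :
    (M.toPseudofunctor.obj i).carrier ≌ (N.toPseudofunctor.obj i).carrier :=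
  CategoryTheory.Equivalence.mk (ap Φ i) (ap Ψ i)
    (NatIso.ofComponents (retIso e i) (fun f => retIso_naturality e i f)).symm
    (NatIso.ofComponents (retIso e' i) (fun f => retIso_naturality e' i f))

/-- The preimage of a stable ideal. -/
def StableIdeal.comap (I : M.StableIdeal) (Ψ : N ⟶ M) : N.StableIdeal where
  hom i X Y := (I.hom i ((ap Ψ i).obj X) ((ap Ψ i).obj Y)).comap ((ap Ψ i).mapLinearMap k)
  precomp_mem {i X Y Z} f g hg := by
    have := I.precomp_mem ((ap Ψ i).map f) hg
    simpa using this
  postcomp_mem {i X Y Z} f g hf := by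
    have := I.postcomp_mem ((ap Ψ i).map g) hf
    simpa using this
  act_mem {i j} F {X Y f} hf := by
    have hf' : (ap Ψ i).map f ∈ I.hom i _ _ := hf
    have := I.precomp_mem (nat Ψ F X).hom (I.postcomp_mem (nat Ψ F Y).inv (I.act_mem F hf'))
    have h : (nat Ψ F X).hom ≫ (M.act F).map ((ap Ψ i).map f) ≫ (nat Ψ F Y).inv =
        (ap Ψ j).map ((N.act F).map f) := by
      rw [← reassoc_of% (@nat_naturality), Iso.hom_inv_id, Category.comp_id]
    rw [h] at this
    exact this

lemma StableIdeal.eq_top_of_id_mem (I : M.StableIdeal) {i : StarB k n}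
    (h : ∀ X, 𝟙 X ∈ I.hom i X X) (X Y : (M.toPseudofunctor.obj i).carrier) : I.hom i X Y = ⊤ :=
  eq_top_iff.mpr fun f _ => by
    have := I.postcomp_mem f (h X)
    rwa [Category.id_comp] at this

/-- Ideals are pulled back along `Ψ`. A morphism `f` of `M` agrees with its image under `Φ` followed
by `Ψ` up to isomorphism, so the pullback of a proper ideal is proper. -/
lemma IsSimpleTransitive.of_equivalence (hN : N.IsSimpleTransitive) (e : Φ ≫ Ψ ≅ 𝟙 M)
    (e' : Ψ ≫ Φ ≅ 𝟙 N) : M.IsSimpleTransitive where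
  finitary i := by
    obtain ⟨R, _, _, hR, T, hT, hT₁, hT₂⟩ := hN.finitary i
    have : (ap Φ i).IsEquivalence := (apEquivalence e e' i).isEquivalence_functor
    exact ⟨R, _, _, hR, ap Φ i ⋙ T, inferInstance, inferInstance, inferInstance⟩
  nonzero := by
    obtain ⟨i, X, hX⟩ := hN.nonzero
    refine ⟨i, (ap Ψ i).obj X, fun h => hX ?_⟩
    have h1 := retIso_naturality e' i (𝟙 X)
    rw [CategoryTheory.Functor.map_id, h, Functor.map_zero, Limits.zero_comp,
      Category.comp_id] at h1
    rw [← (retIso e' i X).inv_hom_id, ← h1, Limits.comp_zero]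
  -- The witnesses of properness in `N` are the images under `Φ` of the witnesses in `M`.
  not_isProper I := by
    rintro ⟨i, ⟨X, Y, h⟩, X', Y', h'⟩
    refine hN.not_isProper (I.comap Ψ) ⟨i, ⟨(ap Φ i).obj X, (ap Φ i).obj Y, fun h0 => h ?_⟩,
      ⟨(ap Φ i).obj X', (ap Φ i).obj Y', fun h1 => h' (eq_top_iff.mpr fun f _ => ?_)⟩⟩
    · refine eq_bot_iff.mpr fun f hf => ?_
      have h1 : (ap Φ i).map f ∈ (I.comap Ψ).hom i ((ap Φ i).obj X) ((ap Φ i).obj Y) := by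
        have := I.precomp_mem (retIso e i X).hom (I.postcomp_mem (retIso e i Y).inv hf)
        rwa [← reassoc_of% (@retIso_naturality), Iso.hom_inv_id, Category.comp_id] at this
      rw [h0, Submodule.mem_bot] at h1
      have h2 := retIso_naturality e i f
      rw [h1, Functor.map_zero, Limits.zero_comp] at h2
      rw [Submodule.mem_bot, ← Iso.inv_hom_id_assoc (retIso e i X) f, ← h2, Limits.comp_zero]
    · have h2 : (ap Ψ i).map ((ap Φ i).map f) ∈ I.hom i _ _ :=
        h1.ge (Submodule.mem_top (x := (ap Φ i).map f))
      have h3 := I.precomp_mem (retIso e i X').inv (I.postcomp_mem (retIso e i Y').hom h2)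
      rwa [retIso_naturality, Iso.inv_hom_id_assoc] at h3

end LinRep

/-- By uniqueness of the joint colimit, one construction decides the matter for all. -/
lemma WRConstruction.isSimpleTransitive {P : Finpartition (Finset.univ : Finset (Fin (n + 1)))}
    {E : BlockEnumeration P} (D D' : WRConstruction k E) (h : D'.CWR.IsSimpleTransitive) :
    D.CWR.IsSimpleTransitive := by
  obtain ⟨Φ, Ψ, ⟨e⟩, ⟨e'⟩⟩ := (D.isCoisoinserter.isRelativeCoisoinserter
    D.isCoequifier).exists_equivalence (D'.isCoisoinserter.isRelativeCoisoinserter D'.isCoequifier)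
  exact h.of_equivalence e e'

end Transfer

/-! ### Generators and relations for the explicit model -/

section Concrete

variable {k : Type u} [Field k] {n : ℕ}
  {P : Finpartition (Finset.univ : Finset (Fin (n + 1)))} {E : BlockEnumeration P}
open Bim

variable (k) in
/-- The bimodule `B ⊗_A A e_j`. -/
def thetaObj (j : Fin (n + 1)) (B : (IsB k n).FullSubcategory) : (IsProj k n).FullSubcategory :=
  ⟨Ae k j ≫ B.obj, isProj_comp k n (isProj_Ae k n j) B.property⟩

variable (k) in
/-- The morphism `f ⊗_A A e_j`. -/
def thetaMap (j : Fin (n + 1)) {B B' : (IsB k n).FullSubcategory} (f : B ⟶ B') :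
    thetaObj k j B ⟶ thetaObj k j B' := ObjectProperty.homMk (Ae k j ◁ f.hom)

variable (k) in
/-- The module `F ⊗_A X`. -/
def actObj (F : (IsB k n).FullSubcategory) (X : (IsProj k n).FullSubcategory) :
    (IsProj k n).FullSubcategory := ⟨X.obj ≫ F.obj, isProj_comp k n X.property F.property⟩

variable (k) in
/-- The map `F ⊗_A f`. -/
def actMap (F : (IsB k n).FullSubcategory) {X Y : (IsProj k n).FullSubcategory} (f : X ⟶ Y) :
    actObj k F X ⟶ actObj k F Y := ObjectProperty.homMk (f.hom ▷ F.obj)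

variable (E) in
/-- The category underlying the birepresentation `C^{WR}`. -/
abbrev WR (i : StarB k n) : Type (u + 1) :=
  ((wrConstruction k E).CWR.toPseudofunctor.obj i).carrier

variable (i : StarB k n)

variable (E) in
/-- The first step of the projection to `C^{WR}`. -/
def wPres : ((repC k n).toPseudofunctor.obj i).Presentation :=
  LinRep.isoPres (fun z : E.Pos => Theta k z.fst.succ) (fun z : E.Pos => Theta k z.snd.succ) i

variable (E) in
/-- The second step of the projection to `C^{WR}`. -/
def wrPres : (wPres E i).cat.Presentation :=
  LinRep.eqPres (p := repN k n) (w := (wrConstruction k E).CW)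
    (f := fun z : E.Pos => (Gam k n ≫ Theta k z.fst.succ) ≫ (wrConstruction k E).OmW)
    (g := fun z : E.Pos => (Gam k n ≫ Theta k z.snd.succ) ≫ (wrConstruction k E).OmW)
    (fun z => (α_ (Gam k n) (Theta k z.fst.succ) (wrConstruction k E).OmW).hom ≫
      Gam k n ◁ ((wrConstruction k E).x z).hom ≫
      (α_ (Gam k n) (Theta k z.snd.succ) (wrConstruction k E).OmW).inv)
    (fun z => (sIso k z.fst z.snd).hom ▷ (wrConstruction k E).OmW) i

variable (E) in
/-- The projection to `C^{WR}`, which is the identity on objects. -/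
def wrQ : (IsProj k n).FullSubcategory ⥤ WR E i := (wPres E i).Q ⋙ (wrPres E i).Q

instance : (wrQ E i).Additive :=
  inferInstanceAs ((wPres E i).Q ⋙ (wrPres E i).Q).Additive
instance : (wrQ E i).Linear k :=
  inferInstanceAs (((wPres E i).Q ⋙ (wrPres E i).Q).Linear k)

/-- The isomorphisms in `C^{WR}`. -/
def wrX (z : E.Pos) (B : (IsB k n).FullSubcategory) :
    (wrQ E i).obj (thetaObj k z.fst.succ B) ≅ (wrQ E i).obj (thetaObj k z.snd.succ B) :=
  (wrPres E i).Q.mapIso (LinRep.univIso (fun z : E.Pos => Theta k z.fst.succ)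
    (fun z : E.Pos => Theta k z.snd.succ) i z B)

lemma wrX_naturality (z : E.Pos) {B B' : (IsB k n).FullSubcategory} (f : B ⟶ B') :
    (wrQ E i).map (thetaMap k z.fst.succ f) ≫ (wrX i z B').hom =
      (wrX i z B).hom ≫ (wrQ E i).map (thetaMap k z.snd.succ f) := by
  have := congrArg (wrPres E i).Q.map (LinRep.univIso_naturality
    (fun z : E.Pos => Theta k z.fst.succ) (fun z : E.Pos => Theta k z.snd.succ) i z f)
  exact ((wrPres E i).Q.map_comp _ _).symm.trans (this.trans ((wrPres E i).Q.map_comp _ _))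

/-- This is the relation imposed by the coequifier; the associators in the pair of modifications
have identity components. -/
lemma wrX_of_isN (z : E.Pos) (N : (IsN k n).FullSubcategory) :
    (wrX i z ⟨N.obj, isB_of_isN k n N.property⟩).hom =
      (wrQ E i).map (smapIso k z.fst z.snd N).hom := by
  have := LinRep.eqPres_map_eq (p := repN k n) (w := (wrConstruction k E).CW)
    (f := fun z : E.Pos => (Gam k n ≫ Theta k z.fst.succ) ≫ (wrConstruction k E).OmW)
    (g := fun z : E.Pos => (Gam k n ≫ Theta k z.snd.succ) ≫ (wrConstruction k E).OmW)
    (fun z => (α_ (Gam k n) (Theta k z.fst.succ) (wrConstruction k E).OmW).hom ≫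
      Gam k n ◁ ((wrConstruction k E).x z).hom ≫
      (α_ (Gam k n) (Theta k z.snd.succ) (wrConstruction k E).OmW).inv)
    (fun z => (sIso k z.fst z.snd).hom ▷ (wrConstruction k E).OmW) i z N
  refine Eq.trans ?_ this
  exact (congrArg (wrPres E i).Q.map ((Category.id_comp _).trans (Category.comp_id _))).symm

variable (k) in
/-- The associativity constraint `F ⊗_A (B ⊗_A A e_j) ≅ (F ⊗_A B) ⊗_A A e_j`. -/
def actTheta (j : Fin (n + 1)) (B F : (IsB k n).FullSubcategory) :
    actObj k F (thetaObj k j B) ≅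
      thetaObj k j ⟨B.obj ≫ F.obj, isB_comp k n B.property F.property⟩ :=
  ObjectProperty.isoMk _ (α_ (Ae k j) B.obj F.obj)

/-- The action was defined on generators by this formula, and for `Θ_j` the structure isomorphisms
are associators of tensor products. -/
lemma act_wrX (F : i ⟶ i) (z : E.Pos) (B : (IsB k n).FullSubcategory) :
    ((wrConstruction k E).CWR.act F).map (wrX i z B).hom =
      (wrQ E i).map (actTheta k z.fst.succ B F).hom ≫
        (wrX i z ⟨B.obj ≫ F.obj, isB_comp k n B.property F.property⟩).hom ≫
          (wrQ E i).map (actTheta k z.snd.succ B F).inv :=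
  ((wrPres E i).Q.map_comp _ _).trans (congrArg (_ ≫ ·) ((wrPres E i).Q.map_comp _ _))

/-- Induction over both presentations. Only the first one adds arrows, and these are the
isomorphisms `wrX` and their inverses. -/
lemma wr_induction {motive : ∀ {X Y : (IsProj k n).FullSubcategory},
      ((wrQ E i).obj X ⟶ (wrQ E i).obj Y) → Prop}
    (of : ∀ {X Y : (IsProj k n).FullSubcategory} (f : X ⟶ Y), motive ((wrQ E i).map f))
    (fwd : ∀ (z : E.Pos) (B : (IsB k n).FullSubcategory), motive (wrX i z B).hom)
    (bwd : ∀ (z : E.Pos) (B : (IsB k n).FullSubcategory), motive (wrX i z B).inv)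
    (comp : ∀ {X Y Z : (IsProj k n).FullSubcategory} (f : (wrQ E i).obj X ⟶ (wrQ E i).obj Y)
      (g : (wrQ E i).obj Y ⟶ (wrQ E i).obj Z), motive f → motive g → motive (f ≫ g))
    (add : ∀ {X Y : (IsProj k n).FullSubcategory} (f g : (wrQ E i).obj X ⟶ (wrQ E i).obj Y),
      motive f → motive g → motive (f + g))
    (smul : ∀ {X Y : (IsProj k n).FullSubcategory} (c : k)
      (f : (wrQ E i).obj X ⟶ (wrQ E i).obj Y), motive f → motive (c • f))
    {X Y : (IsProj k n).FullSubcategory} (f : (wrQ E i).obj X ⟶ (wrQ E i).obj Y) : motive f := by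
  have h₁ : ∀ {X Y : (IsProj k n).FullSubcategory}
      (f : (wPres E i).Q.obj X ⟶ (wPres E i).Q.obj Y),
      motive (X := X) (Y := Y) ((wrPres E i).Q.map f) := by
    intro X Y f
    refine (wPres E i).induction (motive := fun {X Y} f =>
      motive (X := X) (Y := Y) ((wrPres E i).Q.map f)) of ?_ ?_ ?_ ?_ f
    · rintro _ _ (⟨z, B⟩ | ⟨z, B⟩)
      · exact fwd z B
      · exact bwd z B
    · intro X Y Z f g hf hg
      have : (wrPres E i).Q.map (f ≫ g) = (wrPres E i).Q.map f ≫ (wrPres E i).Q.map g :=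
        Functor.map_comp _ _ _
      rw [this]
      exact comp (X := X) (Y := Y) (Z := Z) _ _ hf hg
    · intro X Y f g hf hg
      rw [Functor.map_add]
      exact add (X := X) (Y := Y) _ _ hf hg
    · intro X Y c f hf
      rw [Functor.map_smul]
      exact smul (X := X) (Y := Y) c _ hf
  refine (wrPres E i).induction (motive := fun {X Y} f => motive (X := X.as) (Y := Y.as) f)
    (fun f => h₁ f) ?_ ?_ ?_ ?_ (X := ⟨X⟩) (Y := ⟨Y⟩) f
  -- The coequifier has no additional generators.
  · rintro _ _ ⟨⟩
  · exact fun f g => comp f g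
  · exact fun f g => add f g
  · exact fun c f => smul c f

/-- A linear functor on `C^{WR}` from a linear functor on `A-proj` and natural isomorphisms. -/
lemma exists_wrDesc {D : LinCat k} (H : (IsProj k n).FullSubcategory ⥤ D.carrier) [H.Additive]
    [H.Linear k] (γ : ∀ (z : E.Pos) (B : (IsB k n).FullSubcategory),
      H.obj (thetaObj k z.fst.succ B) ≅ H.obj (thetaObj k z.snd.succ B))
    (hγ : ∀ (z : E.Pos) {B B' : (IsB k n).FullSubcategory} (f : B ⟶ B'),
      H.map (thetaMap k z.fst.succ f) ≫ (γ z B').hom =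
        (γ z B).hom ≫ H.map (thetaMap k z.snd.succ f))
    (hN : ∀ (z : E.Pos) (N : (IsN k n).FullSubcategory),
      (γ z ⟨N.obj, isB_of_isN k n N.property⟩).hom = H.map (smapIso k z.fst z.snd N).hom) :
    ∃ κ : ∀ {X Y : (IsProj k n).FullSubcategory},
        ((wrQ E i).obj X ⟶ (wrQ E i).obj Y) →ₗ[k] (H.obj X ⟶ H.obj Y),
      (∀ {X Y Z : (IsProj k n).FullSubcategory} (f : (wrQ E i).obj X ⟶ (wrQ E i).obj Y)
        (g : (wrQ E i).obj Y ⟶ (wrQ E i).obj Z), κ (f ≫ g) = κ f ≫ κ g) ∧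
      (∀ {X Y : (IsProj k n).FullSubcategory} (f : X ⟶ Y), κ ((wrQ E i).map f) = H.map f) ∧
      ∀ (z : E.Pos) (B : (IsB k n).FullSubcategory), κ (wrX i z B).hom = (γ z B).hom := by
  let H₀ : (repC k n).toPseudofunctor.obj i ⟶ D :=
    { functor := H, additive := ‹H.Additive›, linear := ‹H.Linear k› }
  let φ : ∀ {X Y : ((repC k n).toPseudofunctor.obj i).carrier}, (wPres E i).gen X Y →
      ((LinCat.Hom.functor H₀).obj X ⟶ (LinCat.Hom.functor H₀).obj Y) := fun {X Y} g =>
    match X, Y, g with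
    | _, _, .fwd z B => (γ z B).hom
    | _, _, .bwd z B => (γ z B).inv
  have hφ : ∀ {X Y : ((repC k n).toPseudofunctor.obj i).carrier} (f g : Word (wPres E i).gen X Y),
      (wPres E i).rel f g → LinCat.Presentation.eval H₀ φ f = LinCat.Presentation.eval H₀ φ g := by
    rintro _ _ _ _ (⟨z, B⟩ | ⟨z, B⟩ | ⟨z, f⟩)
    · exact (γ z B).hom_inv_id.trans (H.map_id _).symm
    · exact (γ z B).inv_hom_id.trans (H.map_id _).symm
    · exact hγ z f
  let K₁ := LinCat.Presentation.desc H₀ φ hφ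
  have hK : ∀ {X Y : (wPres E i).cat.carrier} (f g : Word (wrPres E i).gen X Y),
      (wrPres E i).rel f g → LinCat.Presentation.eval K₁ (fun g => PEmpty.elim g) f =
        LinCat.Presentation.eval K₁ (fun g => PEmpty.elim g) g := by
    rintro _ _ _ _ ⟨z, N⟩
    -- The relations of the coequifier hold in the target because `γ` has the prescribed values on
    -- `N`.
    refine Eq.trans ?_ (hN z N)
    exact congrArg (LinCat.Hom.functor K₁).map ((Category.id_comp _).trans (Category.comp_id _))
  let K₂ := LinCat.Presentation.desc (S := wrPres E i) K₁ (fun g => PEmpty.elim g) hK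
  let K := LinCat.Hom.functor K₂
  exact ⟨fun {X Y} => K.mapLinearMap k (X := (wrQ E i).obj X) (Y := (wrQ E i).obj Y),
    fun f g => K.map_comp f g, fun f => rfl, fun z B => rfl⟩

end Concrete

/-! ### Bimodules on which right multiplications by the `a_i` have a common image -/

section Balanced

variable {k : Type u} [Field k] {n : ℕ}
open Bim Alg

/-- The property of a bimodule `G` that the maps `G ⊗_A A e_j ⟶ G ⊗_A A e_0` are
split monomorphisms and have the same image. -/
def IsBalanced {S : Alg k} (G : A k n ⟶ S) : Prop :=
  ∀ j : Fin n, ∃ t : Ae k (0 : Fin (n + 1)) ≫ G ⟶ Ae k j.succ ≫ G, rho k j ▷ G ≫ t = 𝟙 _ ∧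
    ∀ i : Fin n, rho k i ▷ G ≫ t ≫ rho k j ▷ G = rho k i ▷ G

lemma isBalanced_eA : IsBalanced (eA k n) :=
  fun j => ⟨tau k j, rho_tau k j, fun i => rho_tau_rho k i j⟩

/-- The splittings on the summands are assembled with the inclusions and projections. This works
because the maps induced by `rho` are natural in the bimodule. -/
lemma IsBalanced.of_inAdd {S : Alg k} {ι : Type*} {H : ι → (A k n ⟶ S)}
    (hH : ∀ x, IsBalanced (H x)) {N : A k n ⟶ S} (hN : InAdd H N) : IsBalanced N := by
  intro j
  obtain ⟨J, _, l, i, p, h⟩ := hN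
  choose t ht ht' using fun x => hH (l x) j
  have key : ∀ m : Fin n, rho k m ▷ N ≫ (∑ x, Ae k 0 ◁ i x ≫ t x ≫ Ae k j.succ ◁ p x) =
      ∑ x, Ae k m.succ ◁ i x ≫ (rho k m ▷ H (l x) ≫ t x) ≫ Ae k j.succ ◁ p x := by
    intro m
    rw [Preadditive.comp_sum]
    refine Finset.sum_congr rfl fun x _ => ?_
    rw [← whisker_exchange_assoc, Category.assoc]
  have hsum : ∀ m : Fin (n + 1), ∑ x, Ae k m ◁ i x ≫ Ae k m ◁ p x = 𝟙 (Ae k m ≫ N) := by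
    intro m
    have := congrArg (fun f => (precomp _ (Ae k m)).map f) h
    rw [Functor.map_sum] at this
    simp only [Functor.map_comp] at this
    exact this.trans (CategoryTheory.Functor.map_id _ _)
  refine ⟨∑ x, Ae k 0 ◁ i x ≫ t x ≫ Ae k j.succ ◁ p x, ?_, fun m => ?_⟩
  · rw [key]
    simp only [ht, Category.id_comp]
    exact hsum _
  · rw [← Category.assoc, key, Preadditive.sum_comp]
    have : ∀ x, (Ae k m.succ ◁ i x ≫ (rho k m ▷ H (l x) ≫ t x) ≫ Ae k j.succ ◁ p x) ≫
        rho k j ▷ N = rho k m ▷ N ≫ (Ae k 0 ◁ i x ≫ Ae k 0 ◁ p x) := by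
      intro x
      simp only [Category.assoc]
      rw [whisker_exchange, ← whisker_exchange_assoc]
      rw [reassoc_of% ht' x m]
    simp only [this]
    rw [← Preadditive.comp_sum, hsum, Category.comp_id]

instance tensor_eA_Ae_finite (j : Fin (n + 1)) :
    Module.Finite k (BiMod.V (Ae k j ≫ eA k n : ground k ⟶ ground k)) :=
  tensor_finite (rightIdeal k (StarAlg.e k n 0)) (leftIdeal k (StarAlg.e k n j))

/-- The right module `e_0 A ⊗_A B` lies in `add (e_0 A)`. Indeed, for `B = A e_j ⊗_k e_0 A` it is
`e_0 A` tensored with the finite dimensional space `e_0 A ⊗_A A e_j`. This is why the corner functor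
can receive the new isomorphisms for every `B`, not only for those in `N`. -/
lemma isBalanced_comp_eA {B : A k n ⟶ A k n} (hB : IsB k n B) : IsBalanced (B ≫ eA k n) := by
  refine IsBalanced.of_inAdd (H := fun _ : Unit => eA k n) (fun _ => isBalanced_eA) ?_
  refine (hB.map (postcomp _ (eA k n))).trans fun j => ?_
  cases j with
  | none =>
    exact InAdd.of_iso (λ_ (eA k n)) (InAdd.of_mem (G := fun _ : Unit => eA k n) ())
  | some j =>
    refine InAdd.of_iso (α_ (eA k n) (Ae k j) (eA k n)) ?_
    exact ((Alg.inAdd_ground (Ae k j ≫ eA k n) inferInstance).map (precomp _ (eA k n))).trans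
      fun _ => InAdd.of_iso (ρ_ (eA k n)) (InAdd.of_mem (G := fun _ : Unit => eA k n) ())

/-- A map into `G ⊗_A A e_j` is thus determined by its composite with this one. Each identity
between the maps `gmap`, `gIso` and `smap` is tested in this way. -/
lemma IsBalanced.mono_rho {S : Alg k} {G : A k n ⟶ S} (hG : IsBalanced G) (j : Fin n) :
    Mono (rho k j ▷ G) := by
  obtain ⟨t, h, -⟩ := hG j
  exact mono_of_mono_fac h

lemma IsBalanced.exists_gmap {S : Alg k} {G : A k n ⟶ S} (hG : IsBalanced G) (i j : Fin n) :
    ∃ s : Ae k i.succ ≫ G ⟶ Ae k j.succ ≫ G, s ≫ rho k j ▷ G = rho k i ▷ G := by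
  obtain ⟨t, -, h⟩ := hG j
  exact ⟨rho k i ▷ G ≫ t, by rw [Category.assoc, h i]⟩

/-- The map `G ⊗_A A e_i ⟶ G ⊗_A A e_j` that commutes with the maps to `G ⊗_A A e_0`. -/
def gmap {S : Alg k} {G : A k n ⟶ S} (hG : IsBalanced G) (i j : Fin n) :
    Ae k i.succ ≫ G ⟶ Ae k j.succ ≫ G := (hG.exists_gmap i j).choose

lemma gmap_rho {S : Alg k} {G : A k n ⟶ S} (hG : IsBalanced G) (i j : Fin n) :
    gmap hG i j ≫ rho k j ▷ G = rho k i ▷ G := (hG.exists_gmap i j).choose_spec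

lemma gmap_gmap {S : Alg k} {G : A k n ⟶ S} (hG : IsBalanced G) (i j : Fin n) :
    gmap hG i j ≫ gmap hG j i = 𝟙 _ := by
  have := hG.mono_rho i
  rw [← cancel_mono (rho k i ▷ G), Category.assoc, gmap_rho, gmap_rho, Category.id_comp]

lemma gmap_naturality {S : Alg k} {G G' : A k n ⟶ S} (hG : IsBalanced G) (hG' : IsBalanced G')
    (i j : Fin n) (f : G ⟶ G') :
    Ae k i.succ ◁ f ≫ gmap hG' i j = gmap hG i j ≫ Ae k j.succ ◁ f := by
  have := hG'.mono_rho j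
  rw [← cancel_mono (rho k j ▷ G'), Category.assoc, Category.assoc, gmap_rho,
    whisker_exchange, whisker_exchange, ← Category.assoc, gmap_rho]

/-- The map `(G ⊗_A B) ⊗_A A e_i ⟶ (G ⊗_A B) ⊗_A A e_j`, reassociated. -/
def gIso {S : Alg k} {B : A k n ⟶ A k n} {G : A k n ⟶ S} (hG : IsBalanced (B ≫ G))
    (i j : Fin n) : (Ae k i.succ ≫ B) ≫ G ≅ (Ae k j.succ ≫ B) ≫ G :=
  α_ _ _ _ ≪≫ ⟨gmap hG i j, gmap hG j i, gmap_gmap hG i j, gmap_gmap hG j i⟩ ≪≫ (α_ _ _ _).symm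

lemma gIso_naturality {S : Alg k} {B B' : A k n ⟶ A k n} {G : A k n ⟶ S}
    (hG : IsBalanced (B ≫ G)) (hG' : IsBalanced (B' ≫ G)) (i j : Fin n) (f : B ⟶ B') :
    (Ae k i.succ ◁ f) ▷ G ≫ (gIso hG' i j).hom =
      (gIso hG i j).hom ≫ (Ae k j.succ ◁ f) ▷ G := by
  have := gmap_naturality hG hG' i j (f ▷ G)
  simp only [gIso, Iso.trans_hom, Iso.symm_hom, Category.assoc]
  rw [← associator_inv_naturality_middle, ← reassoc_of% this, associator_naturality_middle_assoc]

/-- Both sides are characterized by the same compatibility with the maps to the centre `A e_0`.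
Consequently the isomorphisms chosen for the corner functor satisfy the coequifier relation. -/
lemma smap_whiskerRight {S : Alg k} {N : A k n ⟶ A k n} (hN : IsN k n N) {G : A k n ⟶ S}
    (hG : IsBalanced (N ≫ G)) (i j : Fin n) : smap k i j hN ▷ G = (gIso hG i j).hom := by
  have := hG.mono_rho j
  rw [← cancel_mono (α_ _ _ _).hom, ← cancel_mono (rho k j ▷ (N ≫ G))]
  have h := congrArg (fun t => t ▷ G) (smap_rho i j hN)
  simp only [comp_whiskerRight] at h
  simp only [gIso, Iso.trans_hom, Iso.symm_hom, Category.assoc, Iso.inv_hom_id, Category.comp_id,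
    gmap_rho, ← associator_naturality_left, reassoc_of% h]

end Balanced

/-! ### The corner functor on the explicit model -/

section Concrete

variable {k : Type u} [Field k] {n : ℕ}
  {P : Finpartition (Finset.univ : Finset (Fin (n + 1)))} {E : BlockEnumeration P}
open Bim Alg

variable (i : StarB k n)

variable (k n) in
/-- The functor `X ↦ e_0 A ⊗_A X`. -/
def cornerFunctor : (IsProj k n).FullSubcategory ⥤ (ground k ⟶ ground k) :=
  (IsProj k n).ι ⋙ postcomp (ground k) (eA k n)

instance : (cornerFunctor k n).Additive where
  map_add {_ _ f g} := Alg.whiskerRight_add f.hom g.hom (eA k n)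

instance : (cornerFunctor k n).Linear k where
  map_smul f c := Alg.whiskerRight_smul c f.hom (eA k n)

/-- The isomorphisms `gIso` provide the images of the generators; their naturality and their
agreement with the prescribed values on `N` are the relations. -/
lemma exists_corner : ∃ κ : ∀ {X Y : (IsProj k n).FullSubcategory},
        ((wrQ E i).obj X ⟶ (wrQ E i).obj Y) →ₗ[k] (X.obj ≫ eA k n ⟶ Y.obj ≫ eA k n),
      (∀ {X Y Z : (IsProj k n).FullSubcategory} (f : (wrQ E i).obj X ⟶ (wrQ E i).obj Y)
        (g : (wrQ E i).obj Y ⟶ (wrQ E i).obj Z), κ (f ≫ g) = κ f ≫ κ g) ∧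
      (∀ {X Y : (IsProj k n).FullSubcategory} (f : X ⟶ Y),
        κ ((wrQ E i).map f) = f.hom ▷ eA k n) ∧
      ∀ (z : E.Pos) (B : (IsB k n).FullSubcategory),
        κ (wrX i z B).hom = (gIso (isBalanced_comp_eA B.property) z.fst z.snd).hom := 
  exists_wrDesc (E := E) i (D := ⟨ground k ⟶ ground k⟩) (cornerFunctor k n)
    (fun z B => gIso (isBalanced_comp_eA B.property) z.fst z.snd)
    (fun z B B' f => gIso_naturality _ _ z.fst z.snd f.hom)
    (fun z N => (smap_whiskerRight N.property _ z.fst z.snd).symm)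

/-- The linear functor on `C^{WR}` that extends `X ↦ e_0 A ⊗_A X`. -/
def corner {X Y : (IsProj k n).FullSubcategory} :
    ((wrQ E i).obj X ⟶ (wrQ E i).obj Y) →ₗ[k] (X.obj ≫ eA k n ⟶ Y.obj ≫ eA k n) :=
  (exists_corner i).choose

@[simp]
lemma corner_comp {X Y Z : (IsProj k n).FullSubcategory} (f : (wrQ E i).obj X ⟶ (wrQ E i).obj Y)
    (g : (wrQ E i).obj Y ⟶ (wrQ E i).obj Z) : corner i (f ≫ g) = corner i f ≫ corner i g :=
  (exists_corner i).choose_spec.1 f g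

@[simp]
lemma corner_wrQ {X Y : (IsProj k n).FullSubcategory} (f : X ⟶ Y) :
    corner i ((wrQ E i).map f) = f.hom ▷ eA k n :=
  (exists_corner i).choose_spec.2.1 f

lemma corner_wrX (z : E.Pos) (B : (IsB k n).FullSubcategory) :
    corner i (wrX i z B).hom = (gIso (isBalanced_comp_eA B.property) z.fst z.snd).hom :=
  (exists_corner i).choose_spec.2.2 z B

@[simp]
lemma corner_id (X : (IsProj k n).FullSubcategory) :
    corner i (𝟙 ((wrQ E i).obj X)) = 𝟙 (X.obj ≫ eA k n) := by
  rw [← CategoryTheory.Functor.map_id, corner_wrQ]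
  exact id_whiskerRight _ _

end Concrete

/-! ### Acting by `A e_l ⊗ e_0 A`, and stable ideals -/

section Concrete

variable {k : Type u} [Field k] {n : ℕ}
  {P : Finpartition (Finset.univ : Finset (Fin (n + 1)))} {E : BlockEnumeration P}
open Bim Alg

/-- Choose `x` with `g x ≠ 0` and a functional `φ` with `φ (g x) ≠ 0`. The first map sends `1` to
`x`, the second is `φ` divided by `φ (g x)`. -/
lemma Alg.exists_comp_eq_id {V W : ground k ⟶ ground k} {g : V ⟶ W} (hg : g ≠ 0) :
    ∃ (s : 𝟙 (ground k) ⟶ V) (t : W ⟶ 𝟙 (ground k)), s ≫ g ≫ t = 𝟙 _ := by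
  obtain ⟨x, hx⟩ : ∃ x, BiMod.Hom.lin g x ≠ 0 := by
    by_contra! h
    exact hg (BiMod.hom_ext h)
  obtain ⟨φ, hφ⟩ : ∃ φ : Module.Dual k (BiMod.V W), φ (BiMod.Hom.lin g x) ≠ 0 := by
    by_contra! h
    exact hx ((Module.forall_dual_apply_eq_zero_iff k _).1 h)
  refine ⟨groundHom (V := BiMod.regular k k) (W := V)
      ((LinearMap.toSpanSingleton k _ x) ∘ₗ (BiMod.ofReg k k).symm.toLinearMap),
    groundHom (V := W) (W := BiMod.regular k k) ((BiMod.ofReg k k).toLinearMap ∘ₗ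
      ((φ (BiMod.Hom.lin g x))⁻¹ • φ)), BiMod.hom_ext fun (c : k) => ?_⟩
  change (φ (BiMod.Hom.lin g x))⁻¹ * φ (BiMod.Hom.lin g (c • x)) = c
  rw [map_smul, map_smul, smul_eq_mul, mul_left_comm, inv_mul_cancel₀ hφ, mul_one]

variable (k) in
/-- The bimodule `A e_l ⊗_k e_0 A`, as a `1`-morphism. -/
def projB (l : Fin (n + 1)) : (IsB k n).FullSubcategory :=
  ⟨proj k l, InAdd.of_mem (G := gens k n) (some l)⟩

variable (k) in
/-- The module `A e_l ⊗_k (e_0 A ⊗_A X)`. -/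
def freeObj (l : Fin (n + 1)) (X : (IsProj k n).FullSubcategory) :
    (IsProj k n).FullSubcategory :=
  ⟨(X.obj ≫ eA k n) ≫ Ae k l,
    InAdd.of_iso (α_ _ _ _) (isProj_comp k n X.property (projB k l).property)⟩

variable (k) in
/-- The associativity constraint `(A e_l ⊗_k e_0 A) ⊗_A X ≅ A e_l ⊗_k (e_0 A ⊗_A X)`. -/
def actFreeObj (l : Fin (n + 1)) (X : (IsProj k n).FullSubcategory) :
    actObj k (projB k l) X ≅ freeObj k l X :=
  ObjectProperty.isoMk _ (α_ X.obj (eA k n) (Ae k l)).symm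

variable (k) in
/-- The map `A e_l ⊗_k g`. -/
def freeMap (l : Fin (n + 1)) {X Y : (IsProj k n).FullSubcategory}
    (g : X.obj ≫ eA k n ⟶ Y.obj ≫ eA k n) : freeObj k l X ⟶ freeObj k l Y :=
  ObjectProperty.homMk (g ▷ Ae k l)

/-- Acting by `A e_l ⊗ e_0 A` takes every bimodule into `N`, where the new isomorphisms have
prescribed values. -/
lemma isN_comp_proj {B : A k n ⟶ A k n} (hB : IsB k n B) (l : Fin (n + 1)) :
    IsN k n (B ≫ proj k l) := by
  refine (hB.map (postcomp _ (proj k l))).trans fun j => ?_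
  cases j with
  | none => exact InAdd.of_iso (λ_ (proj k l)) (InAdd.of_mem (G := proj k (n := n)) l)
  | some j => exact isN_proj_comp k n j (projB k l).property

lemma gIso_rho {S : Alg k} {B : A k n ⟶ A k n} {G : A k n ⟶ S} (hG : IsBalanced (B ≫ G))
    (i j : Fin n) : (gIso hG i j).hom ≫ (rho k j ▷ B) ▷ G = (rho k i ▷ B) ▷ G := by
  rw [← cancel_mono (α_ _ _ _).hom]
  simp only [gIso, Iso.trans_hom, Iso.symm_hom, Category.assoc, associator_naturality_left,
    Iso.inv_hom_id_assoc, gmap_rho]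

/-- Both sides agree after composition with the monomorphism induced by `rho k j`, by `smap_rho` and
`gIso_rho`. -/
lemma smap_comp_assoc {S : Alg k} {B : A k n ⟶ A k n} {G : A k n ⟶ S} {H : S ⟶ A k n}
    (hN : IsN k n (B ≫ G ≫ H)) (hG : IsBalanced (B ≫ G)) (i j : Fin n) :
    (α_ _ _ _).hom ≫ smap k i j hN ≫ (α_ _ _ _).inv ≫ (α_ _ _ _).inv =
      (α_ _ _ _).inv ≫ (gIso hG i j).hom ▷ H := by
  have := StarBirep.mono_rho j hN
  have h := congrArg (fun t => t ▷ H) (gIso_rho hG i j)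
  simp only [comp_whiskerRight _ _ H] at h
  rw [← cancel_epi (α_ _ _ _).inv, Iso.inv_hom_id_assoc, ← cancel_mono (α_ _ _ _).hom,
    ← cancel_mono (α_ _ _ _).hom, ← cancel_mono (rho k j ▷ (B ≫ G ≫ H))]
  simp only [Category.assoc, Iso.inv_hom_id, Category.comp_id, smap_rho]
  rw [← associator_naturality_left, ← associator_naturality_left_assoc, reassoc_of% h,
    associator_naturality_left_assoc, associator_naturality_left, Iso.inv_hom_id_assoc,
    Iso.inv_hom_id_assoc]

variable (i : StarB k n)

lemma wrQ_map_comp₃ {X Y Z W : (IsProj k n).FullSubcategory} (f : X ⟶ Y) (g : Y ⟶ Z)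
    (h : Z ⟶ W) : (wrQ E i).map (f ≫ g ≫ h) =
      (wrQ E i).map f ≫ (wrQ E i).map g ≫ (wrQ E i).map h := by
  rw [Functor.map_comp, Functor.map_comp]

variable (k) in
lemma freeMap_id (l : Fin (n + 1)) (X : (IsProj k n).FullSubcategory) :
    freeMap k l (𝟙 (X.obj ≫ eA k n)) = 𝟙 (freeObj k l X) :=
  ObjectProperty.hom_ext _ (id_whiskerRight _ _)

variable (k) in
lemma freeMap_comp (l : Fin (n + 1)) {X Y Z : (IsProj k n).FullSubcategory}
    (g : X.obj ≫ eA k n ⟶ Y.obj ≫ eA k n) (h : Y.obj ≫ eA k n ⟶ Z.obj ≫ eA k n) :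
    freeMap k l (g ≫ h) = freeMap k l g ≫ freeMap k l h :=
  ObjectProperty.hom_ext _ (comp_whiskerRight _ _ _)

/-- The action of a `1`-morphism on the morphisms of `C^{WR}`. -/
def wrAct (F : (IsB k n).FullSubcategory) {X Y : (IsProj k n).FullSubcategory} :
    ((wrQ E i).obj X ⟶ (wrQ E i).obj Y) →ₗ[k]
      ((wrQ E i).obj (actObj k F X) ⟶ (wrQ E i).obj (actObj k F Y)) :=
  (LinRep.act (wrConstruction k E).CWR (i := i) (j := i) F).mapLinearMap k
    (X := (wrQ E i).obj X) (Y := (wrQ E i).obj Y)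

lemma wrAct_comp (F : (IsB k n).FullSubcategory) {X Y Z : (IsProj k n).FullSubcategory}
    (f : (wrQ E i).obj X ⟶ (wrQ E i).obj Y) (g : (wrQ E i).obj Y ⟶ (wrQ E i).obj Z) :
    wrAct i F (f ≫ g) = wrAct i F f ≫ wrAct i F g :=
  (LinRep.act (wrConstruction k E).CWR (i := i) (j := i) F).map_comp f g

lemma wrAct_id (F : (IsB k n).FullSubcategory) (X : (IsProj k n).FullSubcategory) :
    wrAct i F (𝟙 ((wrQ E i).obj X)) = 𝟙 ((wrQ E i).obj (actObj k F X)) :=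
  (LinRep.act (wrConstruction k E).CWR (i := i) (j := i) F).map_id _

lemma wrAct_wrQ (F : (IsB k n).FullSubcategory) {X Y : (IsProj k n).FullSubcategory}
    (f : X ⟶ Y) : wrAct i F ((wrQ E i).map f) = (wrQ E i).map (actMap k F f) := rfl

lemma wrAct_wrX (F : (IsB k n).FullSubcategory) (z : E.Pos) (B : (IsB k n).FullSubcategory) :
    wrAct i F (wrX i z B).hom =
      (wrQ E i).map (actTheta k z.fst.succ B F).hom ≫
        (wrX i z ⟨B.obj ≫ F.obj, isB_comp k n B.property F.property⟩).hom ≫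
          (wrQ E i).map (actTheta k z.snd.succ B F).inv := act_wrX i F z B

/-- Acting by `A e_l ⊗_k e_0 A` factors through the corner functor. -/
lemma wrAct_projB (l : Fin (n + 1)) {X Y : (IsProj k n).FullSubcategory}
    (f : (wrQ E i).obj X ⟶ (wrQ E i).obj Y) :
    wrAct i (projB k l) f ≫ (wrQ E i).map (actFreeObj k l Y).hom =
    (wrQ E i).map (actFreeObj k l X).hom ≫ (wrQ E i).map (freeMap k l (corner i f)) := by
  -- On a forward generator the result of the action is the isomorphism at a bimodule of `N`. It is
  -- therefore the image of `smap`, which is `gIso` tensored with `A e_l`.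
  have fwd : ∀ (z : E.Pos) (B : (IsB k n).FullSubcategory),
      wrAct i (projB k l) (wrX i z B).hom ≫
      (wrQ E i).map (actFreeObj k l (thetaObj k z.snd.succ B)).hom =
    (wrQ E i).map (actFreeObj k l (thetaObj k z.fst.succ B)).hom ≫
      (wrQ E i).map (freeMap k l (corner i (wrX i z B).hom)) := by
    intro z B
    have h := wrX_of_isN (E := E) i z ⟨B.obj ≫ proj k l, isN_comp_proj B.property l⟩
    rw [corner_wrX, wrAct_wrX]
    refine (congrArg (fun t => (_ ≫ t ≫ _) ≫ _) h).trans ?_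
    refine (congrArg (fun t => t ≫ _) (wrQ_map_comp₃ i _ _ _).symm).trans ?_
    refine ((wrQ E i).map_comp _ _).symm.trans (Eq.trans ?_ ((wrQ E i).map_comp _ _))
    refine congrArg (wrQ E i).map (ObjectProperty.hom_ext _ ?_)
    refine Eq.trans ?_ (smap_comp_assoc (G := eA k n) (H := Ae k l)
      (isN_comp_proj B.property l) (isBalanced_comp_eA B.property) z.fst z.snd)
    exact (Category.assoc _ _ _).trans (congrArg _ (Category.assoc _ _ _))
  refine wr_induction i (motive := fun {X Y} f =>
    wrAct i (projB k l) f ≫ (wrQ E i).map (actFreeObj k l Y).hom =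
    (wrQ E i).map (actFreeObj k l X).hom ≫ (wrQ E i).map (freeMap k l (corner i f)))
    ?_ fwd ?_ ?_ ?_ ?_ f
  · intro X Y f
    rw [wrAct_wrQ, corner_wrQ, ← Functor.map_comp, ← Functor.map_comp]
    exact congrArg _ (ObjectProperty.hom_ext _ (associator_inv_naturality_left _ _ _))
  · intro z B
    -- The backward square is the forward one multiplied on either side by the two inverse images.
    have h₂ : wrAct i (projB k l) (wrX i z B).inv ≫ wrAct i (projB k l) (wrX i z B).hom =
        𝟙 _ := by
      rw [← wrAct_comp, Iso.inv_hom_id, wrAct_id]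
    have h₃ : (wrQ E i).map (freeMap k l (corner i (wrX i z B).hom)) ≫
        (wrQ E i).map (freeMap k l (corner i (wrX i z B).inv)) = 𝟙 _ := by
      rw [← Functor.map_comp, ← freeMap_comp, ← corner_comp, Iso.hom_inv_id, corner_id,
        freeMap_id, CategoryTheory.Functor.map_id]
    have h₄ := congrArg (fun t => wrAct i (projB k l) (wrX i z B).inv ≫ t ≫
      (wrQ E i).map (freeMap k l (corner i (wrX i z B).inv))) (fwd z B)
    simp only [Category.assoc, h₃, reassoc_of% h₂, Category.comp_id] at h₄
    exact h₄.symm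
  · intro X Y Z f g hf hg
    rw [wrAct_comp, Category.assoc, hg, reassoc_of% hf, corner_comp, freeMap_comp,
      Functor.map_comp]
  · intro X Y f g hf hg
    have : freeMap k l (corner i f + corner i g) =
        freeMap k l (corner i f) + freeMap k l (corner i g) :=
      ObjectProperty.hom_ext _ (whiskerRight_add _ _ _)
    rw [map_add, map_add, this, Preadditive.add_comp, Functor.map_add, Preadditive.comp_add, hf, hg]
  · intro X Y c f hf
    have : freeMap k l (c • corner i f) = c • freeMap k l (corner i f) :=
      ObjectProperty.hom_ext _ (whiskerRight_smul _ _ _)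
    rw [map_smul, map_smul, this, Linear.smul_comp, Functor.map_smul, Linear.comp_smul, hf]

variable (k) in
/-- The module `A e_l`. -/
def AeObj (l : Fin (n + 1)) : (IsProj k n).FullSubcategory := ⟨Ae k l, isProj_Ae k n l⟩

/-- The morphisms in a stable ideal. -/
def wrIdeal (I : (wrConstruction k E).CWR.StableIdeal) (X Y : (IsProj k n).FullSubcategory) :
    Submodule k ((wrQ E i).obj X ⟶ (wrQ E i).obj Y) := I.hom i ((wrQ E i).obj X) ((wrQ E i).obj Y)

lemma wrIdeal_comp (I : (wrConstruction k E).CWR.StableIdeal)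
    {X Y Z W : (IsProj k n).FullSubcategory} (f : (wrQ E i).obj X ⟶ (wrQ E i).obj Y)
    {g : (wrQ E i).obj Y ⟶ (wrQ E i).obj Z} (h : (wrQ E i).obj Z ⟶ (wrQ E i).obj W)
    (hg : g ∈ wrIdeal i I Y Z) : f ≫ g ≫ h ∈ wrIdeal i I X W :=
  I.precomp_mem f (I.postcomp_mem h hg)

lemma wrIdeal_act (I : (wrConstruction k E).CWR.StableIdeal) (F : (IsB k n).FullSubcategory)
    {X Y : (IsProj k n).FullSubcategory} {f : (wrQ E i).obj X ⟶ (wrQ E i).obj Y}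
    (hf : f ∈ wrIdeal i I X Y) : wrAct i F f ∈ wrIdeal i I (actObj k F X) (actObj k F Y) :=
  I.act_mem (i := i) (j := i) F (X := (wrQ E i).obj X) (Y := (wrQ E i).obj Y) (f := f) hf

/-- A stable ideal that contains a morphism with nonzero image under the corner functor contains
the identities of the modules `A e_l`. -/
lemma id_mem_of_corner_ne_zero (I : (wrConstruction k E).CWR.StableIdeal)
    {X Y : (IsProj k n).FullSubcategory} {f : (wrQ E i).obj X ⟶ (wrQ E i).obj Y}
    (hf : f ∈ wrIdeal i I X Y) (h : corner i f ≠ 0) (l : Fin (n + 1)) :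
    𝟙 ((wrQ E i).obj (AeObj k l)) ∈ wrIdeal i I (AeObj k l) (AeObj k l) := by
  -- The corner of `f` is a nonzero linear map, so the identity of `k` factors through it. Tensoring
  -- with `A e_l` makes the identity of `A e_l` factor through the image of `f` under `projB k l`,
  -- which lies in the ideal.
  obtain ⟨s, t, hst⟩ := exists_comp_eq_id h
  have h₂ := wrIdeal_comp i I ((wrQ E i).map (actFreeObj k l X).inv)
    ((wrQ E i).map (actFreeObj k l Y).hom) (wrIdeal_act i I (projB k l) hf)
  rw [wrAct_projB, ← Functor.map_comp_assoc, Iso.inv_hom_id, CategoryTheory.Functor.map_id,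
    Category.id_comp] at h₂
  let s' : AeObj k l ⟶ freeObj k l X := ObjectProperty.homMk ((λ_ (Ae k l)).inv ≫ s ▷ Ae k l)
  let t' : freeObj k l Y ⟶ AeObj k l := ObjectProperty.homMk (t ▷ Ae k l ≫ (λ_ (Ae k l)).hom)
  have h₃ : s' ≫ freeMap k l (corner i f) ≫ t' = 𝟙 _ := ObjectProperty.hom_ext _ (by
    change ((λ_ (Ae k l)).inv ≫ s ▷ Ae k l) ≫ corner i f ▷ Ae k l ≫ t ▷ Ae k l ≫
      (λ_ (Ae k l)).hom = 𝟙 _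
    have := congrArg (fun t => t ▷ Ae k l) hst
    simp only [comp_whiskerRight, id_whiskerRight] at this
    simp [reassoc_of% this])
  have h₄ := wrIdeal_comp i I ((wrQ E i).map s') ((wrQ E i).map t') h₂
  rwa [← wrQ_map_comp₃, h₃, CategoryTheory.Functor.map_id] at h₄

end Concrete

/-! ### Products with basis elements of the algebra -/

namespace StarAlg

variable {k : Type u} [Field k] {n : ℕ}

lemma sum_smul_arrA (v : Fin n → k) : ∑ t, v t • arrA k t = ⟨0, 0, v, 0, 0⟩ := by
  apply (coords (k := k) (n := n)).injective
  rw [map_sum]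
  refine Prod.ext ?_ (Prod.ext ?_ (Prod.ext ?_ (Prod.ext ?_ ?_))) <;>
    simp [coords, arrA, Prod.fst_sum, Prod.snd_sum]
  funext j
  simp [Finset.sum_apply, Pi.single_apply]

lemma sum_smul_arrB (v : Fin n → k) : ∑ t, v t • arrB k t = ⟨0, 0, 0, v, 0⟩ := by
  apply (coords (k := k) (n := n)).injective
  rw [map_sum]
  refine Prod.ext ?_ (Prod.ext ?_ (Prod.ext ?_ (Prod.ext ?_ ?_))) <;>
    simp [coords, arrB, Prod.fst_sum, Prod.snd_sum]
  funext j
  simp [Finset.sum_apply, Pi.single_apply]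

variable (s : StarAlg k n)

lemma mul_arrA (t : Fin n) : s * arrA k t = s.x t • arrA k t + s.b t • arrC k n := by
  ext l <;> simp [arrA, arrC, Pi.single_apply]
  split_ifs with h <;> simp [h]

lemma mul_arrC : s * arrC k n = s.x₀ • arrC k n := by
  ext l <;> simp [arrC]

lemma arrC_mul : arrC k n * s = s.x₀ • arrC k n := by
  ext l <;> simp [arrC]

lemma arrB_mul (t : Fin n) : arrB k t * s = s.a t • arrC k n + s.x t • arrB k t := by
  ext l <;> simp [arrB, arrC, Pi.single_apply]
  split_ifs with h <;> simp [h]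

lemma mul_e_zero : s * e k n 0 = s.x₀ • e k n 0 + ∑ t, s.a t • arrA k t + s.c • arrC k n := by
  rw [sum_smul_arrA]
  ext l <;> simp [arrC, e_zero_def]

lemma e_zero_mul : e k n 0 * s = s.x₀ • e k n 0 + ∑ t, s.b t • arrB k t + s.c • arrC k n := by
  rw [sum_smul_arrB]
  ext l <;> simp [arrC, e_zero_def]

end StarAlg

/-! ### Homomorphisms between the modules `A e_j`, and bimodule maps between `A` and `A e_0 ⊗ e_0 A`
-/

section AeHom

variable {k : Type u} [Field k] {n : ℕ}
open Bim Alg BiMod StarAlg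

variable (k) in
/-- Right multiplication by `b_j`, as a morphism `A e_0 ⟶ A e_j`. -/
def bHat (j : Fin n) : Ae k (0 : Fin (n + 1)) ⟶ Ae k j.succ :=
  rightMul (e k n 0) (e k n j.succ) (arrB k j) (arrB_mul_e k j)

/-- A left module map out of `A e_i` is right multiplication by the image of `e_i`. -/
lemma exists_eq_rightMul {i j : Fin (n + 1)} (f : Ae k i ⟶ Ae k j) :
    ∃ (y : StarAlg k n) (hy : y * e k n j = y), e k n i * y = y ∧
      f = rightMul (e k n i) (e k n j) y hy := by
  let g : leftIdeal k (e k n i) ⟶ leftIdeal k (e k n j) := f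
  let y := leftVal _ (BiMod.Hom.lin g (leftMk _ _ (e_mul_self k i)))
  have h : ∀ x, leftVal (k := k) _ (BiMod.Hom.lin g x) = leftVal _ x * y := by
    intro x
    have hx : x = (leftIdeal k (e k n i)).lact (leftVal _ x) (leftMk _ _ (e_mul_self k i)) :=
      leftVal_injective (k := k) _ (leftVal_mul _ (e_mul_self k i) x).symm
    conv_lhs => rw [hx, Hom.map_l]
    rfl
  refine ⟨y, leftVal_mul _ (e_mul_self k j) _, (h (leftMk _ _ (e_mul_self k i))).symm, ?_⟩
  exact BiMod.hom_ext fun x => leftVal_injective (k := k) _ (h x)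

/-- The space `e_0 A e_j` is spanned by `b_j`. The next three lemmas similarly use that `e_j A e_0`
is spanned by `a_j`, that `e_j A e_j` is spanned by `e_j` because the loop at a leaf is zero, and
that `e_i A e_j = 0` for distinct leaves. -/
lemma exists_eq_smul_bHat {j : Fin n} (f : Ae k 0 ⟶ Ae k j.succ) : ∃ c : k, f = c • bHat k j := by
  obtain ⟨y, hy, hy', rfl⟩ := exists_eq_rightMul f
  refine ⟨y.b j, BiMod.hom_ext fun x => leftVal_injective (k := k) _ ?_⟩
  change leftVal _ x * y = y.b j • (leftVal _ x * arrB k j)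
  rw [← mul_smul_comm]
  congr 1
  rw [← hy, ← hy']
  ext l <;> simp [e_zero_def, e_succ_def, arrB, Pi.single_apply]
  split_ifs with h <;> simp [h]

lemma exists_eq_smul_rho {j : Fin n} (f : Ae k j.succ ⟶ Ae k 0) : ∃ c : k, f = c • rho k j := by
  obtain ⟨y, hy, hy', rfl⟩ := exists_eq_rightMul f
  refine ⟨y.a j, BiMod.hom_ext fun x => leftVal_injective (k := k) _ ?_⟩
  change leftVal _ x * y = y.a j • (leftVal _ x * arrA k j)
  rw [← mul_smul_comm]
  congr 1
  rw [← hy', ← hy]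
  ext l <;> simp [e_zero_def, e_succ_def, arrA, Pi.single_apply]
  split_ifs with h <;> simp [h]

lemma exists_eq_smul_id {j : Fin n} (f : Ae k j.succ ⟶ Ae k j.succ) : ∃ c : k, f = c • 𝟙 _ := by
  obtain ⟨y, hy, hy', rfl⟩ := exists_eq_rightMul f
  refine ⟨y.x j, BiMod.hom_ext fun x => leftVal_injective (k := k) _ ?_⟩
  change leftVal _ x * y = y.x j • (leftVal _ x)
  have hx := leftVal_mul _ (e_mul_self k j.succ) x
  conv_rhs => rw [← hx, ← mul_smul_comm]
  congr 1
  rw [← hy', ← hy]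
  ext l <;> simp [e_zero_def, e_succ_def, Pi.single_apply]
  split_ifs with h <;> simp [h]

lemma Ae_hom_eq_zero {i j : Fin n} (hij : i ≠ j) (f : Ae k i.succ ⟶ Ae k j.succ) : f = 0 := by
  obtain ⟨y, hy, hy', rfl⟩ := exists_eq_rightMul f
  refine BiMod.hom_ext fun x => leftVal_injective (k := k) _ ?_
  change leftVal _ x * y = 0
  have : y = 0 := by
    rw [← hy', ← hy]
    ext l <;> simp [e_zero_def, e_succ_def, Pi.single_apply]
    rintro rfl rfl
    exact absurd rfl hij
  rw [this, mul_zero]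

/-- The corner functor is faithful on morphisms between the modules `A e_i`. -/
lemma Ae_hom_eq_zero_of_whiskerRight {i j : Fin (n + 1)} (f : Ae k i ⟶ Ae k j)
    (hf : f ▷ eA k n = 0) : f = 0 := by
  obtain ⟨y, hy, hy', rfl⟩ := exists_eq_rightMul f
  -- Multiplying out tensors turns the hypothesis into `e_0 A y = 0`.
  let m : (tensor (rightIdeal k (e k n 0)) (leftIdeal k (e k n j))).V →ₗ[k] StarAlg k n :=
    tlift ((LinearMap.mul k (StarAlg k n)).compl₁₂ (rightVal _) (leftVal _))
      (fun s v x => by simp [mul_assoc])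
  have key : ∀ p : StarAlg k n, e k n 0 * p * y = 0 := by
    intro p
    let v : (rightIdeal k (e k n 0)).V :=
      rightMk _ (e k n 0 * p) (by rw [← mul_assoc, e_mul_self])
    let x : (leftIdeal k (e k n i)).V := leftMk _ _ (e_mul_self k i)
    have h₁ : Hom.lin (tensorHom (𝟙 (rightIdeal k (e k n 0)))
        (rightMul (e k n i) (e k n j) y hy)) (tm _ _ v x) = 0 :=
      LinearMap.congr_fun (congrArg Hom.lin hf) (tm _ _ v x)
    rw [tensorHom_tm] at h₁
    have h₂ := congrArg m h₁
    rw [map_zero, tlift_tm] at h₂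
    simpa [v, x, hy'] using h₂
  refine BiMod.hom_ext fun x => leftVal_injective (k := k) _ ?_
  change leftVal _ x * y = 0
  suffices y = 0 by rw [this, mul_zero]
  induction i using Fin.cases with
  -- For `i = 0` take `p = e_0`, since `e_0 y = y`. For a leaf take `p = b_i`: the product `b_i y`
  -- has coordinate `y.x i` at `b_i` and `y.a i` at `c`, and these are the only coordinates that `y`
  -- in `e_i A` can have.
  | zero => simpa [hy', e_mul_self] using key (e k n 0)
  | succ i =>
    have h := key (arrB k i)
    rw [e_mul_arrB, arrB_mul] at h
    have hc := congrArg StarAlg.c h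
    have hb := congrArg (fun z => z.b i) h
    simp only [arrB, arrC, add_c, smul_c, zero_c, mul_one, mul_zero, add_zero] at hc
    simp [arrB, arrC] at hb
    rw [← hy']
    ext l <;> simp [e_succ_def, Pi.single_apply]
    · rintro rfl; exact hb
    · rintro rfl; exact hc

variable (k) in
/-- The element `e_0 ⊗ b_j` of `e_0 A ⊗_A A e_j`, as a morphism. -/
def cBM (j : Fin n) :
    regular k k ⟶ tensor (rightIdeal k (e k n 0)) (leftIdeal k (e k n j.succ)) :=
  groundHom (V := BiMod.regular k k)
    (W := tensor (rightIdeal k (e k n 0)) (leftIdeal k (e k n j.succ)))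
    (LinearMap.toSpanSingleton k _ (ctmB k j) ∘ₗ (ofReg k k).symm.toLinearMap)

variable (k) in
/-- The element `e_0 ⊗ b_j` of `e_0 A ⊗_A A e_j`, as a morphism. -/
def cB (j : Fin n) : 𝟙 (ground k) ⟶ Ae k j.succ ≫ eA k n := cBM k j

/-- Both composites send `1` to `e_0 ⊗ c`, because `b_i a_i = c` for every leaf. -/
lemma cB_rho (i j : Fin n) : cB k i ≫ rho k i ▷ eA k n = cB k j ≫ rho k j ▷ eA k n := by
  have h : ∀ i : Fin n, Hom.lin (tensorHom (𝟙 (rightIdeal k (e k n 0))) (rhoM k i)) (ctmB k i) =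
      ctm k (e k n 0) (rightMk _ _ (e_mul_self k 0)) (leftMk _ (arrC k n) (arrC_mul_e k)) := by
    intro i
    rw [ctmB, rhoM_tm]
    congr 1
    exact leftVal_injective (k := k) _ (arrB_mul_arrA k i)
  refine BiMod.hom_ext fun (c : k) => ?_
  change Hom.lin (tensorHom (𝟙 (rightIdeal k (e k n 0))) (rhoM k i)) (c • ctmB k i) =
    Hom.lin (tensorHom (𝟙 (rightIdeal k (e k n 0))) (rhoM k j)) (c • ctmB k j)
  rw [map_smul, map_smul, h, h]

variable (k) in
/-- The map `A e_0 ⟶ (A e_0 ⊗_k e_0 A) ⊗_A A e_j`, `v ↦ v ⊗ e_0 ⊗ b_j`. -/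
def bTilde (j : Fin n) : Ae k (0 : Fin (n + 1)) ⟶ Ae k j.succ ≫ proj k (0 : Fin (n + 1)) :=
  (λ_ _).inv ≫ cB k j ▷ Ae k 0 ≫ (α_ (Ae k j.succ) (eA k n) (Ae k 0)).hom

lemma bTilde_rho (i j : Fin n) : bTilde k i ≫ rho k i ▷ proj k 0 = bTilde k j ≫ rho k j ▷ proj k 0 := by
  have h : ∀ i : Fin n, bTilde k i ≫ rho k i ▷ proj k 0 =
      (λ_ _).inv ≫ (cB k i ≫ rho k i ▷ eA k n) ▷ Ae k 0 ≫ (α_ _ (eA k n) (Ae k 0)).hom := by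
    intro i
    rw [comp_whiskerRight, Category.assoc, associator_naturality_left, bTilde]
    exact (Category.assoc _ _ _).trans (congrArg _ (Category.assoc _ _ _))
  rw [h, h, cB_rho i j]

/-- `smap` is determined by compatibility with `rho`, and all the elements `e_0 ⊗ b_j` have the same
image there. -/
lemma bTilde_smap (i j : Fin n) (h : IsN k n (proj k (0 : Fin (n + 1)))) :
    bTilde k i ≫ smap k i j h = bTilde k j := by
  have := StarBirep.mono_rho j h
  rw [← cancel_mono (rho k j ▷ proj k 0), Category.assoc, smap_rho, bTilde_rho i j]

variable (k n) in
/-- The multiplication `A e_0 ⊗_k e_0 A ⟶ A`. -/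
def mulProjM : tensor (leftIdeal k (e k n 0)) (rightIdeal k (e k n 0)) ⟶
    regular k (StarAlg k n) :=
  homLift (M := leftIdeal k (e k n 0)) (N := rightIdeal k (e k n 0))
    (L := regular k (StarAlg k n))
    (((LinearMap.mul k (StarAlg k n)).compl₁₂ (leftVal _) (rightVal _)).compr₂
      (ofReg k (StarAlg k n)).toLinearMap)
    (fun s u w => by simp [ground_lact]) (fun s u w => by simp [mul_assoc])
    (fun s u w => by simp [mul_assoc])

variable (k n) in
/-- The multiplication `A e_0 ⊗_k e_0 A ⟶ A`. -/
def mulProj : proj k (0 : Fin (n + 1)) ⟶ 𝟙 (A k n) := mulProjM k n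

lemma mulProjM_tm (u : (leftIdeal k (e k n 0)).V) (w : (rightIdeal k (e k n 0)).V) :
    Hom.lin (mulProjM k n) (tm (leftIdeal k (e k n 0)) (rightIdeal k (e k n 0)) u w) =
      ofReg k (StarAlg k n) (leftVal _ u * rightVal _ w) :=
  homLift_tm (M := leftIdeal k (e k n 0)) (N := rightIdeal k (e k n 0))
    (L := regular k (StarAlg k n)) _ _ _ _ u w

/-- On elements this is `v ↦ v ⊗ e_0 ⊗ b_j ↦ v e_0 b_j = v b_j`. It exhibits right multiplication by
`b_j` as a map through a bimodule of `N`, where the new isomorphisms are known. -/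
lemma bTilde_mulProj (j : Fin n) :
    bTilde k j ≫ Ae k j.succ ◁ mulProj k n ≫ (ρ_ _).hom = bHat k j := by
  have h₁ : ∀ v : (leftIdeal k (e k n 0)).V, Hom.lin (tensorHom (𝟙 (leftIdeal k (e k n 0)))
      (cBM k j))
      (tm (leftIdeal k (e k n 0)) (regular k k) v (ofReg k k 1)) =
      tm (leftIdeal k (e k n 0)) (tensor (rightIdeal k (e k n 0)) (leftIdeal k (e k n j.succ))) v
        (ctmB k j) := by
    intro v
    rw [tensorHom_tm]
    exact congrArg _ (one_smul k (ctmB k j))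
  have h₂ : ∀ v : (leftIdeal k (e k n 0)).V, Hom.lin (leftUnitHom (leftIdeal k (e k n j.succ)))
      (Hom.lin (tensorHom (mulProjM k n) (𝟙 (leftIdeal k (e k n j.succ))))
        (Hom.lin (assocInv (leftIdeal k (e k n 0)) (rightIdeal k (e k n 0))
          (leftIdeal k (e k n j.succ))) (tm (leftIdeal k (e k n 0)) (tensor (rightIdeal k (e k n 0))
            (leftIdeal k (e k n j.succ))) v (ctmB k j)))) =
      Hom.lin (rightMul (e k n 0) (e k n j.succ) (arrB k j) (arrB_mul_e k j)) v := by
    intro v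
    rw [ctmB, assocInv_tm, tensorHom_tm, leftUnitHom_tm, mulProjM_tm]
    refine leftVal_injective (k := k) _ ?_
    rw [leftVal_lact, leftVal_rightMul]
    change leftVal _ v * e k n 0 * arrB k j = _
    rw [mul_assoc, e_mul_arrB]
  exact BiMod.hom_ext fun v => (congrArg (fun z => Hom.lin (leftUnitHom (leftIdeal k (e k n j.succ)))
      (Hom.lin (tensorHom (mulProjM k n) (𝟙 (leftIdeal k (e k n j.succ))))
        (Hom.lin (assocInv (leftIdeal k (e k n 0)) (rightIdeal k (e k n 0))
          (leftIdeal k (e k n j.succ))) z))) (h₁ v)).trans (h₂ v)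

section Comult

variable (k n)

/-- The tensors `u e_0 ⊗ e_0 w` in `A e_0 ⊗_k e_0 A`. -/
def cornerTensor : StarAlg k n →ₗ[k] StarAlg k n →ₗ[k]
    (tensor (leftIdeal k (e k n 0)) (rightIdeal k (e k n 0))).V :=
  (tm (leftIdeal k (e k n 0)) (rightIdeal k (e k n 0))).compl₁₂
    (LinearMap.mulRight k (e k n 0)).rangeRestrict (LinearMap.mulLeft k (e k n 0)).rangeRestrict

variable {k n} in
lemma lact_cornerTensor (s u w : StarAlg k n) :
    (tensor (leftIdeal k (e k n 0)) (rightIdeal k (e k n 0))).lact s (cornerTensor k n u w) =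
      cornerTensor k n (s * u) w := by
  refine (tensor_lact_tm _ _ _ _ _).trans ?_
  refine congrArg (fun z => tm (leftIdeal k (e k n 0)) (rightIdeal k (e k n 0)) z _) ?_
  exact leftVal_injective (k := k) _ (mul_assoc _ _ _).symm

variable {k n} in
lemma ract_cornerTensor (s u w : StarAlg k n) :
    (tensor (leftIdeal k (e k n 0)) (rightIdeal k (e k n 0))).ract (op s)
      (cornerTensor k n u w) = cornerTensor k n u (w * s) := by
  refine (tensor_ract_tm _ _ _ _ _).trans ?_
  refine congrArg (fun z => tm (leftIdeal k (e k n 0)) (rightIdeal k (e k n 0)) _ z) ?_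
  exact rightVal_injective (k := k) _ (mul_assoc _ _ _)

/-- The element `∑ a_t ⊗ b_t + e_0 ⊗ c + c ⊗ e_0`. -/
def casimir : (tensor (leftIdeal k (e k n 0)) (rightIdeal k (e k n 0))).V :=
  ∑ t, cornerTensor k n (arrA k t) (arrB k t) + cornerTensor k n (e k n 0) (arrC k n) +
    cornerTensor k n (arrC k n) (e k n 0)

/-- Expanding by the multiplication table gives the same sum on both sides. For instance `s • ∑ a_t
⊗ b_t` produces terms `c ⊗ b_t`, which on the right come from `c ⊗ e_0 s`. This centrality makes `1
↦ casimir k n` a bimodule map. -/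
lemma lact_casimir (s : StarAlg k n) :
    (tensor (leftIdeal k (e k n 0)) (rightIdeal k (e k n 0))).lact s (casimir k n) =
      (tensor (leftIdeal k (e k n 0)) (rightIdeal k (e k n 0))).ract (op s) (casimir k n) := by
  simp only [casimir, map_add, map_sum, lact_cornerTensor, ract_cornerTensor, mul_arrA, mul_arrC,
    mul_e_zero, arrB_mul, arrC_mul, e_zero_mul, LinearMap.add_apply, LinearMap.sum_apply,
    map_smul, LinearMap.smul_apply, Finset.sum_add_distrib]
  abel

/-- The comultiplication `A ⟶ A e_0 ⊗_k e_0 A`. -/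
def comulProjM :
    regular k (StarAlg k n) ⟶ tensor (leftIdeal k (e k n 0)) (rightIdeal k (e k n 0)) :=
  ⟨((tensor (leftIdeal k (e k n 0)) (rightIdeal k (e k n 0))).lact.toLinearMap.flip
      (casimir k n)) ∘ₗ (ofReg k (StarAlg k n)).symm.toLinearMap,
    fun s x => by simp [regular_lact'], fun s x => by
      simp only [regular_ract', LinearMap.comp_apply, LinearEquiv.coe_coe,
        LinearEquiv.symm_apply_apply, LinearMap.flip_apply, AlgHom.toLinearMap_apply, map_mul,
        Module.End.mul_apply]
      rw [lact_casimir, BiMod.comm]; rfl⟩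

/-- The comultiplication `A ⟶ A e_0 ⊗_k e_0 A`. -/
def comulProj : 𝟙 (A k n) ⟶ proj k (0 : Fin (n + 1)) := comulProjM k n

/-- The map `e_0 A ⊗_A A e_0 ⟶ k` that sends `w ⊗ x` to the coefficient of `c` in `w x`. -/
def cCoeffM :
    tensor (rightIdeal k (e k n 0)) (leftIdeal k (e k n 0)) ⟶ regular k k :=
  homLift (M := rightIdeal k (e k n 0)) (N := leftIdeal k (e k n 0)) (L := regular k k)
    (LinearMap.mk₂ k (fun v y => ofReg k k (rightVal _ v * leftVal _ y).c)
      (fun _ _ _ => by rw [map_add, add_mul, StarAlg.add_c, map_add])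
      (fun _ _ _ => by rw [map_smul, smul_mul_assoc, StarAlg.smul_c, ← smul_eq_mul, map_smul])
      (fun _ _ _ => by rw [map_add, mul_add, StarAlg.add_c, map_add])
      (fun _ _ _ => by rw [map_smul, mul_smul_comm, StarAlg.smul_c, ← smul_eq_mul, map_smul]))
    (fun s m x => by
      simp only [LinearMap.mk₂_apply, rightVal_ract, leftVal_lact, unop_op, mul_assoc])
    (fun t m x => by
      simp only [LinearMap.mk₂_apply, rightVal_lact, smul_mul_assoc, StarAlg.smul_c,
        regular_lact])
    (fun t m x => by
      simp only [LinearMap.mk₂_apply, leftVal_ract, mul_smul_comm, StarAlg.smul_c, regular_ract,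
        mul_comm])

lemma cCoeffM_tm (v : (rightIdeal k (e k n 0)).V) (x : (leftIdeal k (e k n 0)).V) :
    Hom.lin (cCoeffM k n) (tm (rightIdeal k (e k n 0)) (leftIdeal k (e k n 0)) v x) =
      ofReg k k (rightVal _ v * leftVal _ x).c :=
  homLift_tm (M := rightIdeal k (e k n 0)) (N := leftIdeal k (e k n 0)) (L := regular k k)
    _ _ _ _ v x

/-- The map `e_0 A ⊗_A A e_0 ⟶ k` that sends `w ⊗ x` to the coefficient of `c` in `w x`. -/
def cCoeff : Ae k (0 : Fin (n + 1)) ≫ eA k n ⟶ 𝟙 (ground k) := cCoeffM k n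

/-- The map `(A e_0 ⊗_k e_0 A) ⊗_A A e_0 ⟶ A e_0` that sends `u ⊗ w ⊗ x` to `γ • u`, where `γ` is
the coefficient of `c` in `w x`. -/
def evalProj : Ae k (0 : Fin (n + 1)) ≫ proj k (0 : Fin (n + 1)) ⟶ Ae k (0 : Fin (n + 1)) :=
  (α_ (Ae k 0) (eA k n) (Ae k 0)).inv ≫ cCoeff k n ▷ Ae k 0 ≫ (λ_ _).hom

/-- The linear map underlying `evalProj`. -/
def evalProjLin : (tensor (tensor (leftIdeal k (e k n 0)) (rightIdeal k (e k n 0)))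
    (leftIdeal k (e k n 0))).V →ₗ[k] (leftIdeal k (e k n 0)).V :=
  Hom.lin (rightUnit (leftIdeal k (e k n 0))).hom ∘ₗ
    Hom.lin (tensorHom (𝟙 (leftIdeal k (e k n 0))) (cCoeffM k n)) ∘ₗ
    Hom.lin (assocHom (leftIdeal k (e k n 0)) (rightIdeal k (e k n 0)) (leftIdeal k (e k n 0)))

lemma evalProjLin_tm (u : (leftIdeal k (e k n 0)).V) (w : (rightIdeal k (e k n 0)).V)
    (v : (leftIdeal k (e k n 0)).V) :
    evalProjLin k n (tm (tensor (leftIdeal k (e k n 0)) (rightIdeal k (e k n 0)))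
      (leftIdeal k (e k n 0)) (tm (leftIdeal k (e k n 0)) (rightIdeal k (e k n 0)) u w) v) =
    (rightVal _ w * leftVal _ v).c • u := by
  rw [evalProjLin, LinearMap.comp_apply, LinearMap.comp_apply, assocHom_tm, tensorHom_tm,
    cCoeffM_tm, rightUnit_hom_tm]
  rfl

lemma evalProjLin_cornerTensor (u w : StarAlg k n) (v : (leftIdeal k (e k n 0)).V) :
    evalProjLin k n (tm (tensor (leftIdeal k (e k n 0)) (rightIdeal k (e k n 0)))
      (leftIdeal k (e k n 0)) (cornerTensor k n u w) v) =
    (e k n 0 * w * leftVal _ v).c •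
      leftMk (e k n 0) (u * e k n 0) (by rw [mul_assoc, e_mul_self]) :=
  evalProjLin_tm k n _ _ v

/-- Taking the `c`-coefficient of `w v` pairs `b_t` with the `a_t`-coordinate of `v`, `c` with the
`e_0`-coordinate, and `e_0` with the `c`-coordinate. The Casimir element is built from these dual
bases, so the sum reproduces `v`. -/
lemma evalProjLin_casimir (v : (leftIdeal k (e k n 0)).V) :
    evalProjLin k n (tm (tensor (leftIdeal k (e k n 0)) (rightIdeal k (e k n 0)))
      (leftIdeal k (e k n 0)) (casimir k n) v) = v := by
  simp only [casimir, map_add, map_sum, LinearMap.add_apply, LinearMap.sum_apply,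
    evalProjLin_cornerTensor]
  refine leftVal_injective (k := k) _ ?_
  have hv := leftVal_mul _ (e_mul_self k 0) v
  simp only [map_add, map_sum, map_smul, leftVal_mk, arrA_mul_e, arrC_mul_e, e_mul_self, e_mul_arrB,
    e_mul_arrC]
  generalize leftVal _ v = p at hv ⊢
  conv_rhs => rw [← hv, mul_e_zero]
  have h : ∀ t, (arrB k t * p).c = p.a t := fun t => by rw [arrB_mul]; simp [arrC, arrB]
  have h' : (arrC k n * p).c = p.x₀ := by rw [arrC_mul]; simp [arrC]
  have h'' : (e k n 0 * p).c = p.c := by simp [e_zero_def]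
  simp only [h, h', h'']
  abel

/-- This factors the identity of `A e_0` through a bimodule of `N`. It is used to see how the new
isomorphisms interact with the maps `rho`. -/
lemma comulProj_evalProj :
    (ρ_ (Ae k (0 : Fin (n + 1)))).inv ≫ Ae k 0 ◁ comulProj k n ≫ evalProj k n = 𝟙 _ := by
  have h₃ : ∀ v : (leftIdeal k (e k n 0)).V,
      Hom.lin (tensorHom (comulProjM k n) (𝟙 (leftIdeal k (e k n 0))))
        (tm (regular k (StarAlg k n)) (leftIdeal k (e k n 0)) (ofReg k _ 1) v) =
      tm (tensor (leftIdeal k (e k n 0)) (rightIdeal k (e k n 0))) (leftIdeal k (e k n 0))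
        (casimir k n) v := by
    intro v
    rw [tensorHom_tm]
    refine congrArg (fun z => tm (tensor (leftIdeal k (e k n 0)) (rightIdeal k (e k n 0)))
      (leftIdeal k (e k n 0)) z v) ?_
    change (tensor (leftIdeal k (e k n 0)) (rightIdeal k (e k n 0))).lact 1 (casimir k n) = _
    rw [map_one]; rfl
  exact BiMod.hom_ext fun v => (congrArg (evalProjLin k n) (h₃ v)).trans
    (evalProjLin_casimir k n v)

end Comult

end AeHom

/-! ### Normal form for the morphisms of the explicit model -/

section Concrete

variable {k : Type u} [Field k] {n : ℕ}
  {P : Finpartition (Finset.univ : Finset (Fin (n + 1)))} {E : BlockEnumeration P}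
open Bim Alg

namespace BlockEnumeration

variable (E)

/-- The positions in the enumeration of the blocks, and `none` for the block `{0}`. -/
abbrev Slot : Type := Option (Σ m : Fin E.r, Fin (E.size m))

variable {E}

/-- The element of `{0, …, n}` in a position. -/
def Slot.val : E.Slot → Fin (n + 1)
  | none => 0
  | some p => (E.idx p.1 p.2).succ

/-- The first position in the block. -/
def Slot.root : E.Slot → E.Slot
  | none => none
  | some p => some ⟨p.1, ⟨0, p.2.pos⟩⟩

/-- Distinct blocks are disjoint, so a leaf determines its block, and the enumeration of a block has
no repetitions. The centre is not the successor of a leaf. -/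
lemma Slot.val_injective : Function.Injective (Slot.val (E := E)) := by
  rintro (_ | ⟨m, l⟩) (_ | ⟨m', l'⟩) h
  · rfl
  · exact absurd h (Fin.succ_ne_zero _).symm
  · exact absurd h (Fin.succ_ne_zero _)
  · have h₁ := ((E.mem_parts _).1 ⟨m, rfl⟩).1
    have h₂ := ((E.mem_parts _).1 ⟨m', rfl⟩).1
    have hm : m = m' := by
      refine E.block_injective (P.disjoint.elim_finset h₁ h₂ (E.idx m l).succ
        (Finset.mem_image_of_mem _ (Finset.mem_univ l)) ?_)
      have h' : (E.idx m l).succ = (E.idx m' l').succ := h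
      rw [h']
      exact Finset.mem_image_of_mem _ (Finset.mem_univ l')
    subst hm
    have hl : l = l' := E.idx_injective m (Fin.succ_injective _ h)
    rw [hl]

/-- A leaf lies in some part, and that part is not `{0}`, so it is one of the enumerated blocks. -/
lemma Slot.val_surjective : Function.Surjective (Slot.val (E := E)) := by
  intro j
  induction j using Fin.cases with
  | zero => exact ⟨none, rfl⟩
  | succ j =>
    obtain ⟨p, hp, hj⟩ := P.exists_mem (Finset.mem_univ j.succ)
    obtain ⟨m, rfl⟩ := (E.mem_parts p).2 ⟨hp, by
      rintro rfl
      exact Fin.succ_ne_zero j (Finset.mem_singleton.1 hj)⟩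
    obtain ⟨l, -, hl⟩ := Finset.mem_image.1 hj
    exact ⟨some ⟨m, l⟩, hl⟩

end BlockEnumeration

open BlockEnumeration

variable (k) in
/-- A morphism between the modules `A e_l`. -/
def aeMap {i j : Fin (n + 1)} (f : Ae k i ⟶ Ae k j) : AeObj k i ⟶ AeObj k j :=
  ObjectProperty.homMk f

variable (k n) in
/-- The identity `1`-morphism. -/
def idB : (IsB k n).FullSubcategory := ⟨𝟙 (A k n), isB_id k n⟩

variable (k) in
/-- The unit constraint `A ⊗_A A e_j ≅ A e_j`. -/
def unitIso (j : Fin (n + 1)) : thetaObj k j (idB k n) ≅ AeObj k j :=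
  ObjectProperty.isoMk _ (ρ_ (Ae k j))

variable (i : StarB k n)

/-- The isomorphisms `A e_i ≅ A e_j` in `C^{WR}`. -/
def normX (z : E.Pos) : (wrQ E i).obj (AeObj k z.fst.succ) ≅ (wrQ E i).obj (AeObj k z.snd.succ) :=
  (wrQ E i).mapIso (unitIso k z.fst.succ).symm ≪≫ wrX i z (idB k n) ≪≫
    (wrQ E i).mapIso (unitIso k z.snd.succ)

lemma wrX_idB (z : E.Pos) : (wrX i z (idB k n)).hom =
    (wrQ E i).map (unitIso k z.fst.succ).hom ≫ (normX i z).hom ≫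
      (wrQ E i).map (unitIso k z.snd.succ).inv := by
  simp only [normX, Iso.trans_hom, Functor.mapIso_hom, Iso.symm_hom, Category.assoc,
    ← Functor.map_comp_assoc, ← Functor.map_comp, Iso.hom_inv_id]
  rw [CategoryTheory.Functor.map_id, CategoryTheory.Functor.map_id, Category.comp_id,
    Category.id_comp]

variable (k n) in
lemma isN_proj_zero : IsN k n (proj k (0 : Fin (n + 1))) := InAdd.of_mem (G := proj k (n := n)) 0

lemma wrX_proj (z : E.Pos) (l : Fin (n + 1)) :
    (wrX i z (projB k l)).hom = (wrQ E i).map (ObjectProperty.homMk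
      (smap k z.fst z.snd (InAdd.of_mem (G := proj k (n := n)) l)) :
        thetaObj k z.fst.succ (projB k l) ⟶ thetaObj k z.snd.succ (projB k l)) :=
  wrX_of_isN i z ⟨proj k l, InAdd.of_mem (G := proj k (n := n)) l⟩

/-- Factor `bHat` as `bTilde` followed by `mulProj`. By naturality along `mulProj` the new
isomorphism is moved to `A e_0 ⊗ e_0 A`, where it equals `smap` and carries one `bTilde` to the
other. -/
lemma bHat_normX (z : E.Pos) : (wrQ E i).map (aeMap k (bHat k z.fst)) ≫ (normX i z).hom =
    (wrQ E i).map (aeMap k (bHat k z.snd)) := by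
  have h : ∀ j : Fin n, aeMap k (bHat k j) =
      (ObjectProperty.homMk (bTilde k j) : AeObj k 0 ⟶ thetaObj k j.succ (projB k 0)) ≫
        thetaMap k j.succ (B := projB k 0) (B' := idB k n) (ObjectProperty.homMk (mulProj k n)) ≫
          (unitIso k j.succ).hom :=
    fun j => ObjectProperty.hom_ext _ (bTilde_mulProj j).symm
  have h' : (ObjectProperty.homMk (bTilde k z.fst) :
      AeObj k 0 ⟶ thetaObj k z.fst.succ (projB k 0)) ≫ (ObjectProperty.homMk
      (smap k z.fst z.snd (InAdd.of_mem (G := proj k (n := n)) 0)) :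
        thetaObj k z.fst.succ (projB k 0) ⟶ thetaObj k z.snd.succ (projB k 0)) =
      ObjectProperty.homMk (bTilde k z.snd) :=
    ObjectProperty.hom_ext _ (bTilde_smap z.fst z.snd (isN_proj_zero k n))
  rw [h, h, normX, wrQ_map_comp₃, wrQ_map_comp₃]
  simp only [Iso.trans_hom, Functor.mapIso_hom, Iso.symm_hom, Category.assoc]
  rw [← Functor.map_comp_assoc (wrQ E i) (unitIso k z.fst.succ).hom, Iso.hom_inv_id,
    CategoryTheory.Functor.map_id, Category.id_comp, reassoc_of% (@wrX_naturality), wrX_proj,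
    ← Functor.map_comp_assoc, h']

/-- Dually to `bHat_normX`, `rho` is factored through `comulProj`. Naturality replaces the new
isomorphism by `smap`, which is compatible with `rho`. -/
lemma normX_rho (z : E.Pos) : (normX i z).hom ≫ (wrQ E i).map (aeMap k (rho k z.snd)) =
    (wrQ E i).map (aeMap k (rho k z.fst)) := by
  have h : ∀ j : Fin n, aeMap k (rho k j) = (unitIso k j.succ).inv ≫
      thetaMap k j.succ (B := idB k n) (B' := projB k 0) (ObjectProperty.homMk (comulProj k n)) ≫
        (ObjectProperty.homMk (rho k j ▷ proj k 0 ≫ evalProj k n) :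
          thetaObj k j.succ (projB k 0) ⟶ AeObj k 0) := by
    refine fun j => ObjectProperty.hom_ext _ ?_
    change rho k j = (ρ_ _).inv ≫ Ae k j.succ ◁ comulProj k n ≫ rho k j ▷ proj k 0 ≫ evalProj k n
    rw [whisker_exchange_assoc, whiskerRight_id_assoc, Iso.inv_hom_id_assoc, comulProj_evalProj, Category.comp_id]
  have h' : (ObjectProperty.homMk
      (smap k z.fst z.snd (InAdd.of_mem (G := proj k (n := n)) 0)) :
        thetaObj k z.fst.succ (projB k 0) ⟶ thetaObj k z.snd.succ (projB k 0)) ≫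
      (ObjectProperty.homMk (rho k z.snd ▷ proj k 0 ≫ evalProj k n) :
          thetaObj k z.snd.succ (projB k 0) ⟶ AeObj k 0) =
      ObjectProperty.homMk (rho k z.fst ▷ proj k 0 ≫ evalProj k n) :=
    ObjectProperty.hom_ext _ (by
      have := smap_rho z.fst z.snd (isN_proj_zero k n)
      change smap k z.fst z.snd (isN_proj_zero k n) ≫ rho k z.snd ▷ proj k 0 ≫ evalProj k n = _
      rw [reassoc_of% this]
      rfl)
  rw [h, h, normX, wrQ_map_comp₃, wrQ_map_comp₃]
  simp only [Iso.trans_hom, Functor.mapIso_hom, Iso.symm_hom, Category.assoc]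
  rw [← Functor.map_comp_assoc (wrQ E i) (unitIso k z.snd.succ).hom, Iso.hom_inv_id,
    CategoryTheory.Functor.map_id, Category.id_comp, ← reassoc_of% (@wrX_naturality), wrX_proj,
    ← Functor.map_comp, h']

/-- The isomorphism to the first module in the block. -/
def thetaAux (m : Fin E.r) : ∀ (l : ℕ) (h : l < E.size m),
    (wrQ E i).obj (AeObj k (E.idx m ⟨l, h⟩).succ) ≅
      (wrQ E i).obj (AeObj k (E.idx m ⟨0, (Nat.zero_le l).trans_lt h⟩).succ)
  | 0, h => Iso.refl _
  | l + 1, h => (normX i (⟨m, ⟨l, h⟩⟩ : E.Pos)).symm ≪≫ thetaAux m l ((Nat.lt_succ_self l).trans h)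

/-- By induction along the block, one application of `bHat_normX` at a time. -/
lemma bHat_thetaAux (m : Fin E.r) (l : ℕ) (h : l < E.size m) :
    (wrQ E i).map (aeMap k (bHat k (E.idx m ⟨l, h⟩))) ≫ (thetaAux i m l h).hom =
      (wrQ E i).map (aeMap k (bHat k (E.idx m ⟨0, (Nat.zero_le l).trans_lt h⟩))) := by
  induction l with
  | zero => exact Category.comp_id _
  | succ l ih =>
    have h₁ := bHat_normX i (⟨m, ⟨l, h⟩⟩ : E.Pos)
    rw [← Iso.eq_comp_inv] at h₁
    rw [← ih ((Nat.lt_succ_self l).trans h)]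
    refine Eq.trans ?_ (congrArg (fun t => t ≫ _) h₁.symm)
    exact (Category.assoc _ _ _).symm

lemma thetaAux_rho (m : Fin E.r) (l : ℕ) (h : l < E.size m) :
    (thetaAux i m l h).hom ≫ (wrQ E i).map
      (aeMap k (rho k (E.idx m ⟨0, (Nat.zero_le l).trans_lt h⟩))) =
      (wrQ E i).map (aeMap k (rho k (E.idx m ⟨l, h⟩))) := by
  induction l with
  | zero => exact Category.id_comp _
  | succ l ih =>
    have h₁ := normX_rho i (⟨m, ⟨l, h⟩⟩ : E.Pos)
    rw [← Iso.eq_inv_comp] at h₁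
    refine Eq.trans ?_ h₁.symm
    exact (Category.assoc _ _ _).trans (congrArg _ (ih ((Nat.lt_succ_self l).trans h)))

/-- The isomorphism to the first module in the block. -/
def slotIso : ∀ p : E.Slot, (wrQ E i).obj (AeObj k p.val) ≅ (wrQ E i).obj (AeObj k p.root.val)
  | none => Iso.refl _
  | some ⟨m, l⟩ => thetaAux i m l.1 l.2

/-- The morphisms between the modules `A e_j` in `C^{WR}` that come from morphisms between
the first modules in the blocks. -/
def slotHom (p q : E.Slot) :
    Submodule k ((wrQ E i).obj (AeObj k p.val) ⟶ (wrQ E i).obj (AeObj k q.val)) where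
  carrier := {f | ∃ g : AeObj k p.root.val ⟶ AeObj k q.root.val,
    f = (slotIso i p).hom ≫ (wrQ E i).map g ≫ (slotIso i q).inv}
  add_mem' := by
    rintro _ _ ⟨f, rfl⟩ ⟨g, rfl⟩
    exact ⟨f + g, by simp [Functor.map_add]⟩
  zero_mem' := ⟨0, by simp⟩
  smul_mem' := by
    rintro c _ ⟨f, rfl⟩
    exact ⟨c • f, by simp [Functor.map_smul]⟩

lemma comp_mem_slotHom {p q r : E.Slot}
    {f : (wrQ E i).obj (AeObj k p.val) ⟶ (wrQ E i).obj (AeObj k q.val)}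
    {g : (wrQ E i).obj (AeObj k q.val) ⟶ (wrQ E i).obj (AeObj k r.val)}
    (hf : f ∈ slotHom i p q) (hg : g ∈ slotHom i q r) : f ≫ g ∈ slotHom i p r := by
  obtain ⟨f, rfl⟩ := hf
  obtain ⟨g, rfl⟩ := hg
  exact ⟨f ≫ g, by simp⟩

/-- At the first position of a block `slotIso` is the identity, so between roots the normal form is
itself a morphism of `A-proj`. -/
lemma exists_wrQ_eq_of_mem_slotHom : ∀ {p q : E.Slot}
    {f : (wrQ E i).obj (AeObj k p.root.val) ⟶ (wrQ E i).obj (AeObj k q.root.val)},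
    f ∈ slotHom i p.root q.root →
      ∃ g : AeObj k p.root.val ⟶ AeObj k q.root.val, f = (wrQ E i).map g
  | none, none, _, ⟨g, h⟩ => ⟨g, h.trans ((Category.id_comp _).trans (Category.comp_id _))⟩
  | none, some _, _, ⟨g, h⟩ => ⟨g, h.trans ((Category.id_comp _).trans (Category.comp_id _))⟩
  | some _, none, _, ⟨g, h⟩ => ⟨g, h.trans ((Category.id_comp _).trans (Category.comp_id _))⟩
  | some _, some _, _, ⟨g, h⟩ => ⟨g, h.trans ((Category.id_comp _).trans (Category.comp_id _))⟩

lemma smul_aeMap_mem_slotHom {p q : E.Slot} (c : k) {f : Ae k p.val ⟶ Ae k q.val}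
    (hf : (wrQ E i).map (aeMap k f) ∈ slotHom i p q) :
    (wrQ E i).map (aeMap k (c • f)) ∈ slotHom i p q := by
  have : (wrQ E i).map (aeMap k (c • f)) = c • (wrQ E i).map (aeMap k f) :=
    (wrQ E i).map_smul c (aeMap k f)
  rw [this]
  exact Submodule.smul_mem _ c hf

/-- The Hom spaces involving a leaf are spanned by a `bHat`, a `rho` or an identity, or vanish. Each
of these spanning morphisms is compatible with the isomorphisms to the roots. -/
lemma aeMap_mem_slotHom : ∀ {p q : E.Slot} (f : Ae k p.val ⟶ Ae k q.val),
    (wrQ E i).map (aeMap k f) ∈ slotHom i p q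
  | none, none, f => ⟨aeMap k f, ((Category.id_comp _).trans (Category.comp_id _)).symm⟩
  | none, some ⟨m, l⟩, f => by
    obtain ⟨c, rfl⟩ := exists_eq_smul_bHat f
    refine smul_aeMap_mem_slotHom i (p := none) (q := some ⟨m, l⟩) c ⟨aeMap k (bHat k _), ?_⟩
    refine Eq.trans ?_ (Category.id_comp _).symm
    exact (Iso.eq_comp_inv _).2 (bHat_thetaAux i m l.1 l.2)
  | some ⟨m, l⟩, none, f => by
    obtain ⟨c, rfl⟩ := exists_eq_smul_rho f
    refine smul_aeMap_mem_slotHom i (p := some ⟨m, l⟩) (q := none) c ⟨aeMap k (rho k _), ?_⟩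
    refine Eq.trans ?_ (congrArg _ (Category.comp_id _).symm)
    exact (thetaAux_rho i m l.1 l.2).symm
  | some p, some q, f => by
    by_cases hpq : p = q
    · subst hpq
      obtain ⟨c, rfl⟩ := exists_eq_smul_id f
      refine smul_aeMap_mem_slotHom i (p := some p) (q := some p) c ⟨𝟙 _, ?_⟩
      rw [CategoryTheory.Functor.map_id, Category.id_comp, Iso.hom_inv_id]
      exact (wrQ E i).map_id _
    · have : f = 0 := Ae_hom_eq_zero (fun h => hpq (Option.some_injective _
        (Slot.val_injective (congrArg Fin.succ h)))) f
      subst this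
      have : (wrQ E i).map (aeMap k (0 : Ae k (Slot.val (some p)) ⟶ Ae k (Slot.val (some q)))) = 0 :=
        (wrQ E i).map_zero _ _
      rw [this]
      exact (slotHom i (some p) (some q)).zero_mem

lemma wrQ_map_mem_slotHom {p q : E.Slot} (f : AeObj k p.val ⟶ AeObj k q.val) :
    (wrQ E i).map f ∈ slotHom i p q := aeMap_mem_slotHom i f.hom

/-- The positions of the two leaves joined by a generating isomorphism. -/
def posFst (z : E.Pos) : E.Slot := some ⟨z.1, ⟨z.2.1, (Nat.lt_succ_self _).trans z.2.2⟩⟩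

/-- The positions of the two leaves joined by a generating isomorphism. -/
def posSnd (z : E.Pos) : E.Slot := some ⟨z.1, ⟨z.2.1 + 1, z.2.2⟩⟩

lemma slotIso_posSnd (z : E.Pos) :
    slotIso i (posSnd z) = (normX i z).symm ≪≫ slotIso i (posFst z) := rfl

/-- Consecutive positions have the same root, and `slotIso` at the later one starts with the inverse
of `normX`; hence the identity of the root represents this morphism. -/
lemma normX_hom_mem (z : E.Pos) : (normX i z).hom ∈ slotHom i (posFst z) (posSnd z) := by
  refine ⟨𝟙 _, ?_⟩
  rw [slotIso_posSnd]
  refine Eq.trans ?_ (congrArg (fun t => _ ≫ t ≫ _) ((wrQ E i).map_id _).symm)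
  refine Eq.trans ?_ (congrArg (fun t => _ ≫ t) (Category.id_comp _).symm)
  exact ((slotIso i (posFst z)).hom_inv_id_assoc (normX i z).hom).symm

lemma normX_inv_mem (z : E.Pos) : (normX i z).inv ∈ slotHom i (posSnd z) (posFst z) := by
  refine ⟨𝟙 _, ?_⟩
  rw [slotIso_posSnd]
  refine Eq.trans ?_ (congrArg (fun t => _ ≫ t ≫ _) ((wrQ E i).map_id _).symm)
  refine Eq.trans ?_ (congrArg (fun t => _ ≫ t) (Category.id_comp _).symm)
  refine Eq.trans ?_ (Category.assoc _ _ _).symm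
  refine Eq.trans ?_ (congrArg (fun t => _ ≫ t) (Iso.hom_inv_id _).symm)
  exact (Category.comp_id _).symm

lemma InAdd.fullSubcategory {𝒞 : Type*} [Category 𝒞] [Preadditive 𝒞] {Q : ObjectProperty 𝒞}
    {ι : Type*} {G : ι → Q.FullSubcategory} {X : Q.FullSubcategory}
    (h : InAdd (fun x => (G x).obj) X.obj) : InAdd G X := by
  obtain ⟨J, _, t, a, b, h⟩ := h
  refine ⟨J, inferInstance, t, fun x => ObjectProperty.homMk (a x),
    fun x => ObjectProperty.homMk (b x), Q.ι.map_injective ?_⟩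
  rw [Functor.map_sum]
  exact h

lemma InAdd.reindex {𝒞 : Type*} [Category 𝒞] [Preadditive 𝒞] {ι κ : Type*} {G : ι → 𝒞}
    {φ : κ → ι} (hφ : Function.Surjective φ) {X : 𝒞} (h : InAdd G X) :
    InAdd (fun x => G (φ x)) X := by
  refine h.trans fun y => ?_
  obtain ⟨x, rfl⟩ := hφ y
  exact InAdd.of_mem (G := fun x => G (φ x)) x

variable (E) in
lemma inAdd_slot (X : (IsProj k n).FullSubcategory) :
    InAdd (fun p : E.Slot => AeObj k p.val) X :=
  InAdd.reindex (G := AeObj k) Slot.val_surjective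
    (InAdd.fullSubcategory (X.property.trans fun _ => inAdd_Ae k n))

/-- The property that all components of a morphism are in `slotHom`. -/
def IsSpanned {X Y : (IsProj k n).FullSubcategory} (f : (wrQ E i).obj X ⟶ (wrQ E i).obj Y) :
    Prop :=
  ∀ (p q : E.Slot) (u : AeObj k p.val ⟶ X) (v : Y ⟶ AeObj k q.val),
    (wrQ E i).map u ≫ f ≫ (wrQ E i).map v ∈ slotHom i p q

variable {i}

lemma isSpanned_wrQ {X Y : (IsProj k n).FullSubcategory} (f : X ⟶ Y) :
    IsSpanned i ((wrQ E i).map f) := fun p q u v => by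
  rw [← wrQ_map_comp₃]
  exact wrQ_map_mem_slotHom i _

lemma IsSpanned.add {X Y : (IsProj k n).FullSubcategory}
    {f g : (wrQ E i).obj X ⟶ (wrQ E i).obj Y} (hf : IsSpanned i f) (hg : IsSpanned i g) :
    IsSpanned i (f + g) := fun p q u v => by
  rw [Preadditive.add_comp, Preadditive.comp_add]
  exact add_mem (hf p q u v) (hg p q u v)

lemma IsSpanned.smul {X Y : (IsProj k n).FullSubcategory} (c : k)
    {f : (wrQ E i).obj X ⟶ (wrQ E i).obj Y} (hf : IsSpanned i f) : IsSpanned i (c • f) :=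
  fun p q u v => by
  rw [Linear.smul_comp, Linear.comp_smul]
  exact Submodule.smul_mem _ _ (hf p q u v)

lemma IsSpanned.sum {X Y : (IsProj k n).FullSubcategory} {J : Type*} [Fintype J]
    {f : J → ((wrQ E i).obj X ⟶ (wrQ E i).obj Y)} (hf : ∀ x, IsSpanned i (f x)) :
    IsSpanned i (∑ x, f x) := fun p q u v => by
  rw [Preadditive.sum_comp, Preadditive.comp_sum]
  exact sum_mem fun x _ => hf x p q u v

/-- Insert the identity of `Y`, written as a sum of maps through the modules `A e_p`, between the
two factors. -/
lemma IsSpanned.comp {X Y Z : (IsProj k n).FullSubcategory}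
    {f : (wrQ E i).obj X ⟶ (wrQ E i).obj Y} {g : (wrQ E i).obj Y ⟶ (wrQ E i).obj Z}
    (hf : IsSpanned i f) (hg : IsSpanned i g) : IsSpanned i (f ≫ g) := fun p q u v => by
  obtain ⟨J, _, t, a, b, h⟩ := inAdd_slot E Y
  have h' : ∑ x, (wrQ E i).map (a x) ≫ (wrQ E i).map (b x) = 𝟙 _ := by
    simp only [← Functor.map_comp]
    rw [← Functor.map_sum, h, CategoryTheory.Functor.map_id]
  have : (wrQ E i).map u ≫ (f ≫ g) ≫ (wrQ E i).map v =
      ∑ x, ((wrQ E i).map u ≫ f ≫ (wrQ E i).map (a x)) ≫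
        ((wrQ E i).map (b x) ≫ g ≫ (wrQ E i).map v) := by
    calc _ = (wrQ E i).map u ≫ f ≫ (∑ x, (wrQ E i).map (a x) ≫ (wrQ E i).map (b x)) ≫ g ≫
          (wrQ E i).map v := by rw [h']; simp
      _ = _ := by simp only [Preadditive.sum_comp, Preadditive.comp_sum, Category.assoc]
  rw [this]
  exact sum_mem fun x _ => comp_mem_slotHom i (hf _ _ _ _) (hg _ _ _ _)

lemma isSpanned_normX (z : E.Pos) : IsSpanned i (normX i z).hom := fun p q u v =>
  comp_mem_slotHom i (q := posFst z) (wrQ_map_mem_slotHom i (q := posFst z) u)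
    (comp_mem_slotHom i (q := posSnd z) (normX_hom_mem i z)
      (wrQ_map_mem_slotHom i (p := posSnd z) v))

lemma isSpanned_normX_inv (z : E.Pos) : IsSpanned i (normX i z).inv := fun p q u v =>
  comp_mem_slotHom i (q := posSnd z) (wrQ_map_mem_slotHom i (q := posSnd z) u)
    (comp_mem_slotHom i (q := posFst z) (normX_inv_mem i z)
      (wrQ_map_mem_slotHom i (p := posFst z) v))

variable (k n) in
/-- The generating `1`-morphisms. -/
def genB : Option (Fin (n + 1)) → (IsB k n).FullSubcategory
  | none => idB k n
  | some l => projB k l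

lemma inAdd_genB (B : (IsB k n).FullSubcategory) : InAdd (genB k n) B := by
  refine InAdd.fullSubcategory ?_
  have : (fun x => (genB k n x).obj) = gens k n := funext fun x => by cases x <;> rfl
  rw [this]
  exact B.property

/-- Every `B` is a retract of a finite sum of the generators `A` and `A e_l ⊗ e_0 A`. A natural
family is therefore expressed through its values there. -/
lemma IsSpanned.of_genB {j j' : Fin (n + 1)}
    (T : ∀ B, (wrQ E i).obj (thetaObj k j B) ⟶ (wrQ E i).obj (thetaObj k j' B))
    (hT : ∀ {B B' : (IsB k n).FullSubcategory} (f : B ⟶ B'),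
      (wrQ E i).map (thetaMap k j f) ≫ T B' = T B ≫ (wrQ E i).map (thetaMap k j' f))
    (h₁ : IsSpanned i (T (idB k n))) (h₂ : ∀ l, IsSpanned i (T (projB k l)))
    (B : (IsB k n).FullSubcategory) : IsSpanned i (T B) := by
  obtain ⟨J, _, t, a, b, h⟩ := inAdd_genB B
  have h' : ∑ x, thetaMap k j (a x) ≫ thetaMap k j (b x) = 𝟙 _ := by
    refine (IsProj k n).ι.map_injective ?_
    rw [Functor.map_sum]
    have h₀ := congrArg (fun f => (precomp _ (Ae k j)).map ((IsB k n).ι.map f)) h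
    simp only [Functor.map_sum, Functor.map_comp] at h₀
    exact h₀.trans (CategoryTheory.Functor.map_id _ _)
  have : T B = ∑ x, (wrQ E i).map (thetaMap k j (a x)) ≫ T (genB k n (t x)) ≫
      (wrQ E i).map (thetaMap k j' (b x)) := by
    calc T B = (wrQ E i).map (∑ x, thetaMap k j (a x) ≫ thetaMap k j (b x)) ≫ T B := by
          rw [h', CategoryTheory.Functor.map_id, Category.id_comp]
      _ = _ := by
          simp only [Functor.map_sum, Preadditive.sum_comp, Functor.map_comp, Category.assoc, hT]
  rw [this]
  refine IsSpanned.sum fun x => (isSpanned_wrQ _).comp (IsSpanned.comp ?_ (isSpanned_wrQ _))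
  cases t x with
  | none => exact h₁
  | some l => exact h₂ l

variable (i)

/-- All morphisms of `C^{WR}` are spanned by the morphisms between the first modules in
the blocks. -/
lemma isSpanned {X Y : (IsProj k n).FullSubcategory} (f : (wrQ E i).obj X ⟶ (wrQ E i).obj Y) :
    IsSpanned i f := by
  refine wr_induction i (motive := fun f => IsSpanned i f) isSpanned_wrQ ?_ ?_
    (fun _ _ => IsSpanned.comp) (fun _ _ => IsSpanned.add) (fun c _ => IsSpanned.smul c) f
  · intro z
    refine IsSpanned.of_genB (fun B => (wrX i z B).hom) (fun f => wrX_naturality i z f) ?_ ?_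
    -- At `B = A` the isomorphism is `normX` up to units. At `A e_l ⊗ e_0 A` it is prescribed, hence
    -- the image of a morphism of `A-proj`.
    · rw [wrX_idB]
      exact (isSpanned_wrQ _).comp ((isSpanned_normX z).comp (isSpanned_wrQ _))
    · intro l
      rw [wrX_proj]
      exact isSpanned_wrQ _
  · intro z
    refine IsSpanned.of_genB (fun B => (wrX i z B).inv) (fun {B B'} f => ?_) ?_ ?_
    · rw [Iso.comp_inv_eq, Category.assoc, Iso.eq_inv_comp, wrX_naturality]
    · have : (wrX i z (idB k n)).inv = (wrQ E i).map (unitIso k z.snd.succ).hom ≫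
          (normX i z).inv ≫ (wrQ E i).map (unitIso k z.fst.succ).inv := by
        refine (cancel_epi (wrX i z _).hom).1 ?_
        rw [Iso.hom_inv_id, wrX_idB]
        simp
      rw [this]
      exact (isSpanned_wrQ _).comp ((isSpanned_normX_inv z).comp (isSpanned_wrQ _))
    · intro l
      -- The inverse of `smap` is `smap` with the leaves exchanged, so the inverse isomorphism also
      -- comes from `A-proj`.
      have : (wrX i z (projB k l)).inv = (wrQ E i).map (ObjectProperty.homMk
          (smap k z.snd z.fst (InAdd.of_mem (G := proj k (n := n)) l)) :
            thetaObj k z.snd.succ (projB k l) ⟶ thetaObj k z.fst.succ (projB k l)) := by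
        refine (cancel_epi (wrX i z _).hom).1 ?_
        rw [Iso.hom_inv_id, wrX_proj, ← Functor.map_comp, ← CategoryTheory.Functor.map_id]
        exact congrArg _ (ObjectProperty.hom_ext _
          (smap_smap z.fst z.snd (InAdd.of_mem (G := proj k (n := n)) l)).symm)
      rw [this]
      exact isSpanned_wrQ _

end Concrete

/-! ### Faithfulness of the corner functor and absence of proper stable ideals -/

section Concrete

variable {k : Type u} [Field k] {n : ℕ}
  {P : Finpartition (Finset.univ : Finset (Fin (n + 1)))} {E : BlockEnumeration P}
open Bim Alg BlockEnumeration

/-- A morphism between retracts of finite direct sums is a combination of its matrix entries. -/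
lemma InAdd.eq_zero {𝒞 : Type*} [Category 𝒞] [Preadditive 𝒞] {ι κ : Type*} {G : ι → 𝒞}
    {H : κ → 𝒞} {X Y : 𝒞} (hX : InAdd G X) (hY : InAdd H Y) (f : X ⟶ Y)
    (h : ∀ p q (u : G p ⟶ X) (v : Y ⟶ H q), u ≫ f ≫ v = 0) : f = 0 := by
  obtain ⟨J, _, t, a, b, h₁⟩ := hX
  obtain ⟨J', _, t', a', b', h₂⟩ := hY
  calc f = (∑ x, a x ≫ b x) ≫ f ≫ ∑ y, a' y ≫ b' y := by rw [h₁, h₂]; simp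
    _ = ∑ x, ∑ y, a x ≫ (b x ≫ f ≫ a' y) ≫ b' y := by
      simp only [Preadditive.sum_comp, Preadditive.comp_sum, Category.assoc]
      exact Finset.sum_comm
    _ = 0 := by simp [h]

/-- If every matrix entry of `f` lifts through `F`, the lifts can be reassembled with the inclusions
and projections of the source category. -/
lemma InAdd.exists_map_eq {𝒞 𝒟 : Type*} [Category 𝒞] [Preadditive 𝒞] [Category 𝒟]
    [Preadditive 𝒟] (F : 𝒞 ⥤ 𝒟) [F.Additive] {ι κ : Type*} {G : ι → 𝒞} {H : κ → 𝒞} {X Y : 𝒞}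
    (hX : InAdd G X) (hY : InAdd H Y) (f : F.obj X ⟶ F.obj Y)
    (h : ∀ p q (u : G p ⟶ X) (v : Y ⟶ H q), ∃ g, F.map g = F.map u ≫ f ≫ F.map v) :
    ∃ g, F.map g = f := by
  obtain ⟨J, _, t, a, b, h₁⟩ := hX
  obtain ⟨J', _, t', a', b', h₂⟩ := hY
  choose g hg using fun x y => h _ _ (b x) (a' y)
  refine ⟨∑ x, ∑ y, a x ≫ g x y ≫ b' y, ?_⟩
  calc _ = ∑ x, ∑ y, F.map (a x) ≫ (F.map (b x) ≫ f ≫ F.map (a' y)) ≫ F.map (b' y) := by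
        simp only [Functor.map_sum, Functor.map_comp, hg]
    _ = F.map (∑ x, a x ≫ b x) ≫ f ≫ F.map (∑ y, a' y ≫ b' y) := by
        simp only [Functor.map_sum, Functor.map_comp, Preadditive.sum_comp, Preadditive.comp_sum,
          Category.assoc]
        exact Finset.sum_comm
    _ = f := by rw [h₁, h₂]; simp

variable (i : StarB k n)

variable (E) in
lemma inAdd_wrQ_slot (X : (IsProj k n).FullSubcategory) :
    InAdd (fun p : E.Slot => (wrQ E i).obj (AeObj k p.val)) ((wrQ E i).obj X) :=
  (inAdd_slot E X).map (wrQ E i)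

/-- The functor `X ↦ e_0 A ⊗_A X` on projective modules is faithful. -/
lemma eq_zero_of_whiskerRight_eA {X Y : (IsProj k n).FullSubcategory} (f : X ⟶ Y)
    (hf : f.hom ▷ eA k n = 0) : f = 0 := by
  refine (IsProj k n).ι.map_injective ?_
  have hA : ∀ X : (IsProj k n).FullSubcategory, InAdd (Ae k (n := n)) X.obj :=
    fun X => X.property.trans fun _ => inAdd_Ae k n
  rw [Functor.map_zero]
  refine (hA X).eq_zero (hA Y) _ fun p q u v => Ae_hom_eq_zero_of_whiskerRight _ ?_
  change (u ≫ f.hom ≫ v) ▷ eA k n = 0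
  rw [comp_whiskerRight, comp_whiskerRight, hf, Limits.zero_comp, Limits.comp_zero]

/-- The corner functor restricts along `wrQ` to the faithful functor `e_0 A ⊗_A -` on `A-proj`. -/
lemma wrQ_eq_zero {X Y : (IsProj k n).FullSubcategory} (f : X ⟶ Y)
    (hf : (wrQ E i).map f = 0) : f = 0 :=
  eq_zero_of_whiskerRight_eA f (by rw [← corner_wrQ (E := E) i, hf, map_zero])

lemma exists_slotHom {p q : E.Slot} {X Y : (IsProj k n).FullSubcategory}
    (f : (wrQ E i).obj X ⟶ (wrQ E i).obj Y)
    (u : (wrQ E i).obj (AeObj k p.val) ⟶ (wrQ E i).obj X)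
    (v : (wrQ E i).obj Y ⟶ (wrQ E i).obj (AeObj k q.val)) :
    ∃ g : AeObj k p.root.val ⟶ AeObj k q.root.val,
      u ≫ f ≫ v = (slotIso i p).hom ≫ (wrQ E i).map g ≫ (slotIso i q).inv := by
  have := isSpanned i (u ≫ f ≫ v) p q (𝟙 _) (𝟙 _)
  rw [CategoryTheory.Functor.map_id, CategoryTheory.Functor.map_id, Category.id_comp,
    Category.comp_id] at this
  exact this

/-- The corner functor is faithful on `C^{WR}`. -/
lemma eq_zero_of_corner_eq_zero {X Y : (IsProj k n).FullSubcategory}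
    (f : (wrQ E i).obj X ⟶ (wrQ E i).obj Y) (hf : corner i f = 0) : f = 0 := by
  refine (inAdd_wrQ_slot E i X).eq_zero (inAdd_wrQ_slot E i Y) f fun p q u v => ?_
  -- In normal form each component of `f` comes from a map `g` in `A-proj` between roots, where
  -- faithfulness is already known.
  obtain ⟨g, hg⟩ := exists_slotHom i f u v
  have h : (wrQ E i).map g = (slotIso i p).inv ≫ (u ≫ f ≫ v) ≫ (slotIso i q).hom := by
    rw [hg]; simp
  have h' : g = 0 := eq_zero_of_whiskerRight_eA g (by
    rw [← corner_wrQ (E := E) i, h]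
    simp [hf])
  rw [hg, h', Functor.map_zero, Limits.zero_comp, Limits.comp_zero]

/-- A nonzero morphism has nonzero corner, so the ideal contains the identities of all `A e_l`.
Every identity factors as a sum through these. -/
lemma wrIdeal_eq_top (I : (wrConstruction k E).CWR.StableIdeal)
    {X Y : (IsProj k n).FullSubcategory} {f : (wrQ E i).obj X ⟶ (wrQ E i).obj Y}
    (hf : f ∈ wrIdeal i I X Y) (h : f ≠ 0) (Z : (IsProj k n).FullSubcategory) :
    𝟙 ((wrQ E i).obj Z) ∈ wrIdeal i I Z Z := by
  have hc : corner i f ≠ 0 := fun h' => h (eq_zero_of_corner_eq_zero i f h')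
  obtain ⟨J, _, t, a, b, h₁⟩ := inAdd_wrQ_slot E i Z
  rw [← h₁]
  refine sum_mem fun x _ => ?_
  have := wrIdeal_comp i I (a x) (b x) (id_mem_of_corner_ne_zero i I hf hc (t x).val)
  rwa [Category.id_comp] at this

lemma wr_nonzero : 𝟙 ((wrQ E i).obj (AeObj k 0)) ≠ 0 := by
  intro h
  rw [← CategoryTheory.Functor.map_id] at h
  have h₁ : 𝟙 (AeObj k (0 : Fin (n + 1))) = 0 := wrQ_eq_zero i _ h
  have h₂ : BiMod.Hom.lin (𝟙 (leftIdeal k (StarAlg.e k n 0)))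
      (leftMk _ _ (StarAlg.e_mul_self k 0)) = 0 :=
    LinearMap.congr_fun (congrArg (fun f => BiMod.Hom.lin f.hom) h₁) _
  have h₃ : StarAlg.e k n 0 = 0 := congrArg (leftVal (k := k) (StarAlg.e k n 0)) h₂
  -- The coordinate of `e_0` at `e_0` is `1`.
  exact one_ne_zero (congrArg StarAlg.x₀ h₃)

lemma wr_not_isProper (I : (wrConstruction k E).CWR.StableIdeal) : ¬ I.IsProper := by
  rintro ⟨i, ⟨X, Y, h⟩, X', Y', h'⟩
  obtain ⟨f, hf, hf'⟩ := Submodule.exists_mem_ne_zero_of_ne_bot h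
  exact h' (I.eq_top_of_id_mem (fun Z => wrIdeal_eq_top i I (X := X.as.as) (Y := Y.as.as) (f := f)
    hf hf' Z.as.as) X' Y')

end Concrete

/-- An object of the target is a retract of the image of a finite sum of copies of `G`. The
corresponding idempotent lifts because `F` is fully faithful, and it splits in the source; the image
of the splitting is isomorphic to the given object. -/
lemma essSurj_of_inAdd {𝒞 𝒟 : Type*} [Category 𝒞] [Preadditive 𝒞] [Category 𝒟] [Preadditive 𝒟]
    (F : 𝒞 ⥤ 𝒟) [F.Additive] [F.Full] [F.Faithful] (G : 𝒞)
    (hsum : ∀ (J : Type) [Fintype J], ∃ (B : 𝒞) (a : J → (G ⟶ B)) (b : J → (B ⟶ G)),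
      (∀ x, a x ≫ b x = 𝟙 G) ∧ ∀ x y, x ≠ y → a x ≫ b y = 0)
    (hsplit : ∀ (B : 𝒞) (p : B ⟶ B), p ≫ p = p →
      ∃ (C : 𝒞) (r : B ⟶ C) (s : C ⟶ B), r ≫ s = p ∧ s ≫ r = 𝟙 C)
    (h : ∀ Y, InAdd (fun _ : Unit => F.obj G) Y) : F.EssSurj where
  mem_essImage Y := by
    obtain ⟨J, _, t, c, d, hcd⟩ := h Y
    obtain ⟨B, a, b, hab, hab'⟩ := hsum J
    let α : Y ⟶ F.obj B := ∑ x, c x ≫ F.map (a x)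
    let β : F.obj B ⟶ Y := ∑ x, F.map (b x) ≫ d x
    have hαβ : α ≫ β = 𝟙 Y := by
      rw [← hcd, Preadditive.sum_comp]
      refine Finset.sum_congr rfl fun x _ => ?_
      rw [Preadditive.comp_sum, Finset.sum_eq_single x]
      · rw [Category.assoc, ← F.map_comp_assoc, hab, F.map_id, Category.id_comp]
      · intro y _ hy
        rw [Category.assoc, ← F.map_comp_assoc, hab' x y hy.symm, F.map_zero, Limits.zero_comp,
          Limits.comp_zero]
      · exact fun hx => absurd (Finset.mem_univ x) hx
    -- The idempotent of the retract `Y` is `β ≫ α`; its preimage under `F` is idempotent by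
    -- faithfulness.
    obtain ⟨C, r, s, hrs, hsr⟩ := hsplit B (F.preimage (β ≫ α)) (F.map_injective (by
      rw [F.map_comp, F.map_preimage, Category.assoc, reassoc_of% hαβ]))
    have hrs' : F.map r ≫ F.map s = β ≫ α := by rw [← F.map_comp, hrs, F.map_preimage]
    exact ⟨C, ⟨{
      hom := F.map s ≫ β
      inv := α ≫ F.map r
      hom_inv_id := by
        rw [Category.assoc, ← Category.assoc β, ← hrs', ← F.map_comp, ← F.map_comp,
          ← F.map_comp, Category.assoc, hsr, Category.comp_id, hsr, F.map_id]
      inv_hom_id := by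
        rw [Category.assoc, ← Category.assoc (F.map r), hrs', Category.assoc, hαβ,
          Category.comp_id, hαβ] }⟩⟩

/-! ### Finite sums and split idempotents of finitely generated projective modules -/

section FGProj

variable (R : Type u) [Ring R]

/-- The category of finitely generated projective modules. -/
abbrev FGProj : Type (u + 1) := ObjectProperty.FullSubcategory (C := ModuleCat.{u} R)
  (fun M => Module.Finite R M ∧ Module.Projective R M)

/-- The regular module. -/
def FGProj.reg : FGProj R := ⟨ModuleCat.of R R, inferInstance, inferInstance⟩

variable {R}

/-- A morphism of finitely generated projective modules from a linear map. -/
def FGProj.ofHom {M N : FGProj R} (f : M.obj →ₗ[R] N.obj) : M ⟶ N :=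
  ObjectProperty.homMk (ModuleCat.ofHom f)

lemma FGProj.hom_ext {M N : FGProj R} {f g : M ⟶ N} (h : ∀ x, f.hom.hom x = g.hom.hom x) :
    f = g := ObjectProperty.hom_ext _ (ModuleCat.hom_ext (LinearMap.ext h))

lemma FGProj.exists_sum (J : Type) [Fintype J] :
    ∃ (B : FGProj R) (a : J → (FGProj.reg R ⟶ B)) (b : J → (B ⟶ FGProj.reg R)),
      (∀ x, a x ≫ b x = 𝟙 (FGProj.reg R)) ∧ ∀ x y, x ≠ y → a x ≫ b y = 0 := by
  classical
  refine ⟨⟨ModuleCat.of R (J → R), inferInstance, inferInstance⟩,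
    fun x => FGProj.ofHom (M := FGProj.reg R) (LinearMap.single R (fun _ => R) x),
    fun x => FGProj.ofHom (N := FGProj.reg R) (LinearMap.proj x), fun x => ?_, fun x y hxy => ?_⟩
  · exact FGProj.hom_ext fun (r : R) =>
      (show (Pi.single x r : J → R) x = r by simp)
  · exact FGProj.hom_ext fun (r : R) =>
      (show (Pi.single x r : J → R) y = 0 by simp [hxy.symm])

lemma FGProj.exists_split (B : FGProj R) (p : B ⟶ B) (hp : p ≫ p = p) :
    ∃ (C : FGProj R) (r : B ⟶ C) (s : C ⟶ B), r ≫ s = p ∧ s ≫ r = 𝟙 C := by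
  let q : B.obj →ₗ[R] B.obj := p.hom.hom
  have hq : ∀ x, q (q x) = q x := fun x =>
    LinearMap.congr_fun (congrArg (fun f : B ⟶ B => (f.hom.hom : B.obj →ₗ[R] B.obj)) hp) x
  have h : q.rangeRestrict ∘ₗ (LinearMap.range q).subtype = LinearMap.id := by
    ext ⟨_, y, rfl⟩
    exact hq y
  have := B.property.1
  have := B.property.2
  refine ⟨⟨ModuleCat.of R (LinearMap.range q),
    Module.Finite.of_surjective q.rangeRestrict q.surjective_rangeRestrict,
    Module.Projective.of_split _ _ h⟩, FGProj.ofHom q.rangeRestrict,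
    FGProj.ofHom (LinearMap.range q).subtype, FGProj.hom_ext fun x => rfl,
    FGProj.hom_ext fun x => LinearMap.congr_fun h x⟩

/-- A surjection from a finite free module onto a projective module splits; the coordinates of the
splitting give the required maps. -/
lemma FGProj.inAdd_reg (M : FGProj R) : InAdd (fun _ : Unit => FGProj.reg R) M := by
  have := M.property.1
  have := M.property.2
  obtain ⟨m, f, hf⟩ := Module.Finite.exists_fin' R M.obj
  obtain ⟨g, hg⟩ := Module.projective_lifting_property f LinearMap.id hf
  refine ⟨Fin m, inferInstance, fun _ => (),
    fun x => FGProj.ofHom (N := FGProj.reg R) (LinearMap.proj x ∘ₗ g),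
    fun x => FGProj.ofHom (M := FGProj.reg R) (f ∘ₗ LinearMap.single R (fun _ => R) x),
    FGProj.hom_ext fun y => ?_⟩
  let φ : (M ⟶ M) →+ M.obj :=
    { toFun := fun f => f.hom.hom y, map_zero' := rfl, map_add' := fun _ _ => rfl }
  refine (map_sum φ _ _).trans ?_
  change ∑ x, f (LinearMap.single R (fun _ => R) x (g y x)) = y
  rw [← map_sum]
  have : ∑ x, LinearMap.single R (fun _ => R) x (g y x) = g y := by
    ext z; simp [Finset.sum_apply, Pi.single_apply]
  rw [this]
  exact LinearMap.congr_fun hg y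

end FGProj

/-! ### Tensoring a left module with modules over its endomorphism algebra -/

section TensorFunctor

variable {k : Type u} [Field k]
open Alg BiMod

open scoped ModuleCat in
/-- A left module over a `k`-algebra, as a bimodule. -/
def ofModule (R : Type u) [Ring R] [Algebra k R] (M : ModuleCat.{u} R) : BiMod k R k where
  V := M
  lact := Algebra.lsmul k k M
  ract := scalarRight k M
  comm s r x := by simp [scalarRight]

open scoped ModuleCat in
/-- The functor from left modules to bimodules. -/
def ofModuleFunctor (R : Type u) [Ring R] [Algebra k R] :
    ModuleCat.{u} R ⥤ (ground k ⟶ (⟨R⟩ : Alg k)) where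
  obj M := ofModule R M
  map {M N} f := (⟨f.hom.restrictScalars k, fun s x => f.hom.map_smul s x,
    fun r x => (f.hom.restrictScalars k).map_smul r.unop x⟩ : ofModule R M ⟶ ofModule R N)
  map_id M := rfl
  map_comp f g := rfl

instance (R : Type u) [Ring R] [Algebra k R] : (ofModuleFunctor (k := k) R).Additive where
  map_add {M N f g} := rfl

end TensorFunctor

section EndBimod

variable {k : Type u} [Field k] {S : Alg k}
open Alg BiMod

/-- The endomorphism algebra of a left module. -/
def endAlg (X : BiMod k S.carrier k) : Subalgebra k (Module.End k X.V) :=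
  Subalgebra.centralizer k (Set.range X.lact)

/-- The algebra that acts from the right on a left module by endomorphisms. -/
abbrev EndOp (X : BiMod k S.carrier k) : Type u := (endAlg X)ᵐᵒᵖ

/-- A left module, as a bimodule over its endomorphisms. -/
def endBimod (X : BiMod k S.carrier k) : (⟨EndOp X⟩ : Alg k) ⟶ S :=
  ({ V := X.V
     lact := X.lact
     ract := (endAlg X).val.comp (AlgEquiv.opOp k (endAlg X)).symm.toAlgHom
     comm := fun s r x => LinearMap.congr_fun
      ((Subalgebra.mem_centralizer_iff k).1 r.unop.unop.2 (X.lact s) ⟨s, rfl⟩) x } :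
    BiMod k S.carrier (EndOp X))

/-- The functor `X ⊗_R -`, where `R` is the algebra of endomorphisms of `X`. -/
def tensorEnd (X : BiMod k S.carrier k) : ModuleCat.{u} (EndOp X) ⥤ (ground k ⟶ S) :=
  ofModuleFunctor (EndOp X) ⋙ postcomp (ground k) (endBimod X)

instance instAdditiveTensorEnd (X : BiMod k S.carrier k) : (tensorEnd X).Additive :=
  inferInstanceAs (ofModuleFunctor (EndOp X) ⋙ postcomp (ground k) (endBimod X)).Additive

instance instLinearTensorEnd (X : BiMod k S.carrier k) : (tensorEnd X).Linear k where
  map_smul f c := whiskerRight_smul c ((ofModuleFunctor (EndOp X)).map f) (endBimod X)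

lemma ofModule_smul (R : Type u) [Ring R] [Algebra k R] (c : k)
    (r : BiMod.V (ofModule (k := k) R (ModuleCat.of R R))) :
    c • r = (c • (show R from r) : R) :=
  (Algebra.smul_def c (show R from r)).symm

lemma BiMod.scalar_ract (X : BiMod k S.carrier k) (c : kᵐᵒᵖ) (x : X.V) :
    X.ract c x = c.unop • x := by
  have := AlgHom.commutes X.ract c.unop
  have h2 : algebraMap k kᵐᵒᵖ c.unop = c := rfl
  rw [h2] at this
  rw [this]; rfl

/-- The regular module over the endomorphisms of `X`. -/
abbrev endReg (X : BiMod k S.carrier k) : BiMod k (EndOp X) k :=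
  ofModule (EndOp X) (ModuleCat.of (EndOp X) (EndOp X))

/-- The elements of the regular module. -/
def endRegMk (X : BiMod k S.carrier k) (r : EndOp X) : (endReg X).V := r

lemma endReg_lact (X : BiMod k S.carrier k) (r s : EndOp X) :
    (endReg X).lact r (endRegMk X s) = endRegMk X (r * s) := rfl

/-- The map `X ⊗_R R ⟶ X`. -/
def tensorEndRegHom (X : BiMod k S.carrier k) :
    tensor (endBimod X) (endReg X) ⟶ X :=
  homLift (LinearMap.mk₂ k (fun (x : X.V) (r : EndOp X) => (r.unop : Module.End k X.V) x)
      (fun x y r => map_add _ _ _) (fun c x r => map_smul _ _ _) (fun x r s => rfl)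
      (fun c x r => congrArg (fun t : EndOp X => (t.unop : Module.End k X.V) x)
        (ofModule_smul (EndOp X) c r)))
    (fun s x r => rfl)
    (fun t x r => LinearMap.congr_fun
      ((Subalgebra.mem_centralizer_iff k).1 r.unop.2 (X.lact t) ⟨t, rfl⟩).symm x)
    (fun c x r => (congrArg (fun t : EndOp X => (t.unop : Module.End k X.V) x)
        (ofModule_smul (EndOp X) c.unop r)).trans (BiMod.scalar_ract X c _).symm)

lemma tensorEndRegHom_tm (X : BiMod k S.carrier k) (x : X.V) (r : EndOp X) :
    Hom.lin (tensorEndRegHom X) (tm (endBimod X) (endReg X) x (endRegMk X r)) =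
      (r.unop : Module.End k X.V) x :=
  homLift_tm (M := endBimod X) (N := endReg X) (L := X) _ _ _ _ x (endRegMk X r)

lemma tm_endRegMk (X : BiMod k S.carrier k) (x : X.V) (r : EndOp X) :
    tm (endBimod X) (endReg X) ((r.unop : Module.End k X.V) x) (endRegMk X 1) =
      tm (endBimod X) (endReg X) x (endRegMk X r) := by
  have h := tm_balanced (endBimod X) (endReg X) r x (endRegMk X 1)
  rw [endReg_lact, mul_one] at h
  exact h

/-- The isomorphism `X ⊗_R R ≅ X`. -/
def tensorEndReg (X : BiMod k S.carrier k) : tensor (endBimod X) (endReg X) ≅ X where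
  hom := tensorEndRegHom X
  inv := ⟨(tm (endBimod X) (endReg X)).flip (endRegMk X 1),
      fun s x => (tensor_lact_tm (endBimod X) (endReg X) s x (endRegMk X 1)).symm,
      fun c x => by
        rw [BiMod.scalar_ract, BiMod.scalar_ract]
        exact ((tm (endBimod X) (endReg X)).flip (endRegMk X 1)).map_smul _ _⟩
  hom_inv_id := tensor_hom_ext fun x r =>
    (congrArg (fun y => tm (endBimod X) (endReg X) y (endRegMk X 1))
      (tensorEndRegHom_tm X x r)).trans (tm_endRegMk X x r)
  inv_hom_id := hom_ext fun x => tensorEndRegHom_tm X x 1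

/-- Through `X ⊗_R R ≅ X`, the map `g` becomes an endomorphism of the left module `X`, that is, an
element of `R`; right multiplication by this element induces `g`. -/
lemma tensorEnd_full_reg (X : BiMod k S.carrier k)
    (g : (tensorEnd X).obj (ModuleCat.of (EndOp X) (EndOp X)) ⟶
      (tensorEnd X).obj (ModuleCat.of (EndOp X) (EndOp X))) :
    ∃ f : ModuleCat.of (EndOp X) (EndOp X) ⟶ ModuleCat.of (EndOp X) (EndOp X),
      (tensorEnd X).map f = g := by
  let g₁ : tensor (endBimod X) (endReg X) ⟶
    tensor (endBimod X) (endReg X) := g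
  let g' : X ⟶ X := (tensorEndReg X).inv ≫ g₁ ≫ (tensorEndReg X).hom
  have hg' : Hom.lin g' ∈ endAlg X := by
    rw [endAlg, Subalgebra.mem_centralizer_iff]
    rintro _ ⟨s, rfl⟩
    exact LinearMap.ext fun x => (Hom.map_l g' s x).symm
  let s : EndOp X := op ⟨Hom.lin g', hg'⟩
  refine ⟨ModuleCat.ofHom (LinearMap.toSpanSingleton (EndOp X) (EndOp X) s), ?_⟩
  have h : (tensorEndReg X).hom ≫ g' = g₁ ≫ (tensorEndReg X).hom :=
    Iso.hom_inv_id_assoc _ _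
  let g₂ : tensor (endBimod X) (endReg X) ⟶ tensor (endBimod X) (endReg X) := (tensorEnd X).map
    (ModuleCat.ofHom (LinearMap.toSpanSingleton (EndOp X) (EndOp X) s))
  change g₂ = g₁
  rw [← cancel_mono (tensorEndReg X).hom, ← h]
  refine tensor_hom_ext fun x r => ?_
  have h₂ := tensorEndRegHom_tm X x ((show EndOp X from r) * s)
  have h₃ := tensorEndRegHom_tm X x r
  exact h₂.trans (congrArg (Hom.lin g') h₃).symm

/-- An endomorphism of the regular module is determined by its value at `1`. If the induced map
vanishes, this value acts as zero on `X`, and hence is zero. -/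
lemma tensorEnd_faithful_reg (X : BiMod k S.carrier k)
    (f : ModuleCat.of (EndOp X) (EndOp X) ⟶ ModuleCat.of (EndOp X) (EndOp X))
    (hf : (tensorEnd X).map f = 0) : f = 0 := by
  let s : EndOp X := f.hom (1 : EndOp X)
  have hs : s = 0 := by
    apply unop_injective
    refine Subtype.ext (LinearMap.ext fun x => ?_)
    have h : tm (endBimod X) (endReg X) x (endRegMk X s) = 0 :=
      LinearMap.congr_fun (congrArg Hom.lin hf) (tm (endBimod X)
        (endReg X) x (endRegMk X 1))
    have h' := congrArg (Hom.lin (tensorEndRegHom X)) h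
    rw [map_zero] at h'
    exact (tensorEndRegHom_tm X x s).symm.trans h'
  refine ModuleCat.hom_ext (LinearMap.ext fun (r : EndOp X) => ?_)
  have : f.hom (r • (1 : EndOp X)) = r • s := f.hom.map_smul r 1
  rw [hs, smul_zero, smul_eq_mul, mul_one] at this
  exact this

end EndBimod

/-! ### Equivalence of the explicit model with finitely generated projective modules -/

section Finitary

lemma iso_conj_inv_conj {C : Type*} [Category* C] {X Y : C} (m : X ≅ Y) (t : X ⟶ X) :
    m.hom ≫ (m.inv ≫ t ≫ m.hom) ≫ m.inv = t := by
  simp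

variable {k : Type u} [Field k] {n : ℕ}
  {P : Finpartition (Finset.univ : Finset (Fin (n + 1)))} {E : BlockEnumeration P}
open Bim Alg BlockEnumeration BiMod

variable (E) in
open scoped Classical in
/-- The first elements of the blocks. -/
def roots : Finset (Fin (n + 1)) := Finset.univ.filter fun j => ∃ p : E.Slot, p.root.val = j

lemma root_mem_roots (p : E.Slot) : p.root.val ∈ roots E := by
  classical
  exact Finset.mem_filter.2 ⟨Finset.mem_univ _, p, rfl⟩

variable (k) in
/-- The sum of the idempotents `e_j` over a set. -/
def idem (s : Finset (Fin (n + 1))) : StarAlg k n := ∑ j ∈ s, StarAlg.e k n j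

lemma e_mul_idem {s : Finset (Fin (n + 1))} {j : Fin (n + 1)} (hj : j ∈ s) :
    StarAlg.e k n j * idem k s = StarAlg.e k n j := by
  rw [idem, Finset.mul_sum, Finset.sum_eq_single_of_mem j hj, StarAlg.e_mul_self]
  exact fun l _ hl => StarAlg.e_mul_of_ne k hl.symm

lemma idem_mul_idem (s : Finset (Fin (n + 1))) : idem k s * idem k s = idem k s := by
  conv_lhs => rw [idem, Finset.sum_mul]
  exact Finset.sum_congr rfl fun j hj => e_mul_idem hj

variable (k) in
/-- The direct sum of the modules `A e_j` over a set. -/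
def sumAe (s : Finset (Fin (n + 1))) : ground k ⟶ A k n := leftIdeal k (idem k s)

variable (k) in
/-- The inclusion of a summand. -/
def sumAeIncl {s : Finset (Fin (n + 1))} {j : Fin (n + 1)} (hj : j ∈ s) : Ae k j ⟶ sumAe k s :=
  rightMul (StarAlg.e k n j) (idem k s) (StarAlg.e k n j) (e_mul_idem hj)

variable (k) in
/-- The projection to a summand. -/
def sumAeProj (s : Finset (Fin (n + 1))) (j : Fin (n + 1)) : sumAe k s ⟶ Ae k j :=
  rightMul (idem k s) (StarAlg.e k n j) (StarAlg.e k n j) (StarAlg.e_mul_self k j)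

lemma sumAeIncl_proj {s : Finset (Fin (n + 1))} {j : Fin (n + 1)} (hj : j ∈ s) :
    sumAeIncl k hj ≫ sumAeProj k s j = 𝟙 _ := by
  refine (rightMul_comp _ _ _ _ _ _ _).trans (rightMul_eq_id _ _ (StarAlg.e_mul_self k j) _ ?_)
  rw [StarAlg.e_mul_self, StarAlg.e_mul_self]

lemma sum_sumAeProj_incl (s : Finset (Fin (n + 1))) :
    ∑ j : s, sumAeProj k s j ≫ sumAeIncl k j.2 = 𝟙 (sumAe k s) := by
  have h : ∀ j : s, sumAeProj k s j ≫ sumAeIncl k j.2 =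
      rightMul (idem k s) (idem k s) (StarAlg.e k n j) (e_mul_idem j.2) := fun j =>
    (rightMul_comp _ _ _ _ _ _ _).trans (by congr 1; exact StarAlg.e_mul_self k _)
  simp only [h]
  refine (rightMul_sum Finset.univ _ _ (fun j : s => StarAlg.e k n j) _).trans
    (rightMul_eq_id _ _ (idem_mul_idem s) _ ?_)
  rw [Finset.sum_coe_sort s (fun j => StarAlg.e k n j)]
  exact idem_mul_idem s

lemma inAdd_sumAe_roots : InAdd (fun p : E.Slot => Ae k p.root.val) (sumAe k (roots E)) := by
  classical
  have h : ∀ j : roots E, ∃ p : E.Slot, p.root.val = j := fun j => (Finset.mem_filter.1 j.2).2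
  have h₁ : InAdd (fun j : roots E => Ae k (n := n) j) (sumAe k (roots E)) :=
    ⟨roots E, inferInstance, id, _, _, sum_sumAeProj_incl (roots E)⟩
  refine h₁.trans fun j => ?_
  obtain ⟨p, hp⟩ := h j
  rw [← hp]
  exact InAdd.of_mem (G := fun p : E.Slot => Ae k p.root.val) p

variable (k E) in
/-- The direct sum of the modules `A e_j`, for the first elements of the blocks. -/
def rootObj : (IsProj k n).FullSubcategory :=
  ⟨sumAe k (roots E), inAdd_sumAe_roots.trans fun _ => isProj_Ae k n _⟩

variable (i : StarB k n)

/-- All entries of `f` are morphisms between roots, which lift to `A-proj` by the normal form. -/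
lemma exists_wrQ_rootObj (f : (wrQ E i).obj (rootObj k E) ⟶ (wrQ E i).obj (rootObj k E)) :
    ∃ g, (wrQ E i).map g = f := by
  have h : InAdd (fun p : E.Slot => AeObj k p.root.val) (rootObj k E) :=
    InAdd.fullSubcategory inAdd_sumAe_roots
  refine InAdd.exists_map_eq (wrQ E i) h h f fun p q u v => ?_
  obtain ⟨g, hg⟩ := exists_wrQ_eq_of_mem_slotHom i (isSpanned i f p.root q.root u v)
  exact ⟨g, hg.symm⟩

/-- Each `A e_p` becomes isomorphic in the model to the module of the root of its block, which is a
retract of `rootObj`. -/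
lemma inAdd_rootObj (Y : (IsProj k n).FullSubcategory) :
    InAdd (fun _ : Unit => (wrQ E i).obj (rootObj k E)) ((wrQ E i).obj Y) := by
  refine (inAdd_wrQ_slot E i Y).trans fun p => InAdd.of_iso (slotIso i p) ?_
  let a : AeObj k p.root.val ⟶ rootObj k E :=
    ObjectProperty.homMk (sumAeIncl k (root_mem_roots p))
  let b : rootObj k E ⟶ AeObj k p.root.val := ObjectProperty.homMk (sumAeProj k (roots E) _)
  have hab : a ≫ b = 𝟙 _ := ObjectProperty.hom_ext _ (sumAeIncl_proj (root_mem_roots p))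
  refine InAdd.of_retract ((wrQ E i).map a) ((wrQ E i).map b) ?_
    (InAdd.of_mem (G := fun _ : Unit => (wrQ E i).obj (rootObj k E)) ())
  rw [← Functor.map_comp, hab, CategoryTheory.Functor.map_id]

variable (k E) in
/-- The algebra of endomorphisms of `rootObj`. -/
abbrev RootAlg : Type u := EndOp (S := A k n) (rootObj k E).obj

variable (k E) in
/-- The functor from finitely generated projective modules to `A-proj`. -/
def rootFunctor₀ : FGProj (RootAlg k E) ⥤ (ground k ⟶ A k n) :=
  ObjectProperty.ι _ ⋙ tensorEnd (S := A k n) (rootObj k E).obj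

instance : (rootFunctor₀ k E).Additive where
  map_add {M N f g} :=
    have h := instAdditiveTensorEnd (S := A k n) (rootObj k E).obj
    h.map_add (f := f.hom) (g := g.hom)

instance : (rootFunctor₀ k E).Linear k where
  map_smul f c :=
    have h := instLinearTensorEnd (S := A k n) (rootObj k E).obj
    h.map_smul f.hom c

variable (k E) in
/-- The image of the regular module. -/
def rootReg : (rootFunctor₀ k E).obj (FGProj.reg (RootAlg k E)) ≅ (rootObj k E).obj :=
  tensorEndReg (S := A k n) (rootObj k E).obj

variable (k E) in
/-- The functor from finitely generated projective modules to `A-proj`. -/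
def rootFunctor : FGProj (RootAlg k E) ⥤ (IsProj k n).FullSubcategory :=
  (IsProj k n).lift (rootFunctor₀ k E) fun M => ((FGProj.inAdd_reg M).map (rootFunctor₀ k E)).trans
    fun _ => InAdd.of_iso (rootReg k E) (rootObj k E).property

instance : (rootFunctor k E).Additive where
  map_add {M N f g} := ObjectProperty.hom_ext _ ((rootFunctor₀ k E).map_add (f := f) (g := g))

instance : (rootFunctor k E).Linear k where
  map_smul f c := ObjectProperty.hom_ext _ ((rootFunctor₀ k E).map_smul c f)

variable (k E) in
/-- The image of the regular module. -/
def rootFunctorReg : (rootFunctor k E).obj (FGProj.reg (RootAlg k E)) ≅ rootObj k E :=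
  ObjectProperty.isoMk _ (rootReg k E)

lemma rootFunctor_full_reg (g : (rootFunctor k E).obj (FGProj.reg (RootAlg k E)) ⟶
    (rootFunctor k E).obj (FGProj.reg (RootAlg k E))) : ∃ f, (rootFunctor k E).map f = g := by
  obtain ⟨f, hf⟩ := tensorEnd_full_reg (S := A k n) (rootObj k E).obj g.hom
  exact ⟨ObjectProperty.homMk f, ObjectProperty.hom_ext _ hf⟩

lemma rootFunctor_faithful_reg (f : FGProj.reg (RootAlg k E) ⟶ FGProj.reg (RootAlg k E))
    (hf : (rootFunctor k E).map f = 0) : f = 0 :=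
  ObjectProperty.hom_ext _ (tensorEnd_faithful_reg (S := A k n) (rootObj k E).obj f.hom
    (congrArg (fun t => t.hom) hf))

variable (E) in
/-- The functor from finitely generated projective modules to `C^{WR}`. -/
def wrFunctor : FGProj (RootAlg k E) ⥤ WR E i := rootFunctor k E ⋙ wrQ E i

instance : (wrFunctor E i).Additive := inferInstanceAs (rootFunctor k E ⋙ wrQ E i).Additive

instance : (wrFunctor E i).Linear k := inferInstanceAs ((rootFunctor k E ⋙ wrQ E i).Linear k)

instance : (wrFunctor E i).Faithful where
  map_injective {M N f g} h := by
    rw [← sub_eq_zero]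
    -- Fullness and faithfulness need only be checked on endomorphisms of the regular module, which
    -- generates all finitely generated projective modules.
    refine (FGProj.inAdd_reg M).eq_zero (FGProj.inAdd_reg N) _ fun _ _ u v =>
      rootFunctor_faithful_reg _ (wrQ_eq_zero (E := E) i _ ?_)
    change (wrFunctor E i).map (u ≫ (f - g) ≫ v) = 0
    rw [Functor.map_comp, Functor.map_comp, Functor.map_sub, h, sub_self, Limits.zero_comp,
      Limits.comp_zero]

instance : (wrFunctor E i).Full where
  map_surjective {M N} f := by
    refine InAdd.exists_map_eq (wrFunctor E i) (FGProj.inAdd_reg M) (FGProj.inAdd_reg N) f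
      fun _ _ u v => ?_
    generalize (wrFunctor E i).map u ≫ f ≫ (wrFunctor E i).map v = t
    -- An entry is lifted in two stages, first through `wrQ` to an endomorphism of `rootObj`, then
    -- to an endomorphism of the regular module.
    obtain ⟨s, hs⟩ := exists_wrQ_rootObj i ((wrQ E i).map (rootFunctorReg k E).inv ≫ t ≫
      (wrQ E i).map (rootFunctorReg k E).hom)
    obtain ⟨r, hr⟩ := rootFunctor_full_reg
      ((rootFunctorReg k E).hom ≫ s ≫ (rootFunctorReg k E).inv)
    refine ⟨r, ?_⟩
    change (wrQ E i).map ((rootFunctor k E).map r) = t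
    rw [hr, Functor.map_comp, Functor.map_comp, hs]
    exact iso_conj_inv_conj ((wrQ E i).mapIso (rootFunctorReg k E)) t

instance : (wrFunctor E i).EssSurj :=
  essSurj_of_inAdd (wrFunctor E i) (FGProj.reg (RootAlg k E)) (fun J _ => FGProj.exists_sum J)
    FGProj.exists_split fun Y => (inAdd_rootObj i Y.as.as).trans fun _ =>
      InAdd.of_iso ((wrQ E i).mapIso (rootFunctorReg k E).symm)
        (InAdd.of_mem (G := fun _ : Unit => (wrFunctor E i).obj (FGProj.reg (RootAlg k E))) ())

/-- The algebra consists of endomorphisms of a finite dimensional module, so it is finite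
dimensional. The required equivalence is the inverse of `wrFunctor`. -/
lemma wr_isFinitary : ((wrConstruction k E).CWR.toPseudofunctor.obj i).IsFinitary := by
  have : (wrFunctor E i).IsEquivalence := { }
  let e := (wrFunctor E i).asEquivalence
  have h₁ : e.functor.Additive := inferInstanceAs (wrFunctor E i).Additive
  have h₂ : e.functor.Linear k := inferInstanceAs ((wrFunctor E i).Linear k)
  have : Module.Finite k (BiMod.V (rootObj k E).obj) :=
    inferInstanceAs (Module.Finite k (leftIdeal k (idem k (roots E))).V)
  exact ⟨RootAlg k E, inferInstance, inferInstance, inferInstance, e.inverse, inferInstance,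
    inferInstance, inferInstance⟩

end Finitary

lemma wrConstruction_isSimpleTransitive {k : Type u} [Field k] {n : ℕ}
    {P : Finpartition (Finset.univ : Finset (Fin (n + 1)))} (E : BlockEnumeration P) :
    (wrConstruction k E).CWR.IsSimpleTransitive where
  finitary i := wr_isFinitary i
  nonzero := ⟨⟨⟩, (wrQ E ⟨⟩).obj (AeObj k 0), wr_nonzero ⟨⟩⟩
  not_isProper := wr_not_isProper

end StarBirep

end

theorem mainTheorem3 {k : Type u} [Field k] [IsAlgClosed k] [CharZero k] (n : ℕ) (hn : 0 < n)
    (P : Finpartition (Finset.univ : Finset (Fin (n + 1)))) (h0 : {0} ∈ P.parts)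
    (E : StarBirep.BlockEnumeration P) :
    Nonempty (StarBirep.WRConstruction k E) ∧
      ∀ D : StarBirep.WRConstruction k E, D.CWR.IsSimpleTransitive :=
  ⟨⟨StarBirep.wrConstruction k E⟩, fun D => D.isSimpleTransitive (StarBirep.wrConstruction k E)
    (StarBirep.wrConstruction_isSimpleTransitive E)⟩
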